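/- There are a program for the real random access machine and a constant $C$ such that the following holds for all inputs described here. The input consists of real numbers $\delta>0$ and $0<\varepsilon\le 1$, two one-dimensional curves $\pi=(\pi_1,\dots,\pi_n)$ and $\sigma=(\sigma_1,\dots,\sigma_m)$ with $n,m\ge 1$ real vertices that are separated, i.e. $\pi_i\ge 0\ge\sigma_j$ for all $i,j$, such that all vertices are integral multiples of $\tfrac13\varepsilon\delta$, and an entry set $E\subseteq[1..n]$, where $[a..b]=\{a,a+1,\dots,b\}$. The program halts after at most $C\,(n+m)\,(1+\log(1/\varepsilon))$ steps, and its output is the pair of exit sets $$F^\pi=\{f\in[1..n] : d_{\mathrm{dF}}(\pi_{e..f},\sigma)\le\delta\text{ for some } e\in E,\ e\le f\},$$ $$F^\sigma=\{f\in[1..m] : d_{\mathrm{dF}}(\pi_{e..n},\sigma_{1..f})\le\delta\text{ for some } e\in E\}.$$ That is, the reduced free-space problem can be solved in time $\mathcal O((n+m)\log(1/\varepsilon))$, where the logarithmic factor is read as $1+\log(1/\varepsilon)$ so that the bound makes sense for $\varepsilon$ near $1$. Here the discrete Fréchet distance of $\pi_{p..b}=(\pi_p,\dots,\pi_b)$ and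 $\sigma_{q..d}=(\sigma_q,\dots,\sigma_d)$ is $$d_{\mathrm{dF}}(\pi_{p..b},\sigma_{q..d})=\inf_{\varphi,\psi}\ \max_{t\in[0,1]}|\pi_{\varphi(t)}-\sigma_{\psi(t)}|,$$ where $\varphi$ and $\psi$ range over all non-decreasing functions from $[0,1]$ onto $[p..b]$ and onto $[q..d]$, respectively. The machine has registers and arrays holding natural numbers (used as indices, with addition, truncated subtraction and comparison) and registers and arrays holding real numbers (with rational constants, $+,-,\cdot,/$ and comparison, but without rounding); every such operation and every memory access, also at a computed index, takes one step. $E$, $F^\pi$ and $F^\sigma$ are represented by arrays of natural numbers whose nonzero positions are the elements of the set; initially, all memory that does not hold the input is zero. -/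

import Mathlib

open scoped ENNReal

/-! ## The real random access machine

A machine has registers and one-way infinite arrays of two sorts: natural numbers and real numbers.
A program is a finite piece of syntax that does not depend on the input. The cost of an execution
is the number of elementary operations (constants, register and array accesses, arithmetic
operations, comparisons, writes, jumps) that it performs. -/

namespace RealRAM

/-- The memory: natural and real registers, natural and real arrays (all named by numbers). -/
structure State where
  natReg : ℕ → ℕ
  realReg : ℕ → ℝ
  natArr : ℕ → ℕ → ℕ
  realArr : ℕ → ℕ → ℝ

/-- Index expressions: constants, registers, addition, truncated subtraction, and reading the
entry of an array at a computed position. There is no multiplication and no rounding. -/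
inductive NatExp where
  | const (k : ℕ)
  | reg (x : ℕ)
  | add (e₁ e₂ : NatExp)
  | sub (e₁ e₂ : NatExp)
  | get (a : ℕ) (i : NatExp)

/-- Real expressions: rational constants, registers, field operations, and array entries. There is
no floor function and no conversion of a real number into an index. -/
inductive RealExp where
  | const (r : ℚ)
  | reg (x : ℕ)
  | add (e₁ e₂ : RealExp)
  | sub (e₁ e₂ : RealExp)
  | mul (e₁ e₂ : RealExp)
  | div (e₁ e₂ : RealExp)
  | get (a : ℕ) (i : NatExp)

/-- Tests: comparisons of numbers of one sort, and their Boolean combinations. -/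
inductive Test where
  | natLe (e₁ e₂ : NatExp)
  | realLe (e₁ e₂ : RealExp)
  | not (b : Test)
  | and (b₁ b₂ : Test)

/-- Programs. -/
inductive Cmd where
  | skip
  | setNat (x : ℕ) (e : NatExp)
  | setReal (x : ℕ) (e : RealExp)
  | putNat (a : ℕ) (i e : NatExp)
  | putReal (a : ℕ) (i : NatExp) (e : RealExp)
  | seq (c₁ c₂ : Cmd)
  | ite (b : Test) (c₁ c₂ : Cmd)
  | loop (b : Test) (c : Cmd)

/-- Value of an index expression. -/
def NatExp.eval (s : State) : NatExp → ℕ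
  | .const k => k
  | .reg x => s.natReg x
  | .add e₁ e₂ => e₁.eval s + e₂.eval s
  | .sub e₁ e₂ => e₁.eval s - e₂.eval s
  | .get a i => s.natArr a (i.eval s)

/-- Number of operations for evaluating an index expression. -/
def NatExp.cost : NatExp → ℕ
  | .const _ => 1
  | .reg _ => 1
  | .add e₁ e₂ => e₁.cost + e₂.cost + 1
  | .sub e₁ e₂ => e₁.cost + e₂.cost + 1
  | .get _ i => i.cost + 1

/-- Value of a real expression (the machine returns `0` on a division by zero). -/
noncomputable def RealExp.eval (s : State) : RealExp → ℝ
  | .const r => (r : ℝ)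
  | .reg x => s.realReg x
  | .add e₁ e₂ => e₁.eval s + e₂.eval s
  | .sub e₁ e₂ => e₁.eval s - e₂.eval s
  | .mul e₁ e₂ => e₁.eval s * e₂.eval s
  | .div e₁ e₂ => e₁.eval s / e₂.eval s
  | .get a i => s.realArr a (i.eval s)

/-- Number of operations for evaluating a real expression. -/
def RealExp.cost : RealExp → ℕ
  | .const _ => 1
  | .reg _ => 1
  | .add e₁ e₂ => e₁.cost + e₂.cost + 1
  | .sub e₁ e₂ => e₁.cost + e₂.cost + 1
  | .mul e₁ e₂ => e₁.cost + e₂.cost + 1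
  | .div e₁ e₂ => e₁.cost + e₂.cost + 1
  | .get _ i => i.cost + 1

/-- The test succeeds in the given memory. -/
def Test.holds (s : State) : Test → Prop
  | .natLe e₁ e₂ => e₁.eval s ≤ e₂.eval s
  | .realLe e₁ e₂ => e₁.eval s ≤ e₂.eval s
  | .not b => ¬ b.holds s
  | .and b₁ b₂ => b₁.holds s ∧ b₂.holds s

/-- Number of operations for evaluating a test. -/
def Test.cost : Test → ℕ
  | .natLe e₁ e₂ => e₁.cost + e₂.cost + 1
  | .realLe e₁ e₂ => e₁.cost + e₂.cost + 1
  | .not b => b.cost + 1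
  | .and b₁ b₂ => b₁.cost + b₂.cost + 1

/-- Write `v` at position `i` of the array named `a`. -/
def write {α : Type} (A : ℕ → ℕ → α) (a i : ℕ) (v : α) : ℕ → ℕ → α :=
  Function.update A a (Function.update (A a) i v)

/-- `Exec c s t s'`: started in memory `s`, the program `c` halts after exactly `t` operations
with memory `s'`. -/
inductive Exec : Cmd → State → ℕ → State → Prop where
  | skip (s : State) : Exec .skip s 1 s
  | setNat (s : State) (x : ℕ) (e : NatExp) :
      Exec (.setNat x e) s (e.cost + 1)
        { s with natReg := Function.update s.natReg x (e.eval s) }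
  | setReal (s : State) (x : ℕ) (e : RealExp) :
      Exec (.setReal x e) s (e.cost + 1)
        { s with realReg := Function.update s.realReg x (e.eval s) }
  | putNat (s : State) (a : ℕ) (i e : NatExp) :
      Exec (.putNat a i e) s (i.cost + e.cost + 1)
        { s with natArr := write s.natArr a (i.eval s) (e.eval s) }
  | putReal (s : State) (a : ℕ) (i : NatExp) (e : RealExp) :
      Exec (.putReal a i e) s (i.cost + e.cost + 1)
        { s with realArr := write s.realArr a (i.eval s) (e.eval s) }
  | seq {c₁ c₂ : Cmd} {s s' s'' : State} {t₁ t₂ : ℕ} (h₁ : Exec c₁ s t₁ s')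
      (h₂ : Exec c₂ s' t₂ s'') : Exec (.seq c₁ c₂) s (t₁ + t₂) s''
  | iteTrue {b : Test} {c₁ c₂ : Cmd} {s s' : State} {t : ℕ} (hb : b.holds s)
      (h : Exec c₁ s t s') : Exec (.ite b c₁ c₂) s (b.cost + 1 + t) s'
  | iteFalse {b : Test} {c₁ c₂ : Cmd} {s s' : State} {t : ℕ} (hb : ¬ b.holds s)
      (h : Exec c₂ s t s') : Exec (.ite b c₁ c₂) s (b.cost + 1 + t) s'
  | loopDone {b : Test} {c : Cmd} {s : State} (hb : ¬ b.holds s) :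
      Exec (.loop b c) s (b.cost + 1) s
  | loopStep {b : Test} {c : Cmd} {s s' s'' : State} {t₁ t₂ : ℕ} (hb : b.holds s)
      (h₁ : Exec c s t₁ s') (h₂ : Exec (.loop b c) s' t₂ s'') :
      Exec (.loop b c) s (b.cost + 1 + t₁ + t₂) s''

/-- The machine is deterministic: running time and final memory are determined by the program and
the initial memory. -/
theorem Exec.deterministic {c : Cmd} {s s₁ s₂ : State} {t₁ t₂ : ℕ} (h₁ : Exec c s t₁ s₁)
    (h₂ : Exec c s t₂ s₂) : t₁ = t₂ ∧ s₁ = s₂ := by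
  induction h₁ generalizing t₂ s₂ with
  | skip | setNat | setReal | putNat | putReal => cases h₂; exact ⟨rfl, rfl⟩
  | seq _ _ ih ih' =>
    cases h₂ with
    | seq k k' =>
      obtain ⟨rfl, rfl⟩ := ih k
      obtain ⟨rfl, rfl⟩ := ih' k'
      exact ⟨rfl, rfl⟩
  | iteTrue hb _ ih =>
    cases h₂ with
    | iteTrue _ k => obtain ⟨rfl, rfl⟩ := ih k; exact ⟨rfl, rfl⟩
    | iteFalse hb' _ => exact absurd hb hb'
  | iteFalse hb _ ih =>
    cases h₂ with
    | iteTrue hb' _ => exact absurd hb' hb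
    | iteFalse _ k => obtain ⟨rfl, rfl⟩ := ih k; exact ⟨rfl, rfl⟩
  | loopDone hb =>
    cases h₂ with
    | loopDone => exact ⟨rfl, rfl⟩
    | loopStep hb' => exact absurd hb' hb
  | loopStep hb _ _ ih ih' =>
    cases h₂ with
    | loopDone hb' => exact absurd hb hb'
    | loopStep _ k k' =>
      obtain ⟨rfl, rfl⟩ := ih k
      obtain ⟨rfl, rfl⟩ := ih' k'
      exact ⟨rfl, rfl⟩

end RealRAM

/-! ## Discrete Fréchet distance of one-dimensional curves

A curve with `n` vertices is given by a sequence `π : ℕ → ℝ` of which only the entries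
`π 1, …, π n` matter. -/

/-- `φ` is a non-decreasing function from `[0,1]` onto `[p..b]`. -/
def IsDiscreteParam (p b : ℕ) (φ : unitInterval → ℕ) : Prop :=
  Monotone φ ∧ Set.range φ = Set.Icc p b

/-- The discrete Fréchet distance of the subcurves `π_{p..b}` and `σ_{q..d}`: the infimum of the
widths of their discrete traversals. (It is `∞` if one of the subcurves has no vertex.) -/
noncomputable def discreteFrechetDist (π : ℕ → ℝ) (p b : ℕ) (σ : ℕ → ℝ) (q d : ℕ) : ℝ≥0∞ :=
  ⨅ (φ : unitInterval → ℕ) (_ : IsDiscreteParam p b φ)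
    (ψ : unitInterval → ℕ) (_ : IsDiscreteParam q d ψ),
    ⨆ t : unitInterval, edist (π (φ t)) (σ (ψ t))

/-! ## The reduced free-space problem -/

/-- The admissible inputs: a distance `δ`, a precision `ε`, one-dimensional curves `π_{1..n}` and
`σ_{1..m}` that are separated by `0` and whose vertices are integral multiples of `εδ/3`, and a set
`E ⊆ [1..n]` of entries. -/
structure IsReducedFreeSpaceInstance (n m : ℕ) (π σ : ℕ → ℝ) (δ ε : ℝ) (E : Finset ℕ) :
    Prop where
  one_le_n : 1 ≤ n
  one_le_m : 1 ≤ m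
  delta_pos : 0 < δ
  eps_pos : 0 < ε
  eps_le_one : ε ≤ 1
  pi_nonneg : ∀ i ∈ Finset.Icc 1 n, 0 ≤ π i
  sigma_nonpos : ∀ j ∈ Finset.Icc 1 m, σ j ≤ 0
  pi_multiple : ∀ i ∈ Finset.Icc 1 n, ∃ k : ℤ, π i = k * (ε * δ / 3)
  sigma_multiple : ∀ j ∈ Finset.Icc 1 m, ∃ k : ℤ, σ j = k * (ε * δ / 3)
  entries_subset : E ⊆ Finset.Icc 1 n

/-- The exits on `π`: all `f ∈ [1..n]` such that `π_{e..f}` and `σ` have discrete Fréchet distance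
at most `δ` for some entry `e ≤ f`. -/
def exitsOnPi (n m : ℕ) (π σ : ℕ → ℝ) (δ : ℝ) (E : Finset ℕ) : Set ℕ :=
  {f | f ∈ Set.Icc 1 n ∧
    ∃ e ∈ E, e ≤ f ∧ discreteFrechetDist π e f σ 1 m ≤ ENNReal.ofReal δ}

/-- The exits on `σ`: all `f ∈ [1..m]` such that `π_{e..n}` and `σ_{1..f}` have discrete Fréchet
distance at most `δ` for some entry `e`. -/
def exitsOnSigma (n m : ℕ) (π σ : ℕ → ℝ) (δ : ℝ) (E : Finset ℕ) : Set ℕ :=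
  {f | f ∈ Set.Icc 1 m ∧
    ∃ e ∈ E, discreteFrechetDist π e n σ 1 f ≤ ENNReal.ofReal δ}

/-- The initial memory: natural registers `0`, `1` hold `n`, `m`; real registers `0`, `1` hold `δ`,
`ε`; real arrays `0`, `1` hold `π_1, …, π_n` and `σ_1, …, σ_m`; natural array `0` holds the
characteristic function of `E`; everything else is `0`. -/
noncomputable def reducedFreeSpaceInput (n m : ℕ) (π σ : ℕ → ℝ) (δ ε : ℝ) (E : Finset ℕ) :
    RealRAM.State where
  natReg x := if x = 0 then n else if x = 1 then m else 0
  realReg x := if x = 0 then δ else if x = 1 then ε else 0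
  natArr a i := if a = 0 ∧ i ∈ E then 1 else 0
  realArr a i :=
    if a = 0 ∧ i ∈ Finset.Icc 1 n then π i
    else if a = 1 ∧ i ∈ Finset.Icc 1 m then σ i else 0

/-- The set stored in a natural array of the final memory, as the set of its nonzero positions. -/
def RealRAM.State.output (s : RealRAM.State) (a : ℕ) : Set ℕ := {f | s.natArr a f ≠ 0}

/-!
For separated curves, `|π_i - σ_j| = a_i + b_j` with `a = π ≥ 0` and `b = -σ ≥ 0`, and the discrete
Fréchet distance of two subcurves is at most `δ` if and only if the grid of *free* cells
`a_i + b_j ≤ δ` contains a path of steps to the right and up between two corners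
(`discreteFrechetDist_le_iff`). Diagonal steps are not needed, because the two pairs of opposite
corners of a unit square have the same sum of distances.

Since the distances are sums, a path must cross a row of maximal `b` in a column that is free
altogether, and every column that it passes must contain a free cell. Conversely, suppose that
some column is full and no column is blocked. A lowest row is then free throughout, so the full
column and the lowest row form a cross, and it remains to decide whether the entry reaches the
cross and whether the cross reaches the exit. Either is a property of the entry, respectively the
exit, alone: reading the curve backwards from the entry, the `barrier` is the highest level from
which the last strict prefix minimum of the read vertices cannot be reached. It obeys a
recursion along the curve (`barrier`), and an entry or exit is connected to the cross exactly if
its barrier is `0` (`barrier_lt_of_path` and `descendPath_of_barrier_lt`). This gives the exit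
criteria `risePath_top_iff` and `risePath_right_iff`.

One step of the recursion asks for the last position, in a prefix of a sequence, at which the
sequence exceeds a threshold. Chains of pointers to previous greater entries have strictly
increasing values. After `clip`, which moves vertices of height more than `δ` to height `2 * δ`, the
vertices take only `O(1 / ε)` values (`card_valueSet_le`), so the chains have length `O(1 / ε)`.
Tables of the `2 ^ l`-th ancestors, `l < L = O(1 + log (1 / ε))`, therefore answer each query in
`O(L)` steps (`queryCmd`), and are built in `O(L)` steps per vertex (`buildCmd`). Three passes
compute the barriers of the entries, of the exits on `π`, and of the exits on `σ`. Finally, for each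
exit, the best entry is the last one of barrier `0` before the last full column, and it has to come
after the last blocked column (`lt_isLast_iff`). As the exit advances on `π`, both columns are
updated directly; as it advances on `σ`, both only move to the left, so that two-pointer scans find
all exits in linear time.

The programs share the following memory layout, next to the input and the results. Real arrays `2`
and `3` hold the clipped positions and levels of a pass, `p` and `q` many as given by natural
registers `2` and `3`, and real array `4` the sequence that is being queried, with a sentinel at
position `0`. Natural array `3` is the table of ancestors, in rows of width `W` (natural register
`4`) and of total size `L * W` (register `5`); a query uses registers `6` and `7` and the threshold
in real register `2`. Natural register `8` is the counter of all `forUpTo` loops. Natural array `4`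
holds the numbers of leading blocked levels, array `5` the barriers and array `6` the last good
entries.
-/

/-! ### Last exceedances and prefix minima -/

/-- The last position in `[1..d]` at which `v` exceeds `τ`, and `0` if there is none. -/
noncomputable def lastAbove (v : ℕ → ℝ) (τ : ℝ) : ℕ → ℕ
  | 0 => 0
  | d + 1 => if τ < v (d + 1) then d + 1 else lastAbove v τ d

theorem lastAbove_le (v : ℕ → ℝ) (τ : ℝ) (d : ℕ) : lastAbove v τ d ≤ d := by
  induction d with
  | zero => simp [lastAbove]
  | succ d ih =>
    rw [lastAbove]
    split_ifs <;> omega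

theorem lastAbove_lt_iff {v : ℕ → ℝ} {τ : ℝ} {d j : ℕ} (hj : 1 ≤ j) :
    lastAbove v τ d < j ↔ ∀ k, j ≤ k → k ≤ d → v k ≤ τ := by
  induction d with
  | zero =>
    simp only [lastAbove]
    exact ⟨fun _ k h1 h2 => by omega, fun _ => by omega⟩
  | succ d ih =>
    rw [lastAbove]
    split_ifs with h
    · constructor
      · intro h' k h1 h2
        omega
      · intro h'
        by_contra hlt
        exact absurd (h' (d + 1) (by omega) le_rfl) (not_le.2 h)
    · rw [ih]
      constructor
      · intro h' k h1 h2
        rcases Nat.lt_or_ge d k with h3 | h3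
        · obtain rfl : k = d + 1 := by omega
          exact not_lt.1 h
        · exact h' k h1 h3
      · intro h' k h1 h2
        exact h' k h1 (by omega)

theorem lastAbove_congr {v w : ℕ → ℝ} {τ : ℝ} {d : ℕ} (h : ∀ k, 1 ≤ k → k ≤ d → v k = w k) :
    lastAbove v τ d = lastAbove w τ d := by
  induction d with
  | zero => rfl
  | succ d ih =>
    rw [lastAbove, lastAbove, h (d + 1) (by omega) le_rfl, ih fun k h1 h2 => h k h1 (by omega)]

/-- The minimum of `M` and `v 1, …, v j`. -/
noncomputable def prefixMin (M : ℝ) (v : ℕ → ℝ) : ℕ → ℝ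
  | 0 => M
  | j + 1 => min (prefixMin M v j) (v (j + 1))

theorem lt_prefixMin_iff {M τ : ℝ} {v : ℕ → ℝ} {j : ℕ} :
    τ < prefixMin M v j ↔ τ < M ∧ ∀ k, 1 ≤ k → k ≤ j → τ < v k := by
  induction j with
  | zero =>
    simp only [prefixMin]
    exact ⟨fun h => ⟨h, fun k h1 h2 => by omega⟩, fun h => h.1⟩
  | succ j ih =>
    rw [prefixMin, lt_min_iff, ih]
    constructor
    · rintro ⟨⟨h1, h2⟩, h3⟩
      refine ⟨h1, fun k hk hkj => ?_⟩
      rcases Nat.lt_or_ge j k with h4 | h4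
      · obtain rfl : k = j + 1 := by omega
        exact h3
      · exact h2 k hk h4
    · rintro ⟨h1, h2⟩
      exact ⟨⟨h1, fun k hk hkj => h2 k hk (by omega)⟩, h2 (j + 1) (by omega) le_rfl⟩

theorem prefixMin_congr {M : ℝ} {v w : ℕ → ℝ} {j : ℕ} (h : ∀ k, 1 ≤ k → k ≤ j → v k = w k) :
    prefixMin M v j = prefixMin M w j := by
  induction j with
  | zero => rfl
  | succ d ih =>
    rw [prefixMin, prefixMin, h (d + 1) (by omega) le_rfl, ih fun k h1 h2 => h k h1 (by omega)]

/-- The number of leading entries of `v` all of which exceed `τ`, written as a last exceedance of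
the prefix minima. -/
theorem lastAbove_prefixMin_lt_iff {M τ : ℝ} {v : ℕ → ℝ} {q j : ℕ} (hτ : τ < M) (hj : 1 ≤ j)
    (hjq : j ≤ q) :
    lastAbove (prefixMin M v) τ q < j ↔ ∃ k, 1 ≤ k ∧ k ≤ j ∧ v k ≤ τ := by
  rw [lastAbove_lt_iff hj]
  constructor
  · intro h
    have h1 := h j le_rfl hjq
    rw [← not_lt, lt_prefixMin_iff] at h1
    push Not at h1
    exact h1 hτ
  · rintro ⟨k, h1, h2, h3⟩ i hi hiq
    rw [← not_lt, lt_prefixMin_iff]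
    rintro ⟨-, h4⟩
    exact absurd (h4 k h1 (by omega)) (not_lt.2 h3)

/-- A value of minimal height on an initial segment, at its first occurrence. -/
theorem exists_first_argmin (A : ℕ → ℝ) {x : ℕ} (hx : 1 ≤ x) :
    ∃ c, 1 ≤ c ∧ c ≤ x ∧ (∀ y, 1 ≤ y → y ≤ x → A c ≤ A y) ∧ ∀ y, 1 ≤ y → y < c → A c < A y := by
  induction x, hx using Nat.le_induction with
  | base =>
    refine ⟨1, le_rfl, le_rfl, fun y h1 h2 => ?_, fun y h1 h2 => by omega⟩
    rw [show y = 1 by omega]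
  | succ x hx ih =>
    obtain ⟨c, h1, h2, h3, h4⟩ := ih
    by_cases h : A (x + 1) < A c
    · refine ⟨x + 1, by omega, le_rfl, fun y hy hyx => ?_, fun y hy hyx => ?_⟩
      · rcases Nat.lt_or_ge x y with h5 | h5
        · rw [show y = x + 1 by omega]
        · exact h.le.trans (h3 y hy h5)
      · exact h.trans_le (h3 y hy (by omega))
    · refine ⟨c, h1, by omega, fun y hy hyx => ?_, h4⟩
      rcases Nat.lt_or_ge x y with h5 | h5
      · rw [show y = x + 1 by omega]
        exact not_lt.1 h
      · exact h3 y hy h5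

/-! ### Lattice paths in the free space and barriers -/

/-- A step of a path that goes to smaller positions and to higher levels, through cells
satisfying `F`. -/
def DescendStep (F : ℕ → ℕ → Prop) (u v : ℕ × ℕ) : Prop :=
  F u.1 u.2 ∧ F v.1 v.2 ∧ ((u.1 = v.1 + 1 ∧ v.2 = u.2) ∨ (u.1 = v.1 ∧ v.2 = u.2 + 1))

/-- `(x, j)` and `(c, y)` are joined by a path through cells satisfying `F` along which the
position decreases and the level increases. -/
def DescendPath (F : ℕ → ℕ → Prop) (x j c y : ℕ) : Prop :=
  F x j ∧ Relation.ReflTransGen (DescendStep F) (x, j) (c, y)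

/-- Position `x` and level `j` form a free cell. -/
def FreeCell (A B : ℕ → ℝ) (δ : ℝ) (p q x j : ℕ) : Prop :=
  (1 ≤ x ∧ x ≤ p) ∧ (1 ≤ j ∧ j ≤ q) ∧ A x + B j ≤ δ

/-- The barrier of position `x`: from the levels up to the barrier, no path that goes to smaller
positions and higher levels leads from position `x` to a strict prefix minimum of `A`. Positions at
which `A` has a strict prefix minimum have barrier `0`. At any other position, the barrier is not
below the leading levels that are all blocked; nor is it below the last blocked one among the levels
up to the barrier of the previous position, since a path has to climb above that barrier before it
moves on. -/
noncomputable def barrier (A B : ℕ → ℝ) (δ : ℝ) (q : ℕ) : ℕ → ℕ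
  | 0 => 0
  | x + 1 =>
    if A (x + 1) < prefixMin (3 * δ) A x then 0
    else max (lastAbove (prefixMin (3 * δ) B) (δ - A (x + 1)) q)
      (lastAbove B (δ - A (x + 1)) (barrier A B δ q x))

theorem barrier_le (A B : ℕ → ℝ) (δ : ℝ) (q x : ℕ) : barrier A B δ q x ≤ q := by
  induction x with
  | zero => simp [barrier]
  | succ x ih =>
    rw [barrier]
    split_ifs
    · omega
    · exact max_le (lastAbove_le _ _ _) ((lastAbove_le _ _ _).trans ih)

theorem barrier_congr {A A' B B' : ℕ → ℝ} {δ : ℝ} {q x : ℕ} (hA : ∀ k, 1 ≤ k → k ≤ x → A k = A' k)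
    (hB : ∀ k, 1 ≤ k → k ≤ q → B k = B' k) :
    barrier A B δ q x = barrier A' B' δ q x := by
  induction x with
  | zero => rfl
  | succ x ih =>
    have h1 : ∀ j, j ≤ q → prefixMin (3 * δ) B j = prefixMin (3 * δ) B' j := fun j hj =>
      prefixMin_congr fun k h1 h2 => hB k h1 (by omega)
    rw [barrier, barrier, prefixMin_congr fun k h1 h2 => hA k h1 (by omega),
      hA (x + 1) (by omega) le_rfl, ih fun k h1 h2 => hA k h1 (by omega),
      lastAbove_congr fun k _ h2 => h1 k h2,
      lastAbove_congr fun k h2 h3 => hB k h2 (h3.trans (barrier_le _ _ _ _ x))]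

section
variable {A B : ℕ → ℝ} {δ : ℝ} {p q : ℕ}

theorem barrier_eq_zero_of_record (hA : ∀ x, 1 ≤ x → x ≤ p → A x < 3 * δ) {c : ℕ} (hcp : c ≤ p)
    (h : ∀ y, 1 ≤ y → y < c → A c < A y) : barrier A B δ q c = 0 := by
  cases c with
  | zero => rfl
  | succ c =>
    rw [barrier, if_pos]
    exact lt_prefixMin_iff.2 ⟨hA _ (by omega) hcp, fun k h1 h2 => h k h1 (by omega)⟩

theorem barrier_eq_zero_of_full (hδ : 0 < δ) (hA : ∀ x, 1 ≤ x → x ≤ p → 0 ≤ A x) (hq : 1 ≤ q)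
    {c : ℕ} (hcp : c ≤ p) (h : ∀ j, 1 ≤ j → j ≤ q → FreeCell A B δ p q c j) :
    barrier A B δ q c = 0 := by
  cases c with
  | zero => rfl
  | succ c =>
    rw [barrier]
    split_ifs
    · rfl
    have h0 := hA (c + 1) (by omega) hcp
    have h1 : ∀ j, 1 ≤ j → j ≤ q → B j ≤ δ - A (c + 1) := fun j h1 h2 => by
      linarith [(h j h1 h2).2.2]
    have h2 := (lastAbove_prefixMin_lt_iff (M := 3 * δ) (τ := δ - A (c + 1)) (v := B)
      (by linarith) le_rfl hq).2 ⟨1, le_rfl, le_rfl, h1 1 le_rfl hq⟩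
    have h3 : lastAbove B (δ - A (c + 1)) (barrier A B δ q c) < 1 :=
      (lastAbove_lt_iff le_rfl).2 fun k hk hk' => h1 k hk (hk'.trans (barrier_le _ _ _ _ _))
    omega

/-- A path that reaches a position of barrier `0` starts above the barrier. -/
theorem barrier_lt_of_path (hδ : 0 < δ) (hA : ∀ x, 1 ≤ x → x ≤ p → 0 ≤ A x) {x j c y : ℕ}
    (h : DescendPath (FreeCell A B δ p q) x j c y) (hc : barrier A B δ q c = 0) :
    barrier A B δ q x < j := by
  obtain ⟨hF, hp⟩ := h
  suffices H : ∀ u : ℕ × ℕ, Relation.ReflTransGen (DescendStep (FreeCell A B δ p q)) u (c, y) →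
      FreeCell A B δ p q u.1 u.2 → barrier A B δ q u.1 < u.2 from H (x, j) hp hF
  intro u hu
  induction hu using Relation.ReflTransGen.head_induction_on with
  | refl => intro hF; simp only [hc]; exact hF.2.1.1
  | @head u v hs hv ih =>
    rintro hu
    obtain ⟨-, hv', hs⟩ := hs
    have ih := ih hv'
    obtain ⟨x, j⟩ := u
    obtain ⟨x', j'⟩ := v
    simp only at *
    have hj := hu.2.1
    obtain ⟨z, rfl⟩ : ∃ z, x = z + 1 := ⟨x - 1, by have := hu.1; omega⟩
    have hz := hA (z + 1) hu.1.1 hu.1.2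
    have hfree : B j ≤ δ - A (z + 1) := by linarith [hu.2.2]
    have h1 : lastAbove (prefixMin (3 * δ) B) (δ - A (z + 1)) q < j :=
      (lastAbove_prefixMin_lt_iff (by linarith) hj.1 hj.2).2 ⟨j, hj.1, le_rfl, hfree⟩
    rcases hs with ⟨h2, rfl⟩ | ⟨rfl, rfl⟩
    · obtain rfl : z = x' := by omega
      rw [barrier]
      split_ifs
      · omega
      · exact max_lt h1 ((lastAbove_le _ _ _).trans_lt ih)
    · rw [barrier] at ih ⊢
      split_ifs at ih ⊢
      · omega
      · refine max_lt h1 ((lastAbove_lt_iff hj.1).2 fun k hk hk' => ?_)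
        rcases hk.eq_or_lt with rfl | hk
        · exact hfree
        · exact (lastAbove_lt_iff (by omega)).1 ((le_max_right _ _).trans_lt ih) k hk hk'

theorem descendPath_left {F : ℕ → ℕ → Prop} {x c j : ℕ} (hcx : c ≤ x)
    (h : ∀ z, c ≤ z → z ≤ x → F z j) : DescendPath F x j c j := by
  refine ⟨h x hcx le_rfl, ?_⟩
  induction x, hcx using Nat.le_induction with
  | base => exact .refl
  | succ x hx ih =>
    have hs : DescendStep F (x + 1, j) (x, j) :=
      ⟨h _ (by omega) le_rfl, h x hx (by omega), .inl ⟨rfl, rfl⟩⟩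
    exact .head hs (ih fun z h1 h2 => h z h1 (by omega))

theorem descendPath_up {F : ℕ → ℕ → Prop} {x j y : ℕ} (hjy : j ≤ y)
    (h : ∀ k, j ≤ k → k ≤ y → F x k) : DescendPath F x j x y := by
  refine ⟨h j le_rfl hjy, ?_⟩
  induction y, hjy using Nat.le_induction with
  | base => exact .refl
  | succ y hy ih =>
    exact .tail (ih fun z h1 h2 => h z h1 (by omega))
      ⟨h y hy (by omega), h _ (by omega) le_rfl, .inr ⟨rfl, rfl⟩⟩

theorem DescendPath.trans {F : ℕ → ℕ → Prop} {x j c y a b : ℕ} (h : DescendPath F x j c y)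
    (h' : DescendPath F c y a b) : DescendPath F x j a b :=
  ⟨h.1, h.2.trans h'.2⟩

/-- The greedy path: a position of barrier less than a record level `j` is joined to the crossing
of a column `c` that is free up to level `r` and a row `r` that is free back to `c`. On the way
from `j` to the next record level `j₂`, the path goes along row `j` until the first position at
which the highest of the levels `[j..j₂-1]` is free, and crosses all of them there. -/
theorem descendPath_of_barrier_lt (hδ : 0 < δ) (hA : ∀ x, 1 ≤ x → x ≤ p → 0 ≤ A x)
    {x c r : ℕ} (hc : 1 ≤ c) (hxp : x ≤ p) (hrq : r ≤ q)
    (hcol : ∀ k, 1 ≤ k → k ≤ r → FreeCell A B δ p q c k)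
    (hrow : ∀ z, c ≤ z → z ≤ x → FreeCell A B δ p q z r)
    (hmin : ∀ k, 1 ≤ k → k ≤ r → B r ≤ B k) {j : ℕ} (hj : 1 ≤ j) (hjr : j ≤ r)
    (hrec : ∀ k, 1 ≤ k → k ≤ j → B j ≤ B k) {x₀ : ℕ} (hcx : c ≤ x₀) (hx₀ : x₀ ≤ x)
    (hbar : barrier A B δ q x₀ < j) : DescendPath (FreeCell A B δ p q) x₀ j c r := by
  induction hd : r - j using Nat.strong_induction_on generalizing j x₀ with
  | _ d ih =>
  subst hd
  by_cases hlow : B j ≤ B r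
  · -- row `j` is as low as row `r`: go along it to column `c`
    refine (descendPath_left hcx fun z h1 h2 => ⟨⟨by omega, by omega⟩, ⟨hj, by omega⟩, ?_⟩).trans
      (descendPath_up hjr fun k h1 h2 => hcol k (by omega) h2)
    linarith [(hrow z h1 (by omega)).2.2]
  push Not at hlow
  have hjr' : j < r := by
    rcases hjr.eq_or_lt with rfl | h
    · exact absurd hlow (lt_irrefl _)
    · exact h
  -- the next record level
  classical
  have hex : ∃ k, j < k ∧ B k < B j := ⟨r, hjr', hlow⟩
  obtain ⟨hj₂, hBj₂⟩ := Nat.find_spec hex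
  have hj₂r : Nat.find hex ≤ r := Nat.find_min' hex ⟨hjr', hlow⟩
  have hbetween : ∀ k, j ≤ k → k < Nat.find hex → B j ≤ B k := by
    intro k h1 h2
    rcases h1.eq_or_lt with rfl | h1
    · exact le_rfl
    · by_contra h3
      exact Nat.find_min hex h2 ⟨h1, not_le.1 h3⟩
  generalize Nat.find hex = j₂ at *
  have hrecAll : ∀ k, 1 ≤ k → k < j₂ → B j ≤ B k := fun k h1 h2 => by
    rcases Nat.lt_or_ge k j with h3 | h3
    · exact hrec k h1 h3.le
    · exact hbetween k h3 h2
  -- the highest level before the next record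
  obtain ⟨M, hM, hMmax⟩ := Finset.exists_max_image (Finset.Ico j j₂) B
    ⟨j, Finset.mem_Ico.2 ⟨le_rfl, hj₂⟩⟩
  rw [Finset.mem_Ico] at hM
  have hMmax : ∀ k, j ≤ k → k < j₂ → B k ≤ B M := fun k h1 h2 =>
    hMmax k (Finset.mem_Ico.2 ⟨h1, h2⟩)
  -- the first position, on the way from `x₀` to `c`, at which it is free
  obtain ⟨y, hcy, hyx, hy, hyfirst⟩ : ∃ y, c ≤ y ∧ y ≤ x₀ ∧ A y + B M ≤ δ ∧
      ∀ z, y < z → z ≤ x₀ → δ < A z + B M := by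
    have hP : A c + B M ≤ δ := (hcol M (by omega) (by omega)).2.2
    clear hbar
    induction x₀, hcx using Nat.le_induction with
    | base => exact ⟨c, le_rfl, le_rfl, hP, fun z h1 h2 => by omega⟩
    | succ x₀ hcx ihx =>
      by_cases h : A (x₀ + 1) + B M ≤ δ
      · exact ⟨x₀ + 1, by omega, le_rfl, h, fun z h1 h2 => by omega⟩
      · obtain ⟨y, h1, h2, h3, h4⟩ := ihx (by omega)
        refine ⟨y, h1, by omega, h3, fun z h5 h6 => ?_⟩
        rcases h6.eq_or_lt with rfl | h6
        · exact not_le.1 h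
        · exact h4 z h5 (by omega)
  -- as long as level `M` is blocked, the barrier stays below it
  have hbarM : ∀ i, i ≤ x₀ - y → barrier A B δ q (x₀ - i) < M := by
    intro i
    induction i with
    | zero => intro _; simp only [Nat.sub_zero]; omega
    | succ i ihi =>
      intro hi
      have h1 := ihi (by omega)
      obtain ⟨z, hz⟩ : ∃ z, x₀ - i = z + 1 := ⟨x₀ - i - 1, by omega⟩
      rw [hz] at h1
      rw [show x₀ - (i + 1) = z by omega]
      by_contra h2
      have hblock := hyfirst (z + 1) (by omega) (by omega)
      rw [barrier] at h1
      split_ifs at h1 with h3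
      · -- a record position is lower than column `c`, where level `M` is free
        have h4 := (lt_prefixMin_iff.1 h3).2 c hc (by omega)
        linarith [(hcol M (by omega) (by omega)).2.2]
      · have h4 := (lastAbove_lt_iff (by omega)).1 ((le_max_right _ _).trans_lt h1) M le_rfl
          (not_lt.1 h2)
        linarith
  have hrowj : ∀ z, y ≤ z → z ≤ x₀ → FreeCell A B δ p q z j := by
    intro z h1 h2
    refine ⟨⟨by omega, by omega⟩, ⟨hj, by omega⟩, ?_⟩
    have h3 := hbarM (x₀ - z) (by omega)
    rw [show x₀ - (x₀ - z) = z by omega] at h3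
    obtain ⟨w, rfl⟩ : ∃ w, z = w + 1 := ⟨z - 1, by omega⟩
    by_cases hcz : w + 1 = c
    · rw [hcz]; exact (hcol j hj hjr).2.2
    rw [barrier] at h3
    split_ifs at h3 with h4
    · have h5 := (lt_prefixMin_iff.1 h4).2 c hc (by omega)
      linarith [(hcol j hj hjr).2.2]
    · obtain ⟨k, hk1, hk2, hk3⟩ := (lastAbove_prefixMin_lt_iff
        (by linarith [hA (w + 1) (by omega) (by omega)]) (by omega) (by omega)).1
        ((le_max_left _ _).trans_lt h3)
      linarith [hrecAll k hk1 (by omega)]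
  refine ((descendPath_left hyx hrowj).trans (descendPath_up hj₂.le fun k h1 h2 =>
    ⟨⟨by omega, by omega⟩, ⟨by omega, by omega⟩, ?_⟩)).trans
    (ih (r - j₂) (by omega) (by omega) hj₂r (fun k h1 h2 => ?_) hcy (by omega) ?_ rfl)
  · rcases h2.eq_or_lt with rfl | h2
    · linarith [hMmax j le_rfl hj₂]
    · linarith [hMmax k h1 h2]
  · rcases h2.eq_or_lt with rfl | h2
    · exact le_rfl
    · exact hBj₂.le.trans (hrecAll k h1 h2)
  · have h3 := hbarM (x₀ - y) le_rfl
    rw [show x₀ - (x₀ - y) = y by omega] at h3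
    omega

end

/-! ### Rising paths and the discrete Fréchet distance -/

/-- A step of a path that goes to the right or up, through cells satisfying `F`. -/
def RiseStep (F : ℕ → ℕ → Prop) (u v : ℕ × ℕ) : Prop :=
  F u.1 u.2 ∧ F v.1 v.2 ∧ ((v.1 = u.1 + 1 ∧ v.2 = u.2) ∨ (v.1 = u.1 ∧ v.2 = u.2 + 1))

/-- `(e, j)` and `(i, f)` are joined by a path of steps to the right and up through cells
satisfying `F`. -/
def RisePath (F : ℕ → ℕ → Prop) (e j i f : ℕ) : Prop :=
  F e j ∧ Relation.ReflTransGen (RiseStep F) (e, j) (i, f)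

section
variable {F : ℕ → ℕ → Prop} {e j i f : ℕ}

theorem RisePath.right (h : RisePath F e j i f) (hF : F i f) (hF' : F (i + 1) f) :
    RisePath F e j (i + 1) f :=
  ⟨h.1, h.2.tail ⟨hF, hF', .inl ⟨rfl, rfl⟩⟩⟩

theorem RisePath.up (h : RisePath F e j i f) (hF : F i f) (hF' : F i (f + 1)) :
    RisePath F e j i (f + 1) :=
  ⟨h.1, h.2.tail ⟨hF, hF', .inr ⟨rfl, rfl⟩⟩⟩

theorem RisePath.trans {i' f' : ℕ} (h : RisePath F e j i f) (h' : RisePath F i f i' f') :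
    RisePath F e j i' f' :=
  ⟨h.1, h.2.trans h'.2⟩

@[elab_as_elim]
theorem RisePath.rec_tail {P : ℕ → ℕ → Prop} (h : RisePath F e j i f) (base : P e j)
    (right : ∀ x y, RisePath F e j x y → F x y → F (x + 1) y → P x y → P (x + 1) y)
    (up : ∀ x y, RisePath F e j x y → F x y → F x (y + 1) → P x y → P x (y + 1)) : P i f := by
  obtain ⟨hF, hp⟩ := h
  suffices H : ∀ u, Relation.ReflTransGen (RiseStep F) (e, j) u → P u.1 u.2 from H (i, f) hp
  intro u hu
  induction hu with
  | refl => exact base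
  | @tail u v hu hs ih =>
    obtain ⟨x, y⟩ := u
    obtain ⟨x', y'⟩ := v
    obtain ⟨h1, h2, hs⟩ := hs
    simp only at *
    rcases hs with ⟨rfl, rfl⟩ | ⟨rfl, rfl⟩
    · exact right _ _ ⟨hF, hu⟩ h1 h2 ih
    · exact up _ _ ⟨hF, hu⟩ h1 h2 ih

theorem RisePath.le (h : RisePath F e j i f) : e ≤ i ∧ j ≤ f := by
  refine h.rec_tail (P := fun i f => e ≤ i ∧ j ≤ f) ⟨le_rfl, le_rfl⟩ ?_ ?_
  · intro x y _ _ _ h; omega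
  · intro x y _ _ _ h; omega

theorem RisePath.last (h : RisePath F e j i f) : F i f :=
  h.rec_tail (P := F) h.1 (fun _ _ _ _ h _ => h) (fun _ _ _ _ h _ => h)

theorem RisePath.visit_col (h : RisePath F e j i f) {c : ℕ} (hec : e ≤ c) (hci : c ≤ i) :
    ∃ y, RisePath F e j c y ∧ RisePath F c y i f := by
  suffices H : ∀ c, e ≤ c → c ≤ i → ∃ y, RisePath F e j c y ∧ RisePath F c y i f from H c hec hci
  refine h.rec_tail (P := fun i f => ∀ c, e ≤ c → c ≤ i → ∃ y, RisePath F e j c y ∧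
    RisePath F c y i f) ?_ ?_ ?_
  · intro c h1 h2
    obtain rfl : c = e := by omega
    exact ⟨j, ⟨h.1, .refl⟩, h.1, .refl⟩
  · intro x y hp h1 h2 ih c h3 h4
    rcases h4.eq_or_lt with rfl | h4
    · exact ⟨y, hp.right h1 h2, h2, .refl⟩
    · obtain ⟨z, h5, h6⟩ := ih c h3 (by omega)
      exact ⟨z, h5, h6.right h1 h2⟩
  · intro x y hp h1 h2 ih c h3 h4
    obtain ⟨z, h5, h6⟩ := ih c h3 (by omega)
    exact ⟨z, h5, h6.up h1 h2⟩

theorem RisePath.visit_row (h : RisePath F e j i f) {r : ℕ} (hjr : j ≤ r) (hrf : r ≤ f) :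
    ∃ x, RisePath F e j x r ∧ RisePath F x r i f := by
  suffices H : ∀ r, j ≤ r → r ≤ f → ∃ x, RisePath F e j x r ∧ RisePath F x r i f from H r hjr hrf
  refine h.rec_tail (P := fun i f => ∀ r, j ≤ r → r ≤ f → ∃ x, RisePath F e j x r ∧
    RisePath F x r i f) ?_ ?_ ?_
  · intro c h1 h2
    obtain rfl : c = j := by omega
    exact ⟨e, ⟨h.1, .refl⟩, h.1, .refl⟩
  · intro x y hp h1 h2 ih c h3 h4
    obtain ⟨z, h5, h6⟩ := ih c h3 (by omega)
    exact ⟨z, h5, h6.right h1 h2⟩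
  · intro x y hp h1 h2 ih c h3 h4
    rcases h4.eq_or_lt with rfl | h4
    · exact ⟨x, hp.up h1 h2, h2, .refl⟩
    · obtain ⟨z, h5, h6⟩ := ih c h3 (by omega)
      exact ⟨z, h5, h6.up h1 h2⟩

end

theorem IsDiscreteParam.map_mem {p b : ℕ} {φ : unitInterval → ℕ} (h : IsDiscreteParam p b φ)
    (t : unitInterval) : p ≤ φ t ∧ φ t ≤ b := by
  have : φ t ∈ Set.range φ := ⟨t, rfl⟩
  rwa [h.2] at this

theorem IsDiscreteParam.exists_eq {p b : ℕ} {φ : unitInterval → ℕ} (h : IsDiscreteParam p b φ)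
    {k : ℕ} (h1 : p ≤ k) (h2 : k ≤ b) : ∃ t, φ t = k := by
  have : k ∈ Set.Icc p b := ⟨h1, h2⟩
  rwa [← h.2] at this

theorem IsDiscreteParam.map_zero {p b : ℕ} {φ : unitInterval → ℕ} (h : IsDiscreteParam p b φ) :
    φ 0 = p := by
  obtain ⟨t, ht⟩ := h.exists_eq le_rfl ((h.map_mem 0).1.trans (h.map_mem 0).2)
  have h1 := h.1 (show (0 : unitInterval) ≤ t from t.2.1)
  have h2 := (h.map_mem 0).1
  omega

theorem IsDiscreteParam.map_one {p b : ℕ} {φ : unitInterval → ℕ} (h : IsDiscreteParam p b φ) :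
    φ 1 = b := by
  obtain ⟨t, ht⟩ := h.exists_eq ((h.map_mem 0).1.trans (h.map_mem 0).2) le_rfl
  have h1 := h.1 (show t ≤ (1 : unitInterval) from t.2.2)
  have h2 := (h.map_mem 1).2
  omega

/-- A parametrization run through on `[0,1/2]`, followed by the value `v`. -/
noncomputable def extendParam (φ : unitInterval → ℕ) (v : ℕ) (t : unitInterval) : ℕ :=
  if (t : ℝ) ≤ 1 / 2 then φ (Set.projIcc 0 1 zero_le_one (2 * (t : ℝ))) else v

theorem IsDiscreteParam.extend {p b v : ℕ} {φ : unitInterval → ℕ} (h : IsDiscreteParam p b φ)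
    (hv : v = b ∨ v = b + 1) : IsDiscreteParam p v (extendParam φ v) := by
  have hpb := (h.map_mem 0).1.trans (h.map_mem 0).2
  constructor
  · intro s t hst
    have hst' : (s : ℝ) ≤ t := hst
    unfold extendParam
    split_ifs with h1 h2 h2
    · exact h.1 (Set.monotone_projIcc _ (by linarith))
    · have := (h.map_mem (Set.projIcc 0 1 zero_le_one (2 * (s : ℝ)))).2
      omega
    · linarith
    · exact le_rfl
  · ext k
    constructor
    · rintro ⟨t, rfl⟩
      unfold extendParam
      split_ifs
      · have := h.map_mem (Set.projIcc 0 1 zero_le_one (2 * (t : ℝ)))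
        exact ⟨this.1, by omega⟩
      · exact ⟨by omega, le_rfl⟩
    · rintro ⟨h1, h2⟩
      by_cases hk : k ≤ b
      · obtain ⟨t, ht⟩ := h.exists_eq h1 hk
        have h0 := t.2.1
        have h1 := t.2.2
        refine ⟨⟨(t : ℝ) / 2, by constructor <;> linarith⟩, ?_⟩
        unfold extendParam
        rw [if_pos (by simp only; linarith)]
        simp only
        rw [show 2 * ((t : ℝ) / 2) = t by ring, Set.projIcc_val, ht]
      · refine ⟨1, ?_⟩
        unfold extendParam
        rw [if_neg (by norm_num)]
        omega

/-- A rising path yields parametrizations that stay in its cells. -/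
theorem RisePath.exists_param {F : ℕ → ℕ → Prop} {e j i f : ℕ} (h : RisePath F e j i f) :
    ∃ φ ψ : unitInterval → ℕ, IsDiscreteParam e i φ ∧ IsDiscreteParam j f ψ ∧
      ∀ t, F (φ t) (ψ t) := by
  refine h.rec_tail (P := fun i f => ∃ φ ψ : unitInterval → ℕ, IsDiscreteParam e i φ ∧
    IsDiscreteParam j f ψ ∧ ∀ t, F (φ t) (ψ t)) ?_ ?_ ?_
  · refine ⟨fun _ => e, fun _ => j, ⟨monotone_const, ?_⟩, ⟨monotone_const, ?_⟩, fun _ => h.1⟩ <;>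
    simp
  · rintro x y - h1 h2 ⟨φ, ψ, h3, h4, h5⟩
    refine ⟨_, _, h3.extend (.inr rfl), h4.extend (.inl rfl), fun t => ?_⟩
    unfold extendParam
    split_ifs
    · exact h5 _
    · exact h2
  · rintro x y - h1 h2 ⟨φ, ψ, h3, h4, h5⟩
    refine ⟨_, _, h3.extend (.inl rfl), h4.extend (.inr rfl), fun t => ?_⟩
    unfold extendParam
    split_ifs
    · exact h5 _
    · exact h2

/-- The cells met by a pair of parametrizations form a rising path, provided that a diagonal step
can be replaced by two steps. -/
theorem risePath_of_param {F : ℕ → ℕ → Prop} {e j i f : ℕ} {φ ψ : unitInterval → ℕ}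
    (hφ : IsDiscreteParam e i φ) (hψ : IsDiscreteParam j f ψ) (hF : ∀ t, F (φ t) (ψ t))
    (hdiag : ∀ x y, F x y → F (x + 1) (y + 1) → F (x + 1) y ∨ F x (y + 1)) :
    RisePath F e j i f := by
  suffices H : ∀ N t, φ t + ψ t = N → RisePath F e j (φ t) (ψ t) by
    have := H _ 1 rfl
    rwa [hφ.map_one, hψ.map_one] at this
  intro N
  induction N using Nat.strong_induction_on with
  | _ N ih =>
  intro t ht
  have h0 := hF 0
  rw [hφ.map_zero, hψ.map_zero] at h0
  have htφ := hφ.map_mem t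
  have htψ := hψ.map_mem t
  by_cases hN : N = e + j
  · rw [show φ t = e by omega, show ψ t = j by omega]
    exact ⟨h0, .refl⟩
  -- the last cell met before the present one
  classical
  have hex : (fun k => ∃ s, φ s + ψ s = k) (e + j) := ⟨0, by rw [hφ.map_zero, hψ.map_zero]⟩
  obtain ⟨s, hs⟩ := Nat.findGreatest_spec (P := fun k => ∃ s, φ s + ψ s = k) (n := N - 1)
    (by omega) hex
  have hmax : ∀ s', φ s' + ψ s' < N → φ s' + ψ s' ≤ φ s + ψ s := fun s' hs' => by
    rw [hs]
    exact Nat.le_findGreatest (by omega) ⟨s', rfl⟩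
  have hsN : φ s + ψ s < N := by
    have := Nat.findGreatest_le (P := fun k => ∃ s, φ s + ψ s = k) (N - 1)
    omega
  have hst : s ≤ t := by
    by_contra h
    have h1 := hφ.1 (not_le.1 h).le
    have h2 := hψ.1 (not_le.1 h).le
    omega
  have hsφ := hφ.map_mem s
  have hsψ := hψ.map_mem s
  have h1 := hφ.1 hst
  have h2 := hψ.1 hst
  have h3 : φ t ≤ φ s + 1 := by
    by_contra h
    obtain ⟨r, hr⟩ := hφ.exists_eq (k := φ t - 1) (by omega) (by omega)
    have hrt : r ≤ t := by
      by_contra h'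
      have := hφ.1 (not_le.1 h').le
      omega
    have hsr : s ≤ r := by
      by_contra h'
      have := hφ.1 (not_le.1 h').le
      omega
    have := hψ.1 hrt
    have := hψ.1 hsr
    have := hmax r (by omega)
    omega
  have h4 : ψ t ≤ ψ s + 1 := by
    by_contra h
    obtain ⟨r, hr⟩ := hψ.exists_eq (k := ψ t - 1) (by omega) (by omega)
    have hrt : r ≤ t := by
      by_contra h'
      have := hψ.1 (not_le.1 h').le
      omega
    have hsr : s ≤ r := by
      by_contra h'
      have := hψ.1 (not_le.1 h').le
      omega
    have := hφ.1 hrt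
    have := hφ.1 hsr
    have := hmax r (by omega)
    omega
  have hp := ih _ hsN s rfl
  have hFs := hF s
  have hFt := hF t
  rcases h1.eq_or_lt with h5 | h5
  · have h6 : ψ t = ψ s + 1 := by omega
    rw [← h5, h6] at hFt ⊢
    exact hp.up hFs hFt
  have h5 : φ t = φ s + 1 := by omega
  rcases h2.eq_or_lt with h6 | h6
  · rw [← h6, h5] at hFt ⊢
    exact hp.right hFs hFt
  · have h6 : ψ t = ψ s + 1 := by omega
    rw [h5, h6] at hFt ⊢
    rcases hdiag _ _ hFs hFt with h7 | h7
    · exact (hp.right hFs h7).up h7 hFt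
    · exact (hp.up hFs h7).right h7 hFt

/-- The infimum in the discrete Fréchet distance is attained, since only finitely many vertices
matter. -/
theorem exists_param_of_discreteFrechetDist_le {π σ : ℕ → ℝ} {p b q d : ℕ} {δ : ℝ}
    (h : discreteFrechetDist π p b σ q d ≤ ENNReal.ofReal δ) :
    ∃ φ ψ, IsDiscreteParam p b φ ∧ IsDiscreteParam q d ψ ∧
      ∀ t, edist (π (φ t)) (σ (ψ t)) ≤ ENNReal.ofReal δ := by
  classical
  by_contra hcon
  push Not at hcon
  let T := (Finset.Icc p b ×ˢ Finset.Icc q d).filter fun u =>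
    ENNReal.ofReal δ < edist (π u.1) (σ u.2)
  have h1 : ENNReal.ofReal δ < T.inf fun u => edist (π u.1) (σ u.2) := by
    rw [Finset.lt_inf_iff ENNReal.ofReal_lt_top]
    exact fun u hu => (Finset.mem_filter.1 hu).2
  refine absurd (h1.trans_le ?_) (not_lt.2 h)
  refine le_iInf fun φ => le_iInf fun hφ => le_iInf fun ψ => le_iInf fun hψ => ?_
  obtain ⟨t, ht⟩ := hcon φ ψ hφ hψ
  refine le_trans (Finset.inf_le (b := (φ t, ψ t)) ?_)
    (le_iSup (fun t => edist (π (φ t)) (σ (ψ t))) t)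
  exact Finset.mem_filter.2 ⟨Finset.mem_product.2 ⟨Finset.mem_Icc.2 (hφ.map_mem t),
    Finset.mem_Icc.2 (hψ.map_mem t)⟩, ht⟩

/-- For separated curves, the decision problem is a reachability problem in the grid of free
cells, without diagonal steps: if the two ends of a diagonal step are free, then so is one of the
two other corners, as both pairs of opposite corners have the same sum of distances. -/
theorem discreteFrechetDist_le_iff {n m : ℕ} {π σ a b : ℕ → ℝ} {δ : ℝ} (hδ : 0 < δ)
    (hπ : ∀ i, 1 ≤ i → i ≤ n → 0 ≤ π i) (hσ : ∀ j, 1 ≤ j → j ≤ m → σ j ≤ 0)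
    (hab : ∀ i j, 1 ≤ i → i ≤ n → 1 ≤ j → j ≤ m → (a i + b j ≤ δ ↔ π i - σ j ≤ δ))
    {e i f : ℕ} (he : 1 ≤ e) (hin : i ≤ n) (hfm : f ≤ m) :
    discreteFrechetDist π e i σ 1 f ≤ ENNReal.ofReal δ ↔
      RisePath (FreeCell a b δ n m) e 1 i f := by
  have hedist : ∀ x y, 1 ≤ x → x ≤ n → 1 ≤ y → y ≤ m →
      (edist (π x) (σ y) ≤ ENNReal.ofReal δ ↔ π x - σ y ≤ δ) := by
    intro x y h1 h2 h3 h4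
    rw [edist_dist, ENNReal.ofReal_le_ofReal_iff hδ.le, Real.dist_eq,
      abs_of_nonneg (by linarith [hπ x h1 h2, hσ y h3 h4])]
  constructor
  · intro h
    obtain ⟨φ, ψ, hφ, hψ, ht⟩ := exists_param_of_discreteFrechetDist_le h
    refine risePath_of_param hφ hψ (fun t => ?_) fun x y h1 h2 => ?_
    · have h1 := hφ.map_mem t
      have h2 := hψ.map_mem t
      refine ⟨⟨by omega, by omega⟩, ⟨by omega, by omega⟩, ?_⟩
      rw [hab _ _ (by omega) (by omega) (by omega) (by omega),
        ← hedist _ _ (by omega) (by omega) (by omega) (by omega)]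
      exact ht t
    · obtain ⟨h3, h4, h5⟩ := h1
      obtain ⟨h6, h7, h8⟩ := h2
      by_cases h : a (x + 1) + b y ≤ δ
      · exact .inl ⟨h6, h4, h⟩
      · exact .inr ⟨h3, h7, by linarith⟩
  · intro h
    obtain ⟨φ, ψ, hφ, hψ, ht⟩ := h.exists_param
    refine (iInf_le_of_le φ <| iInf_le_of_le hφ <| iInf_le_of_le ψ <| iInf_le_of_le hψ <|
      iSup_le fun t => ?_)
    obtain ⟨h1, h2, h3⟩ := ht t
    rwa [hedist _ _ h1.1 h1.2 h2.1 h2.2, ← hab _ _ h1.1 h1.2 h2.1 h2.2]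

/-! ### The exit criterion -/

/-- The sequence of length `N` read backwards. -/
def backwards (N : ℕ) (v : ℕ → ℝ) (x : ℕ) : ℝ := v (N + 1 - x)

section
variable {a b : ℕ → ℝ} {δ : ℝ} {n m : ℕ}

theorem RisePath.descendPath_columns {c y i f : ℕ}
    (h : RisePath (FreeCell a b δ n m) c y i f) :
    DescendPath (FreeCell (backwards n a) b δ n m) (n + 1 - c) y (n + 1 - i) f := by
  have key : ∀ x j, FreeCell a b δ n m x j →
      FreeCell (backwards n a) b δ n m (n + 1 - x) j := by
    rintro x j ⟨h1, h2, h3⟩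
    refine ⟨⟨by omega, by omega⟩, h2, ?_⟩
    rwa [backwards, show n + 1 - (n + 1 - x) = x by omega]
  refine ⟨key _ _ h.1, h.2.lift (fun u => (n + 1 - u.1, u.2)) ?_⟩
  rintro ⟨x, j⟩ ⟨x', j'⟩ ⟨h1, h2, h3⟩
  refine ⟨key _ _ h1, key _ _ h2, ?_⟩
  have := h1.1
  have := h2.1
  simp only at *
  omega

theorem DescendPath.risePath_columns {x j c y : ℕ}
    (h : DescendPath (FreeCell (backwards n a) b δ n m) x j c y) :
    RisePath (FreeCell a b δ n m) (n + 1 - x) j (n + 1 - c) y := by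
  have key : ∀ x j, FreeCell (backwards n a) b δ n m x j →
      FreeCell a b δ n m (n + 1 - x) j := by
    rintro x j ⟨h1, h2, h3⟩
    exact ⟨⟨by omega, by omega⟩, h2, h3⟩
  refine ⟨key _ _ h.1, h.2.lift (fun u => (n + 1 - u.1, u.2)) ?_⟩
  rintro ⟨x, j⟩ ⟨x', j'⟩ ⟨h1, h2, h3⟩
  refine ⟨key _ _ h1, key _ _ h2, ?_⟩
  have := h1.1
  have := h2.1
  simp only at *
  omega

theorem RisePath.descendPath_rows {c y i f : ℕ}
    (h : RisePath (FreeCell a b δ n m) c y i f) :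
    DescendPath (FreeCell a (backwards m b) δ n m) i (m + 1 - f) c (m + 1 - y) := by
  have key : ∀ x j, FreeCell a b δ n m x j →
      FreeCell a (backwards m b) δ n m x (m + 1 - j) := by
    rintro x j ⟨h1, h2, h3⟩
    refine ⟨h1, ⟨by omega, by omega⟩, ?_⟩
    rwa [backwards, show m + 1 - (m + 1 - j) = j by omega]
  refine ⟨key _ _ h.last, h.2.swap.lift (fun u => (u.1, m + 1 - u.2)) ?_⟩
  rintro ⟨x, j⟩ ⟨x', j'⟩ ⟨h1, h2, h3⟩
  refine ⟨key _ _ h2, key _ _ h1, ?_⟩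
  have := h1.2.1
  have := h2.2.1
  simp only at *
  omega

theorem DescendPath.last {F : ℕ → ℕ → Prop} {x j c y : ℕ} (h : DescendPath F x j c y) : F c y := by
  obtain ⟨h1, h2⟩ := h
  rcases h2.cases_tail with h | ⟨u, -, h⟩
  · obtain ⟨rfl, rfl⟩ := Prod.mk.inj h
    exact h1
  · exact h.2.1

theorem DescendPath.risePath_rows {x j c y : ℕ}
    (h : DescendPath (FreeCell a (backwards m b) δ n m) x j c y) :
    RisePath (FreeCell a b δ n m) c (m + 1 - y) x (m + 1 - j) := by
  have key : ∀ x j, FreeCell a (backwards m b) δ n m x j →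
      FreeCell a b δ n m x (m + 1 - j) := by
    rintro x j ⟨h1, h2, h3⟩
    exact ⟨h1, ⟨by omega, by omega⟩, h3⟩
  refine ⟨key _ _ h.last, h.2.swap.lift (fun u => (u.1, m + 1 - u.2)) ?_⟩
  rintro ⟨x, j⟩ ⟨x', j'⟩ ⟨h1, h2, h3⟩
  refine ⟨key _ _ h2, key _ _ h1, ?_⟩
  have := h1.2.1
  have := h2.2.1
  simp only at *
  omega

theorem RisePath.descendPath_transposed {c y i f : ℕ}
    (h : RisePath (FreeCell a b δ n m) c y i f) :
    DescendPath (FreeCell b (backwards n a) δ m n) f (n + 1 - i) y (n + 1 - c) := by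
  have key : ∀ x j, FreeCell a b δ n m x j →
      FreeCell b (backwards n a) δ m n j (n + 1 - x) := by
    rintro x j ⟨h1, h2, h3⟩
    refine ⟨h2, ⟨by omega, by omega⟩, ?_⟩
    rwa [backwards, show n + 1 - (n + 1 - x) = x by omega, add_comm]
  refine ⟨key _ _ h.last, h.2.swap.lift (fun u => (u.2, n + 1 - u.1)) ?_⟩
  rintro ⟨x, j⟩ ⟨x', j'⟩ ⟨h1, h2, h3⟩
  refine ⟨key _ _ h2, key _ _ h1, ?_⟩
  have := h1.1
  have := h2.1
  simp only at *
  omega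

theorem DescendPath.risePath_transposed {x j c y : ℕ}
    (h : DescendPath (FreeCell b (backwards n a) δ m n) x j c y) :
    RisePath (FreeCell a b δ n m) (n + 1 - y) c (n + 1 - j) x := by
  have key : ∀ x j, FreeCell b (backwards n a) δ m n x j →
      FreeCell a b δ n m (n + 1 - j) x := by
    rintro x j ⟨h1, h2, h3⟩
    refine ⟨⟨by omega, by omega⟩, h1, ?_⟩
    rwa [add_comm]
  refine ⟨key _ _ h.last, h.2.swap.lift (fun u => (n + 1 - u.2, u.1)) ?_⟩
  rintro ⟨x, j⟩ ⟨x', j'⟩ ⟨h1, h2, h3⟩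
  refine ⟨key _ _ h2, key _ _ h1, ?_⟩
  have := h1.2.1
  have := h2.2.1
  simp only at *
  omega

/-- A path from the lower to the upper side of the rectangle crosses its highest row in a column
that is free altogether. -/
theorem RisePath.exists_free_col {e i f : ℕ} (hf : 1 ≤ f)
    (h : RisePath (FreeCell a b δ n m) e 1 i f) :
    ∃ c, e ≤ c ∧ c ≤ i ∧ ∀ j, 1 ≤ j → j ≤ f → FreeCell a b δ n m c j := by
  obtain ⟨M, hM, hMmax⟩ := Finset.exists_max_image (Finset.Icc 1 f) b
    ⟨1, Finset.mem_Icc.2 ⟨le_rfl, hf⟩⟩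
  rw [Finset.mem_Icc] at hM
  obtain ⟨c, h1, h2⟩ := h.visit_row hM.1 hM.2
  refine ⟨c, h1.le.1, h2.le.1, fun j h3 h4 => ?_⟩
  obtain ⟨h5, h6, h7⟩ := h2.1
  have h8 := h.last.2.1
  exact ⟨h5, ⟨h3, by omega⟩, by linarith [hMmax j (Finset.mem_Icc.2 ⟨h3, h4⟩)]⟩

theorem RisePath.exists_free_row {e i f : ℕ} (h : RisePath (FreeCell a b δ n m) e 1 i f) {x : ℕ}
    (hex : e ≤ x) (hxi : x ≤ i) : ∃ j, 1 ≤ j ∧ j ≤ f ∧ FreeCell a b δ n m x j := by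
  obtain ⟨y, h1, h2⟩ := h.visit_col hex hxi
  exact ⟨y, h1.le.2, h2.le.2, h2.1⟩

/-- The part of a path up to the crossing of a full column `c` and a lowest row `r`. -/
theorem risePath_of_barrier_columns (hδ : 0 < δ) (ha0 : ∀ x, 1 ≤ x → x ≤ n → 0 ≤ a x)
    {e c r : ℕ} (he : 1 ≤ e) (hec : e ≤ c) (hcn : c ≤ n) (hr : 1 ≤ r) (hrm : r ≤ m)
    (hcol : ∀ k, 1 ≤ k → k ≤ r → FreeCell a b δ n m c k)
    (hrow : ∀ z, e ≤ z → z ≤ c → FreeCell a b δ n m z r)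
    (hmin : ∀ k, 1 ≤ k → k ≤ r → b r ≤ b k)
    (hbar : barrier (backwards n a) b δ m (n + 1 - e) = 0) :
    RisePath (FreeCell a b δ n m) e 1 c r := by
  have conv : ∀ z k, z ≤ n → FreeCell a b δ n m (n + 1 - z) k →
      FreeCell (backwards n a) b δ n m z k := by
    rintro z k hz ⟨h1, h2, h3⟩
    exact ⟨⟨by omega, hz⟩, h2, h3⟩
  have h := descendPath_of_barrier_lt (A := backwards n a) (B := b) (p := n) (q := m)
    (x := n + 1 - e) (c := n + 1 - c) (r := r) (j := 1) (x₀ := n + 1 - e) hδ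
    (fun x h1 h2 => ha0 _ (by omega) (by omega)) (by omega) (by omega) hrm
    (fun k h1 h2 => conv _ _ (by omega)
      (by rw [show n + 1 - (n + 1 - c) = c by omega]; exact hcol k h1 h2))
    (fun z h1 h2 => conv _ _ (by omega) (hrow _ (by omega) (by omega)))
    hmin le_rfl hr (fun k h1 h2 => by rw [show k = 1 by omega]) (by omega) le_rfl (by omega)
  have h := h.risePath_columns
  rwa [show n + 1 - (n + 1 - c) = c by omega, show n + 1 - (n + 1 - e) = e by omega] at h

/-- An entry `e` and an exit `(i, m)` on the upper side are joined by a path if and only if both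
have barrier `0`, some column between them is free, and no column between them is blocked. -/
theorem risePath_top_iff (hδ : 0 < δ) (ha0 : ∀ x, 1 ≤ x → x ≤ n → 0 ≤ a x) (hm : 1 ≤ m)
    {e i : ℕ} (he : 1 ≤ e) (hin : i ≤ n) :
    RisePath (FreeCell a b δ n m) e 1 i m ↔
      barrier (backwards n a) b δ m (n + 1 - e) = 0 ∧
      barrier a (backwards m b) δ m i = 0 ∧
      (∃ c, e ≤ c ∧ c ≤ i ∧ ∀ j, 1 ≤ j → j ≤ m → FreeCell a b δ n m c j) ∧
      ∀ x, e ≤ x → x ≤ i → ∃ j, 1 ≤ j ∧ j ≤ m ∧ FreeCell a b δ n m x j := by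
  constructor
  · intro h
    obtain ⟨c, hec, hci, hc⟩ := h.exists_free_col hm
    refine ⟨?_, ?_, ⟨c, hec, hci, hc⟩, fun x h1 h2 => h.exists_free_row h1 h2⟩
    all_goals obtain ⟨y, h1, h2⟩ := h.visit_col hec hci
    · refine Nat.lt_one_iff.1 (barrier_lt_of_path hδ (fun x h1 h2 => ha0 _ (by omega) (by omega))
        h1.descendPath_columns ?_)
      refine barrier_eq_zero_of_full (A := backwards n a) (p := n) hδ
        (fun x h1 h2 => ha0 _ (by omega) (by omega)) hm (by omega) fun j h3 h4 =>
        ⟨⟨by omega, by omega⟩, ⟨h3, h4⟩, ?_⟩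
      rw [backwards, show n + 1 - (n + 1 - c) = c by omega]
      exact (hc j h3 h4).2.2
    · have := barrier_lt_of_path hδ ha0
        h2.descendPath_rows (barrier_eq_zero_of_full (p := n) hδ ha0 hm (by omega) fun j h3 h4 =>
        ⟨⟨by omega, by omega⟩, ⟨h3, h4⟩, (hc (m + 1 - j) (by omega) (by omega)).2.2⟩)
      omega
  · rintro ⟨h1, h2, ⟨c, hec, hci, hc⟩, hx⟩
    obtain ⟨r, hr1, hrm, hr, -⟩ := exists_first_argmin b hm
    have hrow : ∀ z, e ≤ z → z ≤ i → FreeCell a b δ n m z r := by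
      intro z h3 h4
      obtain ⟨j, h5, h6, h7⟩ := hx z h3 h4
      exact ⟨h7.1, ⟨hr1, hrm⟩, by linarith [h7.2.2, hr j h5 h6]⟩
    refine (risePath_of_barrier_columns hδ ha0 he hec (by omega) hr1 hrm
      (fun k h3 h4 => hc k h3 (by omega)) (fun z h3 h4 => hrow z h3 (by omega))
      (fun k h3 h4 => hr k h3 (by omega)) h1).trans ?_
    have conv : ∀ z k, 1 ≤ k → FreeCell a b δ n m z (m + 1 - k) →
        FreeCell a (backwards m b) δ n m z k := by
      rintro z k hz ⟨h1, h2, h3⟩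
      exact ⟨h1, ⟨by omega, by omega⟩, h3⟩
    have h := descendPath_of_barrier_lt (A := a) (B := backwards m b) (p := n) (q := m)
      (x := i) (c := c) (r := m + 1 - r) (j := 1) (x₀ := i) hδ ha0 (by omega) hin (by omega)
      (fun k h3 h4 => conv _ _ h3 (hc _ (by omega) (by omega)))
      (fun z h3 h4 => conv _ _ (by omega) (by
        rw [show m + 1 - (m + 1 - r) = r by omega]; exact hrow z (by omega) h4))
      (fun k h3 h4 => by
        rw [backwards, backwards, show m + 1 - (m + 1 - r) = r by omega]
        exact hr _ (by omega) (by omega))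
      le_rfl (by omega) (fun k h3 h4 => by rw [show k = 1 by omega]) hci le_rfl (by omega)
    have h := h.risePath_rows
    rwa [show m + 1 - (m + 1 - r) = r by omega, show m + 1 - 1 = m by omega] at h

/-- An entry `e` and an exit `(n, f)` on the right side are joined by a path if and only if both
have barrier `0`, some column from `e` on is free up to level `f`, and no column from `e` on is
blocked up to level `f`. -/
theorem risePath_right_iff (hδ : 0 < δ) (ha0 : ∀ x, 1 ≤ x → x ≤ n → 0 ≤ a x)
    (ha3 : ∀ x, 1 ≤ x → x ≤ n → a x < 3 * δ) (hb0 : ∀ x, 1 ≤ x → x ≤ m → 0 ≤ b x)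
    (hb3 : ∀ x, 1 ≤ x → x ≤ m → b x < 3 * δ) {e f : ℕ} (he : 1 ≤ e) (hen : e ≤ n) (hf : 1 ≤ f)
    (hfm : f ≤ m) :
    RisePath (FreeCell a b δ n m) e 1 n f ↔
      barrier (backwards n a) b δ m (n + 1 - e) = 0 ∧
      barrier b (backwards n a) δ n f = 0 ∧
      (∃ c, e ≤ c ∧ c ≤ n ∧ ∀ j, 1 ≤ j → j ≤ f → FreeCell a b δ n m c j) ∧
      ∀ x, e ≤ x → x ≤ n → ∃ j, 1 ≤ j ∧ j ≤ f ∧ FreeCell a b δ n m x j := by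
  -- the last minimum `c` of `a` on `[e..n]`, and the first minimum `r` of `b` on `[1..f]`
  obtain ⟨c', hc1, hce, hcmin, hcfirst⟩ := exists_first_argmin (backwards n a) (x := n + 1 - e)
    (by omega)
  obtain ⟨c, rfl, hec, hcn⟩ : ∃ c, c' = n + 1 - c ∧ e ≤ c ∧ c ≤ n :=
    ⟨n + 1 - c', by omega, by omega, by omega⟩
  have hcmin : ∀ z, e ≤ z → z ≤ n → a c ≤ a z := fun z h1 h2 => by
    have := hcmin (n + 1 - z) (by omega) (by omega)
    rwa [backwards, backwards, show n + 1 - (n + 1 - z) = z by omega,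
      show n + 1 - (n + 1 - c) = c by omega] at this
  obtain ⟨r, hr1, hrf, hrmin, hrfirst⟩ := exists_first_argmin b hf
  constructor
  · intro h
    refine ⟨?_, ?_, h.exists_free_col hf, fun x h1 h2 => h.exists_free_row h1 h2⟩
    · obtain ⟨y, h1, h2⟩ := h.visit_col hec hcn
      exact Nat.lt_one_iff.1 (barrier_lt_of_path hδ
        (fun x h1 h2 => ha0 _ (by omega) (by omega)) h1.descendPath_columns
        (barrier_eq_zero_of_record (p := n) (fun x h1 h2 => ha3 _ (by omega) (by omega))
          (by omega) hcfirst))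
    · obtain ⟨x, h1, h2⟩ := h.visit_row hr1 hrf
      have := barrier_lt_of_path hδ hb0 h2.descendPath_transposed
        (barrier_eq_zero_of_record hb3 (by omega) hrfirst)
      omega
  · rintro ⟨h1, h2, ⟨c₁, hec₁, hc₁n, hc₁⟩, hx⟩
    have hcol : ∀ k, 1 ≤ k → k ≤ f → FreeCell a b δ n m c k := fun k h3 h4 =>
      ⟨⟨by omega, hcn⟩, ⟨h3, by omega⟩, by linarith [(hc₁ k h3 h4).2.2, hcmin c₁ hec₁ hc₁n]⟩
    have hrow : ∀ z, e ≤ z → z ≤ n → FreeCell a b δ n m z r := by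
      intro z h3 h4
      obtain ⟨j, h5, h6, h7⟩ := hx z h3 h4
      exact ⟨h7.1, ⟨hr1, by omega⟩, by linarith [h7.2.2, hrmin j h5 h6]⟩
    refine (risePath_of_barrier_columns hδ ha0 he hec (by omega) hr1 (by omega)
      (fun k h3 h4 => hcol k h3 (by omega)) (fun z h3 h4 => hrow z h3 (by omega))
      (fun k h3 h4 => hrmin k h3 (by omega)) h1).trans ?_
    have conv : ∀ z k, 1 ≤ k → FreeCell a b δ n m (n + 1 - k) z →
        FreeCell b (backwards n a) δ m n z k := by
      rintro z k hz ⟨h1, h2, h3⟩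
      refine ⟨h2, ⟨by omega, by omega⟩, ?_⟩
      rwa [backwards, add_comm]
    have h := descendPath_of_barrier_lt (A := b) (B := backwards n a) (p := m) (q := n)
      (x := f) (c := r) (r := n + 1 - c) (j := 1) (x₀ := f) hδ hb0 hr1 hfm (by omega)
      (fun k h3 h4 => conv _ _ h3 (hrow _ (by omega) (by omega)))
      (fun z h3 h4 => conv _ _ (by omega) (by
        rw [show n + 1 - (n + 1 - c) = c by omega]; exact hcol z (by omega) h4))
      (fun k h3 h4 => by
        rw [backwards, backwards, show n + 1 - (n + 1 - c) = c by omega]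
        exact hcmin _ (by omega) (by omega))
      le_rfl (by omega) (fun k h3 h4 => by rw [show k = 1 by omega]) hrf le_rfl (by omega)
    have h := h.risePath_transposed
    rwa [show n + 1 - (n + 1 - c) = c by omega, show n + 1 - 1 = n by omega] at h

end

/-! ### Reasoning about programs -/

namespace RealRAM

/-- The memory after writing `v` to the natural register `x`. -/
def State.setN (s : State) (x v : ℕ) : State :=
  { s with natReg := Function.update s.natReg x v }

/-- The memory after writing `v` to the real register `x`. -/
noncomputable def State.setR (s : State) (x : ℕ) (v : ℝ) : State :=
  { s with realReg := Function.update s.realReg x v }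

/-- The memory after writing `v` at position `i` of the natural array `a`. -/
def State.putN (s : State) (a i v : ℕ) : State :=
  { s with natArr := write s.natArr a i v }

/-- The memory after writing `v` at position `i` of the real array `a`. -/
noncomputable def State.putR (s : State) (a i : ℕ) (v : ℝ) : State :=
  { s with realArr := write s.realArr a i v }

theorem write_apply {α : Type} (f : ℕ → ℕ → α) (a i : ℕ) (v : α) (b j : ℕ) :
    write f a i v b j = if b = a ∧ j = i then v else f b j := by
  unfold write
  by_cases h : b = a
  · subst h
    by_cases h' : j = i
    · subst h'; simp
    · simp [h']
  · simp [h]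

section
variable (s : State) (x y a b i j v : ℕ) (r : ℝ)

@[simp] theorem State.setN_natReg : (s.setN x v).natReg y = if y = x then v else s.natReg y := by
  simp [State.setN, Function.update_apply]
@[simp] theorem State.setN_realReg : (s.setN x v).realReg = s.realReg := rfl
@[simp] theorem State.setN_natArr : (s.setN x v).natArr = s.natArr := rfl
@[simp] theorem State.setN_realArr : (s.setN x v).realArr = s.realArr := rfl
@[simp] theorem State.setR_natReg : (s.setR x r).natReg = s.natReg := rfl
@[simp] theorem State.setR_realReg :
    (s.setR x r).realReg y = if y = x then r else s.realReg y := by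
  simp [State.setR, Function.update_apply]
@[simp] theorem State.setR_natArr : (s.setR x r).natArr = s.natArr := rfl
@[simp] theorem State.setR_realArr : (s.setR x r).realArr = s.realArr := rfl
@[simp] theorem State.putN_natReg : (s.putN a i v).natReg = s.natReg := rfl
@[simp] theorem State.putN_realReg : (s.putN a i v).realReg = s.realReg := rfl
@[simp] theorem State.putN_natArr :
    (s.putN a i v).natArr b j = if b = a ∧ j = i then v else s.natArr b j :=
  write_apply _ _ _ _ _ _
@[simp] theorem State.putN_realArr : (s.putN a i v).realArr = s.realArr := rfl
@[simp] theorem State.putR_natReg : (s.putR a i r).natReg = s.natReg := rfl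
@[simp] theorem State.putR_realArr :
    (s.putR a i r).realArr b j = if b = a ∧ j = i then r else s.realArr b j :=
  write_apply _ _ _ _ _ _

end

/-- Started in `s`, the program `c` halts, and its running time and final memory satisfy `Q`. -/
def HaltsWith (c : Cmd) (Q : ℕ → State → Prop) (s : State) : Prop :=
  ∃ t s', Exec c s t s' ∧ Q t s'

section
variable {c c₁ c₂ : Cmd} {Q Q' : ℕ → State → Prop} {s : State}

theorem HaltsWith.mono (h : HaltsWith c Q s) (hQ : ∀ t s', Q t s' → Q' t s') :
    HaltsWith c Q' s := by
  obtain ⟨t, s', h1, h2⟩ := h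
  exact ⟨t, s', h1, hQ _ _ h2⟩

theorem haltsWith_skip : HaltsWith .skip Q s ↔ Q 1 s :=
  ⟨by rintro ⟨t, s', h, hQ⟩; cases h; exact hQ, fun h => ⟨_, _, .skip s, h⟩⟩

theorem haltsWith_setNat {x : ℕ} {e : NatExp} :
    HaltsWith (.setNat x e) Q s ↔ Q (e.cost + 1) (s.setN x (e.eval s)) :=
  ⟨by rintro ⟨t, s', h, hQ⟩; cases h; exact hQ, fun h => ⟨_, _, .setNat s x e, h⟩⟩

theorem haltsWith_setReal {x : ℕ} {e : RealExp} :
    HaltsWith (.setReal x e) Q s ↔ Q (e.cost + 1) (s.setR x (e.eval s)) :=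
  ⟨by rintro ⟨t, s', h, hQ⟩; cases h; exact hQ, fun h => ⟨_, _, .setReal s x e, h⟩⟩

theorem haltsWith_putNat {a : ℕ} {i e : NatExp} :
    HaltsWith (.putNat a i e) Q s ↔ Q (i.cost + e.cost + 1) (s.putN a (i.eval s) (e.eval s)) :=
  ⟨by rintro ⟨t, s', h, hQ⟩; cases h; exact hQ, fun h => ⟨_, _, .putNat s a i e, h⟩⟩

theorem haltsWith_putReal {a : ℕ} {i : NatExp} {e : RealExp} :
    HaltsWith (.putReal a i e) Q s ↔ Q (i.cost + e.cost + 1) (s.putR a (i.eval s) (e.eval s)) :=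
  ⟨by rintro ⟨t, s', h, hQ⟩; cases h; exact hQ, fun h => ⟨_, _, .putReal s a i e, h⟩⟩

theorem haltsWith_seq : HaltsWith (.seq c₁ c₂) Q s ↔
    HaltsWith c₁ (fun t s' => HaltsWith c₂ (fun t' => Q (t + t')) s') s := by
  constructor
  · rintro ⟨t, s', h, hQ⟩
    cases h with
    | seq h1 h2 => exact ⟨_, _, h1, _, _, h2, hQ⟩
  · rintro ⟨_, _, h1, _, _, h2, hQ⟩
    exact ⟨_, _, .seq h1 h2, hQ⟩

theorem haltsWith_ite {b : Test} : HaltsWith (.ite b c₁ c₂) Q s ↔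
    (b.holds s → HaltsWith c₁ (fun t => Q (b.cost + 1 + t)) s) ∧
    (¬ b.holds s → HaltsWith c₂ (fun t => Q (b.cost + 1 + t)) s) := by
  constructor
  · rintro ⟨t, s', h, hQ⟩
    cases h with
    | iteTrue hb h => exact ⟨fun _ => ⟨_, _, h, hQ⟩, fun h' => absurd hb h'⟩
    | iteFalse hb h => exact ⟨fun h' => absurd h' hb, fun _ => ⟨_, _, h, hQ⟩⟩
  · rintro ⟨h1, h2⟩
    by_cases hb : b.holds s
    · obtain ⟨_, _, h, hQ⟩ := h1 hb
      exact ⟨_, _, .iteTrue hb h, hQ⟩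
    · obtain ⟨_, _, h, hQ⟩ := h2 hb
      exact ⟨_, _, .iteFalse hb h, hQ⟩

end

/-- The natural registers that a program may write. -/
def Cmd.natRegs : Cmd → List ℕ
  | .setNat x _ => [x]
  | .seq c₁ c₂ => c₁.natRegs ++ c₂.natRegs
  | .ite _ c₁ c₂ => c₁.natRegs ++ c₂.natRegs
  | .loop _ c => c.natRegs
  | _ => []

/-- The real registers that a program may write. -/
def Cmd.realRegs : Cmd → List ℕ
  | .setReal x _ => [x]
  | .seq c₁ c₂ => c₁.realRegs ++ c₂.realRegs
  | .ite _ c₁ c₂ => c₁.realRegs ++ c₂.realRegs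
  | .loop _ c => c.realRegs
  | _ => []

/-- The natural arrays that a program may write. -/
def Cmd.natArrs : Cmd → List ℕ
  | .putNat a _ _ => [a]
  | .seq c₁ c₂ => c₁.natArrs ++ c₂.natArrs
  | .ite _ c₁ c₂ => c₁.natArrs ++ c₂.natArrs
  | .loop _ c => c.natArrs
  | _ => []

/-- The real arrays that a program may write. -/
def Cmd.realArrs : Cmd → List ℕ
  | .putReal a _ _ => [a]
  | .seq c₁ c₂ => c₁.realArrs ++ c₂.realArrs
  | .ite _ c₁ c₂ => c₁.realArrs ++ c₂.realArrs
  | .loop _ c => c.realArrs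
  | _ => []

/-- The memories `s` and `s'` agree on everything that the program `c` never writes. -/
structure Frame (c : Cmd) (s s' : State) : Prop where
  natReg : ∀ x, x ∉ c.natRegs → s'.natReg x = s.natReg x
  realReg : ∀ x, x ∉ c.realRegs → s'.realReg x = s.realReg x
  natArr : ∀ a, a ∉ c.natArrs → s'.natArr a = s.natArr a
  realArr : ∀ a, a ∉ c.realArrs → s'.realArr a = s.realArr a

theorem Frame.rfl {c : Cmd} {s : State} : Frame c s s :=
  ⟨fun _ _ => Eq.refl _, fun _ _ => Eq.refl _, fun _ _ => Eq.refl _, fun _ _ => Eq.refl _⟩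

theorem Frame.trans {c : Cmd} {s s' s'' : State} (h : Frame c s s') (h' : Frame c s' s'') :
    Frame c s s'' :=
  ⟨fun x hx => (h'.natReg x hx).trans (h.natReg x hx),
    fun x hx => (h'.realReg x hx).trans (h.realReg x hx),
    fun x hx => (h'.natArr x hx).trans (h.natArr x hx),
    fun x hx => (h'.realArr x hx).trans (h.realArr x hx)⟩

theorem Frame.of_subset {c c' : Cmd} {s s' : State} (h : Frame c s s')
    (h1 : c.natRegs ⊆ c'.natRegs) (h2 : c.realRegs ⊆ c'.realRegs) (h3 : c.natArrs ⊆ c'.natArrs)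
    (h4 : c.realArrs ⊆ c'.realArrs) : Frame c' s s' :=
  ⟨fun x hx => h.natReg x fun h' => hx (h1 h'), fun x hx => h.realReg x fun h' => hx (h2 h'),
    fun x hx => h.natArr x fun h' => hx (h3 h'), fun x hx => h.realArr x fun h' => hx (h4 h')⟩

theorem write_of_ne {α : Type} {f : ℕ → ℕ → α} {a i : ℕ} {v : α} {b : ℕ} (h : b ≠ a) :
    write f a i v b = f b := by
  simp [write, h]

theorem Exec.frame {c : Cmd} {s s' : State} {t : ℕ} (h : Exec c s t s') : Frame c s s' := by
  induction h with
  | skip => exact .rfl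
  | setNat s x e =>
    refine ⟨fun y hy => ?_, fun _ _ => rfl, fun _ _ => rfl, fun _ _ => rfl⟩
    exact Function.update_of_ne (by simpa [Cmd.natRegs] using hy) _ _
  | setReal s x e =>
    refine ⟨fun _ _ => rfl, fun y hy => ?_, fun _ _ => rfl, fun _ _ => rfl⟩
    exact Function.update_of_ne (by simpa [Cmd.realRegs] using hy) _ _
  | putNat s a i e =>
    refine ⟨fun _ _ => rfl, fun _ _ => rfl, fun y hy => ?_, fun _ _ => rfl⟩
    exact write_of_ne (by simpa [Cmd.natArrs] using hy)
  | putReal s a i e =>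
    refine ⟨fun _ _ => rfl, fun _ _ => rfl, fun _ _ => rfl, fun y hy => ?_⟩
    exact write_of_ne (by simpa [Cmd.realArrs] using hy)
  | seq _ _ ih₁ ih₂ =>
    exact (ih₁.of_subset (by simp [Cmd.natRegs]) (by simp [Cmd.realRegs]) (by simp [Cmd.natArrs])
      (by simp [Cmd.realArrs])).trans (ih₂.of_subset (by simp [Cmd.natRegs])
      (by simp [Cmd.realRegs]) (by simp [Cmd.natArrs]) (by simp [Cmd.realArrs]))
  | iteTrue _ _ ih | iteFalse _ _ ih =>
    exact ih.of_subset (by simp [Cmd.natRegs]) (by simp [Cmd.realRegs]) (by simp [Cmd.natArrs])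
      (by simp [Cmd.realArrs])
  | loopDone => exact .rfl
  | loopStep _ _ _ ih₁ ih₂ =>
    exact (ih₁.of_subset (by simp [Cmd.natRegs]) (by simp [Cmd.realRegs]) (by simp [Cmd.natArrs])
      (by simp [Cmd.realArrs])).trans ih₂

theorem HaltsWith.frame {c : Cmd} {Q : ℕ → State → Prop} {s : State} (h : HaltsWith c Q s) :
    HaltsWith c (fun t s' => Q t s' ∧ Frame c s s') s := by
  obtain ⟨t, s', h1, h2⟩ := h
  exact ⟨t, s', h1, h2, h1.frame⟩

/-- The rule for loops: the index `k` of the invariant bounds the number of iterations that are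
still to come, and each iteration takes at most `K` steps. -/
theorem haltsWith_loop {b : Test} {c : Cmd} {s₀ : State} (I : ℕ → State → Prop) (K : ℕ)
    (hstep : ∀ k s, Frame (.loop b c) s₀ s → I k s → b.holds s →
      HaltsWith c (fun t s' => t ≤ K ∧ ∃ k' < k, I k' s') s) {k₀ : ℕ} (h₀ : I k₀ s₀) :
    HaltsWith (.loop b c) (fun t s' => t ≤ b.cost + 1 + k₀ * (K + b.cost + 1) ∧
      ¬ b.holds s' ∧ Frame (.loop b c) s₀ s' ∧ ∃ k ≤ k₀, I k s') s₀ := by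
  suffices H : ∀ k s, Frame (.loop b c) s₀ s → I k s →
      HaltsWith (.loop b c) (fun t s' => t ≤ b.cost + 1 + k * (K + b.cost + 1) ∧
      ¬ b.holds s' ∧ Frame (.loop b c) s₀ s' ∧ ∃ k' ≤ k, I k' s') s from H k₀ s₀ .rfl h₀
  intro k
  induction k using Nat.strong_induction_on with
  | _ k ih =>
  intro s hs hI
  by_cases hb : b.holds s
  · obtain ⟨t₁, s₁, h1, h2, k', hk', h3⟩ := hstep k s hs hI hb
    have hf : Frame (.loop b c) s s₁ := h1.frame.of_subset (by simp [Cmd.natRegs])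
      (by simp [Cmd.realRegs]) (by simp [Cmd.natArrs]) (by simp [Cmd.realArrs])
    obtain ⟨t₂, s₂, h4, h5, h6, h7, k'', h8, h9⟩ := ih k' hk' s₁ (hs.trans hf) h3
    refine ⟨_, _, .loopStep hb h1 h4, ?_, h6, h7, k'', by omega, h9⟩
    have : (k' + 1) * (K + b.cost + 1) ≤ k * (K + b.cost + 1) := Nat.mul_le_mul_right _ hk'
    rw [add_mul, one_mul] at this
    omega
  · exact ⟨_, _, .loopDone hb, by omega, hb, hs, k, le_rfl, hI⟩

/-- Run `body` with natural register `8` counting from `1` to the value of natural register `N`. -/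
def forUpTo (N : ℕ) (body : Cmd) : Cmd :=
  .seq (.setNat 8 (.const 1))
    (.loop (.natLe (.reg 8) (.reg N)) (.seq body (.setNat 8 (.add (.reg 8) (.const 1)))))

theorem haltsWith_forUpTo {N : ℕ} {body : Cmd} {s₀ : State} (hN : N ∉ body.natRegs)
    (h8 : 8 ∉ body.natRegs) (hN8 : N ≠ 8) (I : ℕ → State → Prop) (K : ℕ)
    (h₀ : I 0 (s₀.setN 8 1))
    (hstep : ∀ i s, i < s₀.natReg N → Frame (forUpTo N body) s₀ s → s.natReg 8 = i + 1 → I i s →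
      HaltsWith body (fun t s' => t ≤ K ∧ I (i + 1) (s'.setN 8 (i + 2))) s) :
    HaltsWith (forUpTo N body) (fun t s' => t ≤ 6 + s₀.natReg N * (K + 8) ∧
      Frame (forUpTo N body) s₀ s' ∧ I (s₀.natReg N) s') s₀ := by
  have hl : ∀ s, Frame (.loop (.natLe (.reg 8) (.reg N))
      (.seq body (.setNat 8 (.add (.reg 8) (.const 1))))) (s₀.setN 8 1) s →
      Frame (forUpTo N body) s₀ s := by
    intro s hs
    have h1 : Frame (forUpTo N body) s₀ (s₀.setN 8 1) :=
      ⟨fun x hx => by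
        have : x ≠ 8 := by rintro rfl; simp [forUpTo, Cmd.natRegs] at hx
        simp [this], fun _ _ => rfl, fun _ _ => rfl, fun _ _ => rfl⟩
    exact h1.trans (hs.of_subset (by simp [forUpTo, Cmd.natRegs]) (by simp [forUpTo, Cmd.realRegs])
      (by simp [forUpTo, Cmd.natArrs]) (by simp [forUpTo, Cmd.realArrs]))
  have hNN : N ∉ (forUpTo N body).natRegs := by simp [forUpTo, Cmd.natRegs, hN, hN8]
  suffices H : HaltsWith (.loop (.natLe (.reg 8) (.reg N))
      (.seq body (.setNat 8 (.add (.reg 8) (.const 1)))))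
      (fun t s' => t ≤ 4 + s₀.natReg N * (K + 8) ∧ I (s₀.natReg N) s') (s₀.setN 8 1) by
    refine (HaltsWith.frame (Q := fun t s' => t ≤ 6 + s₀.natReg N * (K + 8) ∧
      I (s₀.natReg N) s') ?_).mono fun t s' h => ⟨h.1.1, h.2, h.1.2⟩
    rw [forUpTo, haltsWith_seq, haltsWith_setNat]
    refine H.mono fun t s' h => ⟨?_, h.2⟩
    simp only [NatExp.cost]
    omega
  refine (haltsWith_loop (fun k s => ∃ i, i + k = s₀.natReg N ∧ s.natReg 8 = i + 1 ∧ I i s)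
    (K + 4) ?_ (k₀ := s₀.natReg N) ⟨0, by omega, by simp, h₀⟩).mono ?_
  · rintro k s hs ⟨i, hik, h8i, hi⟩ hb
    have hf := hl s hs
    simp only [Test.holds, NatExp.eval, hf.natReg N hNN, h8i] at hb
    rw [haltsWith_seq]
    refine (hstep i s (by omega) hf h8i hi).frame.mono ?_
    rintro t s' ⟨⟨ht, hI⟩, hfr⟩
    rw [haltsWith_setNat]
    have : s'.natReg 8 = i + 1 := (hfr.natReg 8 h8).trans h8i
    simp only [NatExp.cost, NatExp.eval, this]
    exact ⟨by omega, k - 1, by omega, i + 1, by omega, by simp, hI⟩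
  · rintro t s' ⟨ht, hb, hs, k, -, i, hik, h8i, hi⟩
    simp only [Test.holds, NatExp.eval, (hl s' hs).natReg N hNN, h8i] at hb
    obtain rfl : i = s₀.natReg N := by omega
    simp only [Test.cost, NatExp.cost] at ht
    exact ⟨ht, hi⟩

end RealRAM

/-! ### Ancestors in the tree of previous greater entries -/

theorem lastAbove_eq_of_le {v : ℕ → ℝ} {τ : ℝ} {d d' : ℕ} (hd : d' ≤ d)
    (h : ∀ k, d' < k → k ≤ d → v k ≤ τ) : lastAbove v τ d = lastAbove v τ d' := by
  induction d, hd using Nat.le_induction with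
  | base => rfl
  | succ d hd ih =>
    rw [lastAbove, if_neg (not_lt.2 (h _ (by omega) le_rfl)), ih fun k h1 h2 => h k h1 (by omega)]

theorem lastAbove_self {v : ℕ → ℝ} {τ : ℝ} {d : ℕ} (h : τ < v d) : lastAbove v τ d = d := by
  cases d with
  | zero => rfl
  | succ d => rw [lastAbove, if_pos h]

theorem lt_of_lastAbove_pos {v : ℕ → ℝ} {τ : ℝ} {d : ℕ} (h : 1 ≤ lastAbove v τ d) :
    τ < v (lastAbove v τ d) := by
  induction d with
  | zero => simp [lastAbove] at h
  | succ d ih =>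
    rw [lastAbove] at h ⊢
    split_ifs at h ⊢ with h1
    · exact h1
    · exact ih h

/-- The last position before `k` with an entry greater than `v k`; position `0` if there is none. -/
noncomputable def prevGreater (v : ℕ → ℝ) (k : ℕ) : ℕ := lastAbove v (v k) (k - 1)

section
variable {v : ℕ → ℝ} {q : ℕ}

theorem prevGreater_zero : prevGreater v 0 = 0 := rfl

theorem prevGreater_le (k : ℕ) : prevGreater v k ≤ k - 1 := lastAbove_le _ _ _

theorem iterate_prevGreater_zero (i : ℕ) : (prevGreater v)^[i] 0 = 0 :=
  Function.iterate_fixed prevGreater_zero i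

theorem iterate_prevGreater_le (i k : ℕ) : (prevGreater v)^[i] k ≤ k := by
  induction i generalizing k with
  | zero => exact le_rfl
  | succ i ih =>
    rw [Function.iterate_succ_apply]
    have := prevGreater_le (v := v) k
    have := ih (prevGreater v k)
    omega

theorem iterate_prevGreater_lt {i k : ℕ} (hi : 1 ≤ i) (hk : 1 ≤ k) :
    (prevGreater v)^[i] k < k := by
  obtain ⟨i, rfl⟩ : ∃ i', i = i' + 1 := ⟨i - 1, by omega⟩
  rw [Function.iterate_succ_apply]
  have := prevGreater_le (v := v) k
  have := iterate_prevGreater_le (v := v) i (prevGreater v k)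
  omega

theorem lastAbove_prevGreater {τ : ℝ} {k : ℕ} (h : v k ≤ τ) :
    lastAbove v τ k = lastAbove v τ (prevGreater v k) := by
  have h0 := prevGreater_le (v := v) k
  refine lastAbove_eq_of_le (by omega) fun j h1 h2 => ?_
  rcases h2.eq_or_lt with rfl | h2
  · exact h
  · exact ((lastAbove_lt_iff (by omega)).1 h1 j le_rfl (by omega)).trans h

/-- Following the pointers to previous greater entries through entries not exceeding `τ` does not
change the last exceedance of `τ`. -/
theorem lastAbove_iterate_prevGreater {τ : ℝ} {i k : ℕ}
    (h : v ((prevGreater v)^[i] k) ≤ τ) (hτ : τ < v 0) :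
    v k ≤ τ ∧ lastAbove v τ k = lastAbove v τ ((prevGreater v)^[i] k) := by
  induction i generalizing k with
  | zero => exact ⟨h, rfl⟩
  | succ i ih =>
    rw [Function.iterate_succ_apply] at h ⊢
    obtain ⟨h1, h2⟩ := ih h
    have hk : v k ≤ τ := by
      by_cases hp : prevGreater v k = 0
      · rw [hp] at h1; linarith
      · exact (lt_of_lastAbove_pos (Nat.pos_of_ne_zero hp)).le.trans h1
    exact ⟨hk, (lastAbove_prevGreater hk).trans h2⟩

/-- Entries increase strictly along the pointers, so that the chain of pointers is not longer than
the number of values. -/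
theorem iterate_prevGreater_eq_zero {S : Finset ℝ} (hS : ∀ j, 1 ≤ j → j ≤ q → v j ∈ S) {N k : ℕ}
    (hN : S.card ≤ N) (hk : k ≤ q) : (prevGreater v)^[N] k = 0 := by
  classical
  by_cases hk0 : k = 0
  · rw [hk0, iterate_prevGreater_zero]
  have hlt : (S.filter (v k < ·)).card < N := by
    refine lt_of_lt_of_le (Finset.card_lt_card ?_) hN
    exact Finset.filter_ssubset.2 ⟨v k, hS k (by omega) hk, lt_irrefl _⟩
  clear hN
  induction N generalizing k with
  | zero => omega
  | succ N ih =>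
    rw [Function.iterate_succ_apply]
    have hle := prevGreater_le (v := v) k
    by_cases hp : prevGreater v k = 0
    · rw [hp, iterate_prevGreater_zero]
    have h1 := lt_of_lastAbove_pos (v := v) (Nat.pos_of_ne_zero hp)
    refine ih (by omega) hp (lt_of_lt_of_le (Finset.card_lt_card ?_) (Nat.lt_succ_iff.1 hlt))
    refine Finset.ssubset_iff_subset_ne.2 ⟨fun y hy => ?_, fun h => ?_⟩
    · rw [Finset.mem_filter] at hy ⊢
      exact ⟨hy.1, h1.trans hy.2⟩
    · have : v (prevGreater v k) ∈ S.filter (v k < ·) :=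
        Finset.mem_filter.2 ⟨hS _ (by omega) (by omega), h1⟩
      rw [← h] at this
      exact lt_irrefl _ (Finset.mem_filter.1 this).2

end

/-! ### Programs for the queries -/

namespace RealRAM

theorem addr_inj {W l l' k k' : ℕ} (hk : k < W) (hk' : k' < W) (h : l * W + k = l' * W + k') :
    l = l' ∧ k = k' := by
  have hkk : k = k' := by
    have h2 : (l * W + k) % W = (l' * W + k') % W := by rw [h]
    rwa [Nat.mul_add_mod', Nat.mul_add_mod', Nat.mod_eq_of_lt hk, Nat.mod_eq_of_lt hk'] at h2
  subst hkk
  exact ⟨Nat.eq_of_mul_eq_mul_right (by omega) (Nat.add_right_cancel h), rfl⟩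

/-- Natural array `3` holds, at position `l * W + k`, the `2 ^ l`-th ancestor of position `k` in
the tree of previous greater entries of real array `4`, for all `k ≤ d` and `l < L`. -/
def AncestorTable (s : State) (W L d : ℕ) : Prop :=
  ∀ k ≤ d, ∀ l < L, s.natArr 3 (l * W + k) = (prevGreater (s.realArr 4))^[2 ^ l] k

/-- Replace the content `d` of natural register `6` by the last position in `[1..d]` at which real
array `4` exceeds real register `2`. The jumps to ancestors are tried in order of decreasing
length. -/
def queryCmd : Cmd :=
  .ite (.realLe (.get 4 (.reg 6)) (.reg 2))
    (.seq (.setNat 7 (.reg 5))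
      (.seq
        (.loop (.natLe (.reg 4) (.reg 7))
          (.seq (.setNat 7 (.sub (.reg 7) (.reg 4)))
            (.ite (.realLe (.get 4 (.get 3 (.add (.reg 7) (.reg 6)))) (.reg 2))
              (.setNat 6 (.get 3 (.add (.reg 7) (.reg 6))))
              .skip)))
        (.setNat 6 (.get 3 (.reg 6)))))
    .skip

theorem haltsWith_queryCmd {s : State} {W L : ℕ} (hL : 1 ≤ L) (hW : 1 ≤ W) (h4 : s.natReg 4 = W)
    (h5 : s.natReg 5 = L * W) (hτ : s.realReg 2 < s.realArr 4 0)
    (htab : AncestorTable s W L (s.natReg 6))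
    (hlong : (prevGreater (s.realArr 4))^[2 ^ L] (s.natReg 6) = 0) :
    HaltsWith queryCmd (fun t s' => t ≤ 40 * (L + 1) ∧
      s'.natReg 6 = lastAbove (s.realArr 4) (s.realReg 2) (s.natReg 6) ∧
      Frame queryCmd s s') s := by
  suffices H : HaltsWith queryCmd (fun t s' => t ≤ 40 * (L + 1) ∧
      s'.natReg 6 = lastAbove (s.realArr 4) (s.realReg 2) (s.natReg 6)) s from
    H.frame.mono fun t s' h => ⟨h.1.1, h.1.2, h.2⟩
  generalize hv : s.realArr 4 = v at *
  generalize hd : s.natReg 6 = d at *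
  generalize hr : s.realReg 2 = τ at *
  rw [queryCmd, haltsWith_ite]
  constructor
  · intro hb
    simp only [Test.holds, RealExp.eval, NatExp.eval, hv, hd, hr] at hb
    rw [haltsWith_seq, haltsWith_setNat, haltsWith_seq]
    refine (haltsWith_loop (fun l s' => l ≤ L ∧ s'.natReg 7 = l * W ∧ ∃ k, s'.natReg 6 = k ∧
      k ≤ d ∧ v k ≤ τ ∧ lastAbove v τ k = lastAbove v τ d ∧ τ < v ((prevGreater v)^[2 ^ l] k)) 20
      ?_ (k₀ := L) ?_).mono ?_
    · rintro l s' hf ⟨hlL, h7, k, h6, hkd, hk1, hk2, hk3⟩ hb'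
      have e4 : s'.natReg 4 = W := (hf.natReg 4 (by decide)).trans (by simpa using h4)
      have er : s'.realReg 2 = τ := (hf.realReg 2 (by decide)).trans hr
      have ev : s'.realArr 4 = v := (hf.realArr 4 (by decide)).trans hv
      have et : s'.natArr 3 = s.natArr 3 := hf.natArr 3 (by decide)
      simp only [Test.holds, NatExp.eval, e4, h7] at hb'
      obtain ⟨l, rfl⟩ : ∃ l', l = l' + 1 := ⟨l - 1, by
        rcases Nat.eq_zero_or_pos l with rfl | h
        · omega
        · omega⟩
      have h7' : (l + 1) * W - W = l * W := by rw [add_mul, one_mul, Nat.add_sub_cancel]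
      have hu := htab k hkd l (by omega)
      rw [hv] at hu
      rw [haltsWith_seq, haltsWith_setNat, haltsWith_ite]
      simp only [haltsWith_setNat, haltsWith_skip, Test.holds, Test.cost, RealExp.eval,
        RealExp.cost, NatExp.eval, NatExp.cost, State.setN_natReg, State.setN_realReg,
        State.setN_natArr, State.setN_realArr, h7, h6, e4, er, ev, et, h7', hu, if_true,
        (by decide : ¬ (6 = 7)), if_false, (by decide : ¬ (7 = 6))]
      refine ⟨fun h => ⟨by omega, l, by omega, by omega, rfl, _, rfl, ?_, h, ?_, ?_⟩,
        fun h => ⟨by omega, l, by omega, by omega, rfl, k, rfl, hkd, hk1, hk2, not_le.1 h⟩⟩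
      · exact (iterate_prevGreater_le _ _).trans hkd
      · rw [← hk2, (lastAbove_iterate_prevGreater h hτ).2]
      · rwa [← Function.iterate_add_apply, ← two_mul, ← pow_succ']
    · refine ⟨le_rfl, by simp [NatExp.eval, h5], d, by simpa using hd, le_rfl, hb, rfl, ?_⟩
      rw [hlong]
      exact hτ
    · rintro t s' ⟨ht, hb', hf, l, -, hlL, h7, k, h6, hkd, hk1, hk2, hk3⟩
      have e4 : s'.natReg 4 = W := (hf.natReg 4 (by decide)).trans (by simpa using h4)
      have et : s'.natArr 3 = s.natArr 3 := hf.natArr 3 (by decide)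
      simp only [Test.holds, NatExp.eval, e4, h7, not_le] at hb'
      obtain rfl : l = 0 := by
        by_contra h
        exact absurd (Nat.le_mul_of_pos_left W (Nat.pos_of_ne_zero h)) (not_le.2 hb')
      have hu := htab k hkd 0 hL
      rw [hv, zero_mul, zero_add] at hu
      rw [haltsWith_setNat]
      simp only [NatExp.eval, NatExp.cost, State.setN_natReg, if_true, h6, et, hu]
      simp only [Test.cost, RealExp.cost, NatExp.cost] at ht ⊢
      refine ⟨by omega, ?_⟩
      simp only [pow_zero, Function.iterate_one] at hk3 ⊢
      rw [← hk2, lastAbove_prevGreater hk1, lastAbove_self hk3]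
  · intro hb
    simp only [Test.holds, RealExp.eval, NatExp.eval, hv, hd, hr, not_le] at hb
    rw [haltsWith_skip, hd, lastAbove_self hb]
    refine ⟨?_, rfl⟩
    simp only [Test.cost, RealExp.cost, NatExp.cost]
    omega

end RealRAM

namespace RealRAM

/-- Set register `4` to the width `W = q + 1` of the rows of the table of ancestors and register
`5` to the size `L * W` of the table, where `L` is the least number with `6 < 2 ^ L * ε`, and clear
column `0` of the table. -/
def heightCmd : Cmd :=
  .seq (.setNat 4 (.add (.reg 3) (.const 1)))
    (.seq (.setNat 5 (.const 0))
      (.seq (.setReal 3 (.const 1))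
        (.loop (.realLe (.mul (.reg 3) (.reg 1)) (.const 6))
          (.seq (.putNat 3 (.reg 5) (.const 0))
            (.seq (.setNat 5 (.add (.reg 5) (.reg 4)))
              (.setReal 3 (.add (.reg 3) (.reg 3))))))))

theorem haltsWith_heightCmd {s : State} {L : ℕ}
    (hL : ∀ l, 2 ^ l * s.realReg 1 ≤ 6 ↔ l < L) :
    HaltsWith heightCmd (fun t s' => t ≤ 40 * (L + 1) ∧ s'.natReg 4 = s.natReg 3 + 1 ∧
      s'.natReg 5 = L * (s.natReg 3 + 1) ∧ (∀ l < L, s'.natArr 3 (l * (s.natReg 3 + 1)) = 0) ∧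
      Frame heightCmd s s') s := by
  suffices H : HaltsWith heightCmd (fun t s' => t ≤ 40 * (L + 1) ∧ s'.natReg 4 = s.natReg 3 + 1 ∧
      s'.natReg 5 = L * (s.natReg 3 + 1) ∧ (∀ l < L, s'.natArr 3 (l * (s.natReg 3 + 1)) = 0)) s from
    H.frame.mono fun t s' h => ⟨h.1.1, h.1.2.1, h.1.2.2.1, h.1.2.2.2, h.2⟩
  generalize hW : s.natReg 3 + 1 = W
  generalize hε : s.realReg 1 = ε at *
  rw [heightCmd, haltsWith_seq, haltsWith_setNat, haltsWith_seq, haltsWith_setNat, haltsWith_seq,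
    haltsWith_setReal]
  simp only [NatExp.eval, NatExp.cost, RealExp.cost, RealExp.eval, hW]
  refine (haltsWith_loop (fun k s' => ∃ l, l + k = L ∧ s'.natReg 5 = l * W ∧
    s'.realReg 3 = 2 ^ l ∧ ∀ l' < l, s'.natArr 3 (l' * W) = 0) 20 ?_ (k₀ := L) ?_).mono ?_
  · rintro k s' hf ⟨l, hlk, h5, h3, hz⟩ hb
    have e4 : s'.natReg 4 = W := (hf.natReg 4 (by decide)).trans (by simp)
    have e1 : s'.realReg 1 = ε := (hf.realReg 1 (by decide)).trans (by simpa using hε)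
    simp only [Test.holds, RealExp.eval, e1, h3, Rat.cast_ofNat, hL] at hb
    rw [haltsWith_seq, haltsWith_putNat, haltsWith_seq, haltsWith_setNat, haltsWith_setReal]
    simp only [NatExp.eval, NatExp.cost, RealExp.cost, RealExp.eval, State.putN_natReg,
      State.putN_realReg, State.setN_natReg, State.setN_realReg, State.setR_natReg,
      State.setR_realReg, State.setR_natArr, State.setN_natArr, State.putN_natArr, h5, e4, h3,
      if_true]
    refine ⟨by omega, k - 1, by omega, l + 1, by omega, by rw [add_mul, one_mul],
      by rw [pow_succ, mul_two], fun l' hl' => ?_⟩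
    rcases Nat.lt_or_ge l' l with h | h
    · rw [hz l' h, ite_self]
    · rw [show l' = l by omega]
      simp
  · exact ⟨0, by omega, by simp, by simp, fun l' hl' => by omega⟩
  · rintro t s' ⟨ht, hb, hf, k, -, l, hlk, h5, h3, hz⟩
    have e4 : s'.natReg 4 = W := (hf.natReg 4 (by decide)).trans (by simp)
    have e1 : s'.realReg 1 = ε := (hf.realReg 1 (by decide)).trans (by simpa using hε)
    simp only [Test.holds, RealExp.eval, e1, h3, Rat.cast_ofNat, hL] at hb
    obtain rfl : l = L := by omega
    simp only [Test.cost, RealExp.cost] at ht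
    exact ⟨by omega, e4, h5, hz⟩

/-- Enter the ancestors of the position in register `8`, whose previous greater position is in
register `6`, into the table. -/
def enterAncestorsCmd : Cmd :=
  .seq (.putNat 3 (.reg 8) (.reg 6))
    (.seq (.setNat 7 (.reg 4))
      (.loop (.not (.natLe (.reg 5) (.reg 7)))
        (.seq (.putNat 3 (.add (.reg 7) (.reg 8))
            (.get 3 (.add (.sub (.reg 7) (.reg 4))
              (.get 3 (.add (.sub (.reg 7) (.reg 4)) (.reg 8))))))
          (.setNat 7 (.add (.reg 7) (.reg 4))))))

theorem haltsWith_enterAncestorsCmd {s : State} {W L i : ℕ} (hL : 1 ≤ L) (h4 : s.natReg 4 = W)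
    (h5 : s.natReg 5 = L * W) (h8 : s.natReg 8 = i + 1) (hi : i + 1 < W)
    (h6 : s.natReg 6 = prevGreater (s.realArr 4) (i + 1)) (htab : AncestorTable s W L i) :
    HaltsWith enterAncestorsCmd (fun t s' => t ≤ 40 * (L + 1) ∧ AncestorTable s' W L (i + 1)) s := by
  generalize hv : s.realArr 4 = v at *
  rw [enterAncestorsCmd, haltsWith_seq, haltsWith_putNat, haltsWith_seq, haltsWith_setNat]
  simp only [NatExp.eval, NatExp.cost, State.putN_natReg, h4, h8, h6]
  refine (haltsWith_loop (fun r s' => ∃ l, 1 ≤ l ∧ l + r = L ∧ s'.natReg 7 = l * W ∧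
    (∀ l' < l, s'.natArr 3 (l' * W + (i + 1)) = (prevGreater v)^[2 ^ l'] (i + 1)) ∧
    ∀ k ≤ i, ∀ l' < L, s'.natArr 3 (l' * W + k) = (prevGreater v)^[2 ^ l'] k) 30
    ?_ (k₀ := L - 1) ?_).mono ?_
  · rintro r s' hf ⟨l, hl1, hlr, h7, hnew, hold⟩ hb
    have e4 : s'.natReg 4 = W := (hf.natReg 4 (by decide)).trans (by simpa using h4)
    have e5 : s'.natReg 5 = L * W := (hf.natReg 5 (by decide)).trans (by simpa using h5)
    have e8 : s'.natReg 8 = i + 1 := (hf.natReg 8 (by decide)).trans (by simpa using h8)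
    simp only [Test.holds, NatExp.eval, e5, h7, not_le] at hb
    have hlL : l < L := lt_of_mul_lt_mul_right hb (Nat.zero_le W)
    obtain ⟨l, rfl⟩ : ∃ l', l = l' + 1 := ⟨l - 1, by omega⟩
    have h7' : (l + 1) * W - W = l * W := by rw [add_mul, one_mul, Nat.add_sub_cancel]
    have hlt : (prevGreater v)^[2 ^ l] (i + 1) < i + 1 :=
      iterate_prevGreater_lt Nat.one_le_two_pow (by omega)
    have hval : s'.natArr 3 (l * W + (prevGreater v)^[2 ^ l] (i + 1)) =
        (prevGreater v)^[2 ^ (l + 1)] (i + 1) := by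
      rw [hold _ (by omega) l (by omega), ← Function.iterate_add_apply, ← two_mul, ← pow_succ']
    rw [haltsWith_seq, haltsWith_putNat, haltsWith_setNat]
    simp only [NatExp.eval, NatExp.cost, State.putN_natReg, State.setN_natReg, State.setN_natArr,
      State.putN_natArr, h7, e4, e8, h7', if_true, hnew l (by omega), hval, true_and]
    refine ⟨by omega, r - 1, by omega, l + 2, by omega, by omega, by ring, fun l' hl' => ?_,
      fun k hk l' hl' => ?_⟩
    · by_cases h : l' = l + 1
      · rw [if_pos (by rw [h]), h]
      · rw [if_neg fun h' => h (addr_inj hi hi h').1, hnew l' (by omega)]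
    · rw [if_neg fun h' => by have := (addr_inj (by omega) hi h').2; omega, hold k hk l' hl']
  · refine ⟨1, le_rfl, by omega, by simp, fun l' hl' => ?_, fun k hk l' hl' => ?_⟩
    · obtain rfl : l' = 0 := by omega
      simp
    · have hne : l' * W + k ≠ i + 1 := fun h => by
        have := (addr_inj (l := l') (l' := 0) (k := k) (k' := i + 1) (by omega) hi (by omega)).2
        omega
      have := htab k hk l' hl'
      rw [hv] at this
      simp [hne, this]
  · rintro t s' ⟨ht, hb, hf, r, -, l, hl1, hlr, h7, hnew, hold⟩
    have e5 : s'.natReg 5 = L * W := (hf.natReg 5 (by decide)).trans (by simpa using h5)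
    have ev : s'.realArr 4 = v := (hf.realArr 4 (by decide)).trans (by simpa using hv)
    simp only [Test.holds, NatExp.eval, e5, h7, not_not] at hb
    have hLl : L ≤ l := le_of_mul_le_mul_right hb (by omega)
    obtain rfl : l = L := by omega
    simp only [Test.cost, NatExp.cost] at ht
    refine ⟨by omega, fun k hk l' hl' => ?_⟩
    rw [ev]
    rcases hk.eq_or_lt with rfl | hk
    · exact hnew l' hl'
    · exact hold k (by omega) l' hl'

/-- Build the table of ancestors for positions `[1..q]`. The previous greater position of a position
is found by a query to the part of the table that is complete already. -/
def buildCmd : Cmd :=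
  forUpTo 3
    (.seq (.setNat 6 (.sub (.reg 8) (.const 1)))
      (.seq (.setReal 2 (.get 4 (.reg 8))) (.seq queryCmd enterAncestorsCmd)))

theorem haltsWith_buildCmd {s : State} {L : ℕ} {S : Finset ℝ} (hL : 1 ≤ L)
    (h4 : s.natReg 4 = s.natReg 3 + 1) (h5 : s.natReg 5 = L * (s.natReg 3 + 1))
    (hzero : ∀ l < L, s.natArr 3 (l * (s.natReg 3 + 1)) = 0)
    (hS : ∀ j, 1 ≤ j → j ≤ s.natReg 3 → s.realArr 4 j ∈ S) (hcard : S.card ≤ 2 ^ L)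
    (hS0 : ∀ x ∈ S, x < s.realArr 4 0) :
    HaltsWith buildCmd (fun t s' => t ≤ 6 + s.natReg 3 * (120 * (L + 1)) ∧
      AncestorTable s' (s.natReg 3 + 1) L (s.natReg 3) ∧ Frame buildCmd s s') s := by
  generalize hv : s.realArr 4 = v at *
  refine (haltsWith_forUpTo (by decide) (by decide) (by decide)
    (fun i s' => AncestorTable s' (s.natReg 3 + 1) L i) (80 * (L + 1) + 20) ?_ ?_).mono ?_
  · intro k hk l hl
    obtain rfl : k = 0 := by omega
    rw [iterate_prevGreater_zero]
    simpa using hzero l hl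
  · intro i s' hi hf h8 htab
    have e3 : s'.natReg 3 = s.natReg 3 := hf.natReg 3 (by decide)
    have e4 : s'.natReg 4 = s.natReg 3 + 1 := (hf.natReg 4 (by decide)).trans h4
    have e5 : s'.natReg 5 = L * (s.natReg 3 + 1) := (hf.natReg 5 (by decide)).trans h5
    have ev : s'.realArr 4 = v := (hf.realArr 4 (by decide)).trans hv
    rw [haltsWith_seq, haltsWith_setNat, haltsWith_seq, haltsWith_setReal, haltsWith_seq]
    simp only [NatExp.eval, NatExp.cost, RealExp.eval, RealExp.cost, State.setN_natReg,
      State.setN_realArr, h8, ev, (by decide : ¬ (8 = 6)), if_false, Nat.add_sub_cancel]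
    refine (haltsWith_queryCmd (W := s.natReg 3 + 1) (L := L) hL (by omega) (by simpa using e4)
      (by simpa using e5) ?_ ?_ ?_).mono ?_
    · simpa [ev] using hS0 _ (hS (i + 1) (by omega) hi)
    · intro k hk l hl
      simp only [State.setR_natReg, State.setN_natReg, if_true] at hk
      simpa using htab k hk l hl
    · simp only [State.setR_natReg, State.setN_natReg, if_true, State.setR_realArr,
        State.setN_realArr, ev]
      exact iterate_prevGreater_eq_zero hS hcard (by omega)
    · rintro t s₁ ⟨ht, h6, hq⟩
      have f4 : s₁.natReg 4 = s.natReg 3 + 1 := (hq.natReg 4 (by decide)).trans (by simpa using e4)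
      have f5 : s₁.natReg 5 = L * (s.natReg 3 + 1) :=
        (hq.natReg 5 (by decide)).trans (by simpa using e5)
      have f8 : s₁.natReg 8 = i + 1 := (hq.natReg 8 (by decide)).trans (by simpa using h8)
      have fv : s₁.realArr 4 = v := (hq.realArr 4 (by decide)).trans (by simpa using ev)
      have ft : s₁.natArr 3 = s'.natArr 3 := (hq.natArr 3 (by decide)).trans (by simp)
      refine (haltsWith_enterAncestorsCmd hL f4 f5 f8 (by omega) ?_ ?_).mono ?_
      · rw [h6, fv]
        simp [prevGreater, ev]
      · intro k hk l hl
        rw [ft, fv, ← ev]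
        exact htab k hk l hl
      · rintro t' s₂ ⟨ht', htab'⟩
        refine ⟨by omega, fun k hk l hl => ?_⟩
        simpa using htab' k hk l hl
  · rintro t s' ⟨ht, hf, htab⟩
    refine ⟨ht.trans (Nat.add_le_add_left (Nat.mul_le_mul_left _ (by omega)) _), htab, hf⟩

end RealRAM

/-! ### The program for the barriers -/

namespace RealRAM

/-- The memory is prepared for queries to real array `4` on positions up to the content `q` of
natural register `3`. -/
structure Ready (s : State) (L : ℕ) : Prop where
  width : s.natReg 4 = s.natReg 3 + 1
  size : s.natReg 5 = L * (s.natReg 3 + 1)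
  table : AncestorTable s (s.natReg 3 + 1) L (s.natReg 3)
  long : ∀ d ≤ s.natReg 3, (prevGreater (s.realArr 4))^[2 ^ L] d = 0

theorem Ready.congr {s s' : State} {L : ℕ} (h : Ready s L) (h3 : s'.natReg 3 = s.natReg 3)
    (h4 : s'.natReg 4 = s.natReg 4) (h5 : s'.natReg 5 = s.natReg 5)
    (ha : s'.natArr 3 = s.natArr 3) (hv : s'.realArr 4 = s.realArr 4) : Ready s' L := by
  refine ⟨by rw [h3, h4, h.width], by rw [h5, h3, h.size], ?_, ?_⟩
  · intro k hk l hl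
    rw [ha, hv, h3]
    exact h.table k (by omega) l hl
  · rw [hv, h3]
    exact h.long

theorem Ready.haltsWith_queryCmd {s : State} {L : ℕ} (h : Ready s L) (hL : 1 ≤ L)
    (hd : s.natReg 6 ≤ s.natReg 3) (hτ : s.realReg 2 < s.realArr 4 0) :
    HaltsWith queryCmd (fun t s' => t ≤ 40 * (L + 1) ∧
      s'.natReg 6 = lastAbove (s.realArr 4) (s.realReg 2) (s.natReg 6) ∧
      Frame queryCmd s s') s :=
  RealRAM.haltsWith_queryCmd hL (by omega) h.width h.size hτ
    (fun k hk => h.table k (hk.trans hd)) (h.long _ hd)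

/-- Write the prefix minima of real array `3` to real array `4`. -/
noncomputable def prefixMinCmd : Cmd :=
  .seq (.putReal 4 (.const 0) (.mul (.const 3) (.reg 0)))
    (forUpTo 3
      (.ite (.realLe (.get 4 (.sub (.reg 8) (.const 1))) (.get 3 (.reg 8)))
        (.putReal 4 (.reg 8) (.get 4 (.sub (.reg 8) (.const 1))))
        (.putReal 4 (.reg 8) (.get 3 (.reg 8)))))

theorem haltsWith_prefixMinCmd (s : State) :
    HaltsWith prefixMinCmd (fun t s' => t ≤ 20 + s.natReg 3 * 40 ∧
      (∀ j ≤ s.natReg 3, s'.realArr 4 j = prefixMin (3 * s.realReg 0) (s.realArr 3) j) ∧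
      Frame prefixMinCmd s s') s := by
  suffices H : HaltsWith prefixMinCmd (fun t s' => t ≤ 20 + s.natReg 3 * 40 ∧
      (∀ j ≤ s.natReg 3, s'.realArr 4 j = prefixMin (3 * s.realReg 0) (s.realArr 3) j)) s from
    H.frame.mono fun t s' h => ⟨h.1.1, h.1.2, h.2⟩
  generalize hB : s.realArr 3 = B
  rw [prefixMinCmd, haltsWith_seq, haltsWith_putReal]
  simp only [NatExp.eval, NatExp.cost, RealExp.eval, RealExp.cost]
  refine (haltsWith_forUpTo (by decide) (by decide) (by decide)
    (fun i s' => ∀ j ≤ i, s'.realArr 4 j = prefixMin (3 * s.realReg 0) B j) 20 ?_ ?_).mono ?_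
  · intro j hj
    obtain rfl : j = 0 := by omega
    simp [prefixMin]
  · intro i s' hi hf h8 hI
    have eB : s'.realArr 3 = B := by
      rw [hf.realArr 3 (by decide), ← hB]
      ext j
      simp
    rw [haltsWith_ite, haltsWith_putReal, haltsWith_putReal]
    simp only [Test.holds, Test.cost, NatExp.eval, NatExp.cost, RealExp.eval, RealExp.cost,
      h8, Nat.add_sub_cancel, hI i le_rfl, eB, State.setN_realArr, State.putR_realArr]
    constructor <;> intro hle <;> refine ⟨by omega, fun j hj => ?_⟩
    all_goals
      rcases hj.eq_or_lt with rfl | hj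
      · simp only [if_true, true_and, prefixMin]
        first
        | rw [min_eq_left hle]
        | rw [min_eq_right (not_le.1 hle).le]
      · rw [if_neg (by omega), hI j (by omega)]
  · rintro t s' ⟨ht, -, hI⟩
    simp only [State.putR_natReg] at ht hI
    exact ⟨by omega, hI⟩

/-- Copy real array `3` to real array `4`, with a sentinel at position `0`. -/
noncomputable def copyCmd : Cmd :=
  .seq (.putReal 4 (.const 0) (.mul (.const 3) (.reg 0)))
    (forUpTo 3 (.putReal 4 (.reg 8) (.get 3 (.reg 8))))

theorem haltsWith_copyCmd (s : State) :
    HaltsWith copyCmd (fun t s' => t ≤ 20 + s.natReg 3 * 40 ∧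
      s'.realArr 4 0 = 3 * s.realReg 0 ∧
      (∀ j, 1 ≤ j → j ≤ s.natReg 3 → s'.realArr 4 j = s.realArr 3 j) ∧
      Frame copyCmd s s') s := by
  suffices H : HaltsWith copyCmd (fun t s' => t ≤ 20 + s.natReg 3 * 40 ∧
      s'.realArr 4 0 = 3 * s.realReg 0 ∧
      (∀ j, 1 ≤ j → j ≤ s.natReg 3 → s'.realArr 4 j = s.realArr 3 j)) s from
    H.frame.mono fun t s' h => ⟨h.1.1, h.1.2.1, h.1.2.2, h.2⟩
  generalize hB : s.realArr 3 = B
  rw [copyCmd, haltsWith_seq, haltsWith_putReal]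
  simp only [NatExp.eval, NatExp.cost, RealExp.eval, RealExp.cost]
  refine (haltsWith_forUpTo (by decide) (by decide) (by decide)
    (fun i s' => s'.realArr 4 0 = 3 * s.realReg 0 ∧ ∀ j, 1 ≤ j → j ≤ i → s'.realArr 4 j = B j)
    20 ?_ ?_).mono ?_
  · exact ⟨by simp, fun j h1 h2 => by omega⟩
  · rintro i s' hi hf h8 ⟨hI0, hI⟩
    have eB : s'.realArr 3 = B := by
      rw [hf.realArr 3 (by decide), ← hB]
      ext j
      simp
    rw [haltsWith_putReal]
    simp only [NatExp.eval, NatExp.cost, RealExp.eval, RealExp.cost,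
      h8, eB, State.setN_realArr, State.putR_realArr]
    refine ⟨by omega, ?_, fun j hj1 hj => ?_⟩
    · rw [if_neg (by omega), hI0]
    · rcases hj.eq_or_lt with rfl | hj
      · simp
      · rw [if_neg (by omega), hI j hj1 (by omega)]
  · rintro t s' ⟨ht, -, hI⟩
    simp only [State.putR_natReg] at ht hI
    exact ⟨by omega, hI⟩

/-- For every position `x ≤ p` of real array `2`, query the last of all levels that exceeds
`δ - A x`, and store the answer in natural array `4`. -/
def queryAllCmd : Cmd :=
  forUpTo 2
    (.seq (.setNat 6 (.reg 3))
      (.seq (.setReal 2 (.sub (.reg 0) (.get 2 (.reg 8))))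
        (.seq queryCmd (.putNat 4 (.reg 8) (.reg 6)))))

theorem haltsWith_queryAllCmd {s : State} {L : ℕ} (hs : Ready s L) (hL : 1 ≤ L)
    (hτ : ∀ x, 1 ≤ x → x ≤ s.natReg 2 → s.realReg 0 - s.realArr 2 x < s.realArr 4 0) :
    HaltsWith queryAllCmd (fun t s' => t ≤ 6 + s.natReg 2 * (80 * (L + 1)) ∧
      (∀ x, 1 ≤ x → x ≤ s.natReg 2 → s'.natArr 4 x =
        lastAbove (s.realArr 4) (s.realReg 0 - s.realArr 2 x) (s.natReg 3)) ∧
      Frame queryAllCmd s s') s := by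
  refine (haltsWith_forUpTo (by decide) (by decide) (by decide)
    (fun i s' => ∀ x, 1 ≤ x → x ≤ i → s'.natArr 4 x =
        lastAbove (s.realArr 4) (s.realReg 0 - s.realArr 2 x) (s.natReg 3)) (40 * (L + 1) + 30)
    (fun x h1 h2 => by omega) ?_).mono ?_
  · rintro i s' hi hf h8 hI
    have hs' : Ready s' L := hs.congr (hf.natReg 3 (by decide)) (hf.natReg 4 (by decide))
      (hf.natReg 5 (by decide)) (hf.natArr 3 (by decide)) (hf.realArr 4 (by decide))
    have e3 : s'.natReg 3 = s.natReg 3 := hf.natReg 3 (by decide)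
    have e0 : s'.realReg 0 = s.realReg 0 := hf.realReg 0 (by decide)
    have e2 : s'.realArr 2 = s.realArr 2 := hf.realArr 2 (by decide)
    have ev : s'.realArr 4 = s.realArr 4 := hf.realArr 4 (by decide)
    rw [haltsWith_seq, haltsWith_setNat, haltsWith_seq, haltsWith_setReal, haltsWith_seq]
    simp only [NatExp.eval, NatExp.cost, RealExp.eval, RealExp.cost, State.setN_natReg,
      State.setN_realReg, State.setN_realArr, (by decide : ¬ (8 = 6)), if_false, h8, e3, e0, e2]
    refine (Ready.haltsWith_queryCmd (L := L) ?_ hL (by simp [e3]) ?_).mono ?_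
    · exact hs'.congr (by simp) (by simp) (by simp) rfl rfl
    · simpa [ev] using hτ (i + 1) (by omega) hi
    · rintro t s₁ ⟨ht, h6, hq⟩
      have f8 : s₁.natReg 8 = i + 1 := (hq.natReg 8 (by decide)).trans (by simpa using h8)
      have f4 : s₁.natArr 4 = s'.natArr 4 := hq.natArr 4 (by decide)
      simp only [State.setR_natReg, State.setN_natReg, if_true, State.setR_realReg,
        State.setR_realArr, State.setN_realArr, ev] at h6
      rw [haltsWith_putNat]
      simp only [NatExp.eval, NatExp.cost, State.setN_natArr, State.putN_natArr, f8, h6, f4,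
        true_and]
      refine ⟨by omega, fun x h1 h2 => ?_⟩
      rcases h2.eq_or_lt with rfl | h2
      · rw [if_pos rfl]
      · rw [if_neg (by omega), hI x h1 (by omega)]
  · rintro t s' ⟨ht, hf, hI⟩
    exact ⟨ht.trans (Nat.add_le_add_left (Nat.mul_le_mul_left _ (by omega)) _), hI, hf⟩

/-- The recursion for the barriers, with the barrier of the last position in register `6`. -/
noncomputable def recursionCmd : Cmd :=
  .seq (.setReal 3 (.mul (.const 3) (.reg 0)))
    (.seq (.setNat 6 (.const 0))
      (forUpTo 2
        (.seq
          (.ite (.not (.realLe (.reg 3) (.get 2 (.reg 8))))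
            (.seq (.setReal 3 (.get 2 (.reg 8))) (.setNat 6 (.const 0)))
            (.seq (.setReal 2 (.sub (.reg 0) (.get 2 (.reg 8))))
              (.seq queryCmd
                (.ite (.natLe (.reg 6) (.get 4 (.reg 8)))
                  (.setNat 6 (.get 4 (.reg 8)))
                  .skip))))
          (.putNat 5 (.reg 8) (.reg 6)))))

theorem haltsWith_recursionCmd {s : State} {L : ℕ} {A B : ℕ → ℝ} {δ : ℝ} {p q : ℕ}
    (hs : Ready s L) (hL : 1 ≤ L) (hp : s.natReg 2 = p) (hq : s.natReg 3 = q)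
    (hδ : s.realReg 0 = δ) (hA : s.realArr 2 = A)
    (hτ : ∀ x, 1 ≤ x → x ≤ p → δ - A x < s.realArr 4 0)
    (hB : ∀ j, 1 ≤ j → j ≤ q → s.realArr 4 j = B j)
    (hJ : ∀ x, 1 ≤ x → x ≤ p → s.natArr 4 x = lastAbove (prefixMin (3 * δ) B) (δ - A x) q) :
    HaltsWith recursionCmd (fun t s' => t ≤ 20 + p * (80 * (L + 1)) ∧
      (∀ x, 1 ≤ x → x ≤ p → s'.natArr 5 x = barrier A B δ q x)) s := by
  rw [recursionCmd, haltsWith_seq, haltsWith_setReal, haltsWith_seq, haltsWith_setNat]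
  simp only [NatExp.eval, NatExp.cost, RealExp.eval, RealExp.cost]
  refine (haltsWith_forUpTo (by decide) (by decide) (by decide)
    (fun i s' => s'.natReg 6 = barrier A B δ q i ∧ s'.realReg 3 = prefixMin (3 * δ) A i ∧
      ∀ x, 1 ≤ x → x ≤ i → s'.natArr 5 x = barrier A B δ q x) (40 * (L + 1) + 38)
    ⟨by simp [barrier], by simp [prefixMin, hδ], fun x h1 h2 => by omega⟩ ?_).mono ?_
  · rintro i s' hi hf h8 ⟨h6, h3, hI⟩
    simp only [State.setN_natReg, State.setR_natReg, (by decide : ¬ (2 = 6)), if_false, hp] at hi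
    have g3 : s'.natReg 3 = s.natReg 3 := (hf.natReg 3 (by decide)).trans (by simp)
    have e3 : s'.natReg 3 = q := g3.trans hq
    have e0 : s'.realReg 0 = δ := (hf.realReg 0 (by decide)).trans (by simpa using hδ)
    have eA : s'.realArr 2 = A := (hf.realArr 2 (by decide)).trans hA
    have ev : s'.realArr 4 = s.realArr 4 := hf.realArr 4 (by decide)
    have eJ : s'.natArr 4 = s.natArr 4 := hf.natArr 4 (by decide)
    have hs' : Ready s' L := hs.congr g3 ((hf.natReg 4 (by decide)).trans (by simp))
      ((hf.natReg 5 (by decide)).trans (by simp)) (hf.natArr 3 (by decide)) ev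
    -- the first part of the body computes the barrier and the prefix minimum
    suffices H : HaltsWith (.ite (.not (.realLe (.reg 3) (.get 2 (.reg 8))))
            (.seq (.setReal 3 (.get 2 (.reg 8))) (.setNat 6 (.const 0)))
            (.seq (.setReal 2 (.sub (.reg 0) (.get 2 (.reg 8))))
              (.seq queryCmd
                (.ite (.natLe (.reg 6) (.get 4 (.reg 8)))
                  (.setNat 6 (.get 4 (.reg 8)))
                  .skip)))) (fun t s₁ => t ≤ 40 * (L + 1) + 35 ∧
            s₁.natReg 6 = barrier A B δ q (i + 1) ∧
            s₁.realReg 3 = prefixMin (3 * δ) A (i + 1)) s' by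
      rw [haltsWith_seq]
      refine H.frame.mono ?_
      rintro t s₁ ⟨⟨ht, k6, k3⟩, hf₁⟩
      have f8 : s₁.natReg 8 = i + 1 := (hf₁.natReg 8 (by decide)).trans h8
      have f5 : s₁.natArr 5 = s'.natArr 5 := hf₁.natArr 5 (by decide)
      rw [haltsWith_putNat]
      simp only [NatExp.eval, NatExp.cost, State.setN_natArr, State.putN_natArr, State.setN_natReg,
        State.putN_natReg, State.setN_realReg, State.putN_realReg, f8, f5, k6, k3, true_and,
        (by decide : ¬ (6 = 8)), if_false]
      refine ⟨by omega, fun x h1 h2 => ?_⟩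
      rcases h2.eq_or_lt with rfl | h2
      · rw [if_pos rfl]
      · rw [if_neg (by omega), hI x h1 (by omega)]
    rw [haltsWith_ite, haltsWith_seq, haltsWith_setReal, haltsWith_setNat, haltsWith_seq,
      haltsWith_setReal, haltsWith_seq]
    simp only [Test.holds, Test.cost, NatExp.eval, NatExp.cost, RealExp.eval, RealExp.cost,
      State.setN_natReg, State.setN_realReg, State.setR_realReg, h8, h3, e0, eA, if_true, not_le,
      not_lt, barrier, prefixMin]
    constructor
    · intro h
      exact ⟨by omega, by rw [if_pos h], by rw [min_eq_right h.le]⟩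
    · intro h
      refine (Ready.haltsWith_queryCmd (L := L) ?_ hL ?_ ?_).mono ?_
      · exact hs'.congr rfl rfl rfl rfl rfl
      · simp only [State.setR_natReg, h6, e3]
        exact barrier_le _ _ _ _ _
      · simpa [ev] using hτ (i + 1) (by omega) (by omega)
      · rintro t s₁ ⟨ht, k6, hq₁⟩
        have f8 : s₁.natReg 8 = i + 1 := (hq₁.natReg 8 (by decide)).trans (by simpa using h8)
        have f3 : s₁.realReg 3 = prefixMin (3 * δ) A i :=
          (hq₁.realReg 3 (by decide)).trans (by simpa using h3)
        have fJ : s₁.natArr 4 (i + 1) = lastAbove (prefixMin (3 * δ) B) (δ - A (i + 1)) q := by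
          rw [hq₁.natArr 4 (by decide)]
          simpa [eJ] using hJ (i + 1) (by omega) (by omega)
        have k6 : s₁.natReg 6 = lastAbove B (δ - A (i + 1)) (barrier A B δ q i) := by
          rw [k6]
          simp only [State.setR_natReg, State.setR_realReg, State.setR_realArr, if_true, h6, ev]
          exact lastAbove_congr fun k h1 h2 => hB k h1 (h2.trans (barrier_le _ _ _ _ _))
        rw [haltsWith_ite, haltsWith_setNat, haltsWith_skip]
        simp only [Test.holds, Test.cost, NatExp.eval, NatExp.cost, State.setN_natReg,
          State.setN_realReg, f8, f3, fJ, k6, if_true, not_le, if_neg (not_lt.2 h), min_eq_left h,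
          and_true]
        exact ⟨fun h' => ⟨by omega, by rw [max_eq_left h']⟩,
          fun h' => ⟨by omega, by rw [max_eq_right h'.le]⟩⟩
  · rintro t s' ⟨ht, -, -, -, hI⟩
    simp only [State.setN_natReg, State.setR_natReg, (by decide : ¬ (2 = 6)), if_false, hp]
      at ht hI
    have : p * (40 * (L + 1) + 38 + 8) ≤ p * (80 * (L + 1)) := Nat.mul_le_mul_left _ (by omega)
    exact ⟨by omega, hI⟩

theorem AncestorTable.column_zero {s : State} {W L d : ℕ} (h : AncestorTable s W L d) {l : ℕ}
    (hl : l < L) : s.natArr 3 (l * W) = 0 := by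
  have := h 0 (Nat.zero_le d) l hl
  rwa [iterate_prevGreater_zero] at this

theorem prefixMin_mem {M : ℝ} {v : ℕ → ℝ} {j : ℕ} {S : Set ℝ} (hM : ∀ x ∈ S, x < M)
    (h : ∀ k, 1 ≤ k → k ≤ j → v k ∈ S) (hj : 1 ≤ j) : prefixMin M v j ∈ S := by
  induction j, hj using Nat.le_induction with
  | base =>
    have h1 := h 1 le_rfl le_rfl
    rwa [prefixMin, prefixMin, min_eq_right (hM _ h1).le]
  | succ j hj ih =>
    rw [prefixMin]
    rcases min_choice (prefixMin M v j) (v (j + 1)) with h1 | h1 <;> rw [h1]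
    · exact ih fun k h2 h3 => h k h2 (by omega)
    · exact h _ (by omega) le_rfl

theorem haltsWith_buildCmd_ready {s : State} {L q : ℕ} {S : Finset ℝ} (hL : 1 ≤ L)
    (h3 : s.natReg 3 = q) (h4 : s.natReg 4 = q + 1) (h5 : s.natReg 5 = L * (q + 1))
    (hzero : ∀ l < L, s.natArr 3 (l * (q + 1)) = 0)
    (hS : ∀ j, 1 ≤ j → j ≤ q → s.realArr 4 j ∈ S) (hcard : S.card ≤ 2 ^ L)
    (hS0 : ∀ x ∈ S, x < s.realArr 4 0) :
    HaltsWith buildCmd (fun t s' => t ≤ 6 + q * (120 * (L + 1)) ∧ Ready s' L ∧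
      Frame buildCmd s s') s := by
  subst h3
  refine (haltsWith_buildCmd hL h4 h5 hzero hS hcard hS0).mono ?_
  rintro t s' ⟨ht, htab, f⟩
  have e3 : s'.natReg 3 = s.natReg 3 := f.natReg 3 (by decide)
  have e4 : s'.natReg 4 = s.natReg 4 := f.natReg 4 (by decide)
  have e5 : s'.natReg 5 = s.natReg 5 := f.natReg 5 (by decide)
  have eV : s'.realArr 4 = s.realArr 4 := f.realArr 4 (by decide)
  refine ⟨ht, ⟨by omega, by rw [e5, e3, h5], by rwa [e3], fun d hd => ?_⟩, f⟩
  exact iterate_prevGreater_eq_zero (by rwa [eV]) hcard (hd.trans_eq e3)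

/-- Compute, for each position, the number of leading levels that are blocked at it, into natural
array `4`. -/
noncomputable def leadingCmd : Cmd :=
  .seq heightCmd (.seq prefixMinCmd (.seq buildCmd queryAllCmd))

theorem haltsWith_leadingCmd {s : State} {L : ℕ} {δ : ℝ} {p q : ℕ} {S : Finset ℝ}
    (hL : 1 ≤ L) (hLε : ∀ l, 2 ^ l * s.realReg 1 ≤ 6 ↔ l < L) (hcard : S.card ≤ 2 ^ L)
    (hp : s.natReg 2 = p) (hq : s.natReg 3 = q) (hδ : s.realReg 0 = δ)
    (hτ : ∀ x, 1 ≤ x → x ≤ p → δ - s.realArr 2 x < 3 * δ)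
    (hBS : ∀ x, 1 ≤ x → x ≤ q → s.realArr 3 x ∈ S) (hS3 : ∀ x ∈ S, x < 3 * δ) :
    HaltsWith leadingCmd (fun t s' => t ≤ 300 * ((p + q + 1) * (L + 1)) ∧ Ready s' L ∧
      (∀ x, 1 ≤ x → x ≤ p → s'.natArr 4 x =
        lastAbove (prefixMin (3 * δ) (s.realArr 3)) (δ - s.realArr 2 x) q) ∧
      Frame leadingCmd s s') s := by
  suffices H : HaltsWith leadingCmd (fun t s' => t ≤ 300 * ((p + q + 1) * (L + 1)) ∧
      Ready s' L ∧ (∀ x, 1 ≤ x → x ≤ p → s'.natArr 4 x =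
        lastAbove (prefixMin (3 * δ) (s.realArr 3)) (δ - s.realArr 2 x) q)) s from
    H.frame.mono fun t s' h => ⟨h.1.1, h.1.2.1, h.1.2.2, h.2⟩
  rw [leadingCmd, haltsWith_seq]
  refine (haltsWith_heightCmd hLε).mono ?_
  rintro t₁ s₁ ⟨ht₁, h4, h5, hz, f₁⟩
  rw [haltsWith_seq]
  refine (haltsWith_prefixMinCmd s₁).mono ?_
  rintro t₂ s₂ ⟨ht₂, hV, f₂⟩
  have e3 : s₁.natReg 3 = q := (f₁.natReg 3 (by decide)).trans hq
  have e0 : s₁.realReg 0 = δ := (f₁.realReg 0 (by decide)).trans hδ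
  have eB : s₁.realArr 3 = s.realArr 3 := f₁.realArr 3 (by decide)
  rw [e3] at ht₂
  rw [e3, e0, eB] at hV
  rw [hq] at h4 h5 hz
  have hV0 : s₂.realArr 4 0 = 3 * δ := hV 0 (Nat.zero_le q)
  rw [haltsWith_seq]
  refine (haltsWith_buildCmd_ready (s := s₂) (S := S) hL ((f₂.natReg 3 (by decide)).trans e3)
    ((f₂.natReg 4 (by decide)).trans h4) ((f₂.natReg 5 (by decide)).trans h5)
    (fun l hl => by rw [f₂.natArr 3 (by decide)]; exact hz l hl) (fun j h1 h2 => ?_) hcard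
    (by rwa [hV0])).mono ?_
  · rw [hV j h2]
    exact prefixMin_mem (S := (S : Set ℝ)) hS3 (fun k h3 h4 => hBS k h3 (by omega)) h1
  rintro t₃ s₃ ⟨ht₃, hr₃, f₃⟩
  have m3 : s₃.natReg 3 = q := by
    rw [f₃.natReg 3 (by decide), f₂.natReg 3 (by decide), e3]
  have m0 : s₃.realReg 0 = δ := by
    rw [f₃.realReg 0 (by decide), f₂.realReg 0 (by decide), e0]
  have mV : s₃.realArr 4 = s₂.realArr 4 := f₃.realArr 4 (by decide)
  have mp : s₃.natReg 2 = p := by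
    rw [f₃.natReg 2 (by decide), f₂.natReg 2 (by decide), f₁.natReg 2 (by decide), hp]
  have mA : s₃.realArr 2 = s.realArr 2 := by
    rw [f₃.realArr 2 (by decide), f₂.realArr 2 (by decide), f₁.realArr 2 (by decide)]
  refine (haltsWith_queryAllCmd hr₃ hL (by rw [mp, m0, mA, mV, hV0]; exact hτ)).mono ?_
  rintro t₄ s₄ ⟨ht₄, hJ, f₄⟩
  rw [mp] at ht₄ hJ
  rw [m0, mA, m3, mV] at hJ
  refine ⟨?_, hr₃.congr (f₄.natReg 3 (by decide)) (f₄.natReg 4 (by decide))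
    (f₄.natReg 5 (by decide)) (f₄.natArr 3 (by decide)) (f₄.realArr 4 (by decide)),
    fun x h1 h2 => ?_⟩
  · have e1 : p * (80 * (L + 1)) = 80 * (p * (L + 1)) := by ring
    have e2 : q * (120 * (L + 1)) = 120 * (q * (L + 1)) := by ring
    have e3 : (p + q + 1) * (L + 1) = p * (L + 1) + q * (L + 1) + (L + 1) := by ring
    have e4 : q ≤ q * (L + 1) := Nat.le_mul_of_pos_right q (by omega)
    omega
  · rw [hJ x h1 h2]
    exact lastAbove_congr fun k _ h3 => hV k h3

/-- Compute the barriers, for positions in real array `2` and levels in real array `3`, into natural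
array `5`. -/
noncomputable def barrierCmd : Cmd :=
  .seq leadingCmd (.seq copyCmd (.seq buildCmd recursionCmd))

theorem haltsWith_barrierCmd {s : State} {L : ℕ} {A B : ℕ → ℝ} {δ : ℝ} {p q : ℕ} {S : Finset ℝ}
    (hL : 1 ≤ L) (hLε : ∀ l, 2 ^ l * s.realReg 1 ≤ 6 ↔ l < L) (hcard : S.card ≤ 2 ^ L)
    (hp : s.natReg 2 = p) (hq : s.natReg 3 = q) (hδ : s.realReg 0 = δ) (hδ0 : 0 < δ)
    (hA : ∀ x, 1 ≤ x → x ≤ p → s.realArr 2 x = A x)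
    (hB : ∀ j, 1 ≤ j → j ≤ q → s.realArr 3 j = B j)
    (hAS : ∀ x, 1 ≤ x → x ≤ p → A x ∈ S) (hBS : ∀ x, 1 ≤ x → x ≤ q → B x ∈ S)
    (hS0 : ∀ x ∈ S, 0 ≤ x) (hS3 : ∀ x ∈ S, x < 3 * δ) :
    HaltsWith barrierCmd (fun t s' => t ≤ 1000 * ((p + q + 1) * (L + 1)) ∧
      (∀ x, 1 ≤ x → x ≤ p → s'.natArr 5 x = barrier A B δ q x) ∧ Frame barrierCmd s s') s := by
  suffices H : HaltsWith barrierCmd (fun t s' => t ≤ 1000 * ((p + q + 1) * (L + 1)) ∧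
      (∀ x, 1 ≤ x → x ≤ p → s'.natArr 5 x = barrier A B δ q x)) s from
    H.frame.mono fun t s' h => ⟨h.1.1, h.1.2, h.2⟩
  have hτ : ∀ x, 1 ≤ x → x ≤ p → δ - s.realArr 2 x < 3 * δ := fun x h1 h2 => by
    rw [hA x h1 h2]
    linarith [hS0 _ (hAS x h1 h2)]
  have hBS' : ∀ j, 1 ≤ j → j ≤ q → s.realArr 3 j ∈ S := fun j h1 h2 => by
    rw [hB j h1 h2]; exact hBS j h1 h2
  rw [barrierCmd, haltsWith_seq]
  refine (haltsWith_leadingCmd hL hLε hcard hp hq hδ hτ hBS' hS3).mono ?_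
  rintro t₄ s₄ ⟨ht₄, hr₄, hJ, f₄⟩
  have n3 : s₄.natReg 3 = q := (f₄.natReg 3 (by decide)).trans hq
  have n0 : s₄.realReg 0 = δ := (f₄.realReg 0 (by decide)).trans hδ
  have nB : s₄.realArr 3 = s.realArr 3 := f₄.realArr 3 (by decide)
  have w4 := hr₄.width
  have w5 := hr₄.size
  have w0 := fun l (hl : l < L) => hr₄.table.column_zero hl
  rw [n3] at w4 w5 w0
  rw [haltsWith_seq]
  refine (haltsWith_copyCmd s₄).mono ?_
  rintro t₅ s₅ ⟨ht₅, hV0₅, hV₅, f₅⟩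
  rw [n3] at ht₅ hV₅
  rw [n0] at hV0₅
  rw [nB] at hV₅
  rw [haltsWith_seq]
  refine (haltsWith_buildCmd_ready (s := s₅) (S := S) hL ((f₅.natReg 3 (by decide)).trans n3)
    ((f₅.natReg 4 (by decide)).trans w4) ((f₅.natReg 5 (by decide)).trans w5)
    (fun l hl => by rw [f₅.natArr 3 (by decide)]; exact w0 l hl) (fun j h1 h2 => ?_) hcard
    (by rwa [hV0₅])).mono ?_
  · rw [hV₅ j h1 h2]
    exact hBS' j h1 h2
  rintro t₆ s₆ ⟨ht₆, hr₆, f₆⟩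
  have rV : s₆.realArr 4 = s₅.realArr 4 := f₆.realArr 4 (by decide)
  have r3 : s₆.natReg 3 = q := by rw [f₆.natReg 3 (by decide), f₅.natReg 3 (by decide), n3]
  have r0 : s₆.realReg 0 = δ := by rw [f₆.realReg 0 (by decide), f₅.realReg 0 (by decide), n0]
  have rp : s₆.natReg 2 = p := by
    rw [f₆.natReg 2 (by decide), f₅.natReg 2 (by decide), f₄.natReg 2 (by decide), hp]
  have rA : s₆.realArr 2 = s.realArr 2 := by
    rw [f₆.realArr 2 (by decide), f₅.realArr 2 (by decide), f₄.realArr 2 (by decide)]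
  have rJ : s₆.natArr 4 = s₄.natArr 4 := by
    rw [f₆.natArr 4 (by decide), f₅.natArr 4 (by decide)]
  refine (haltsWith_recursionCmd (B := s.realArr 3) hr₆ hL rp r3 r0 rA
    (by rw [rV, hV0₅]; exact hτ) (by rw [rV]; exact hV₅) (by rw [rJ]; exact hJ)).mono ?_
  rintro t₇ s₇ ⟨ht₇, hD⟩
  refine ⟨?_, fun x h1 h2 => ?_⟩
  · have e1 : p * (80 * (L + 1)) = 80 * (p * (L + 1)) := by ring
    have e2 : q * (120 * (L + 1)) = 120 * (q * (L + 1)) := by ring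
    have e3 : (p + q + 1) * (L + 1) = p * (L + 1) + q * (L + 1) + (L + 1) := by ring
    have e4 : q ≤ q * (L + 1) := Nat.le_mul_of_pos_right q (by omega)
    omega
  · rw [hD x h1 h2]
    exact barrier_congr (fun k h3 h4 => hA k h3 (by omega)) hB

end RealRAM

/-! ### Marked positions and the exit condition -/

/-- `c` is the last position in `[1..i]` with property `P`, or `0` if there is none. -/
structure IsLast (P : ℕ → Prop) (i c : ℕ) : Prop where
  le : c ≤ i
  prop : 1 ≤ c → P c
  after : ∀ x, c < x → x ≤ i → ¬ P x

theorem IsLast.zero (P : ℕ → Prop) : IsLast P 0 0 :=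
  ⟨le_rfl, fun h => by omega, fun x h1 h2 => by omega⟩

theorem IsLast.succ_of {P : ℕ → Prop} {i : ℕ} (h : P (i + 1)) : IsLast P (i + 1) (i + 1) :=
  ⟨le_rfl, fun _ => h, fun x h1 h2 => by omega⟩

theorem IsLast.succ_of_not {P : ℕ → Prop} {i c : ℕ} (hc : IsLast P i c) (h : ¬ P (i + 1)) :
    IsLast P (i + 1) c := by
  refine ⟨hc.le.trans (Nat.le_succ i), hc.prop, fun x h1 h2 => ?_⟩
  rcases h2.eq_or_lt with rfl | h2
  · exact h
  · exact hc.after x h1 (by omega)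

/-- An entry whose segment up to `i` contains a full column and no blocked column exists if and
only if the last good entry before the last full column comes after the last blocked column. -/
theorem lt_isLast_iff {Full Blocked Good : ℕ → Prop} {i c X g : ℕ} (hc : IsLast Full i c)
    (hX : IsLast Blocked i X) (hg : IsLast Good c g) :
    X < g ↔ ∃ e, 1 ≤ e ∧ e ≤ i ∧ Good e ∧ (∃ c, e ≤ c ∧ c ≤ i ∧ Full c) ∧
      ∀ x, e ≤ x → x ≤ i → ¬ Blocked x := by
  have h1 := hc.le
  have h2 := hg.le
  constructor
  · intro h
    exact ⟨g, by omega, by omega, hg.prop (by omega), ⟨c, h2, h1, hc.prop (by omega)⟩,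
      fun x h3 h4 => hX.after x (by omega) h4⟩
  · rintro ⟨e, he1, hei, he, ⟨c', hec', hci', hc'⟩, hx⟩
    have h3 : c' ≤ c := by
      by_contra h
      exact hc.after c' (by omega) hci' hc'
    have h4 : e ≤ g := by
      by_contra h
      exact hg.after e (by omega) (by omega) he
    by_contra h
    exact hx X (by omega) hX.le (hX.prop (by omega))

/-- `hi` and `lo` decide, like the maximum and the minimum of `β` on `T`, whether a column is free
in all rows of `T` and in some row of `T`, respectively. -/
def BoundsRows (β : ℕ → ℝ) (δ : ℝ) (T : Set ℕ) (hi lo : ℝ) : Prop :=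
  (∀ r, r + hi ≤ δ ↔ ∀ j ∈ T, r + β j ≤ δ) ∧ ∀ r, r + lo ≤ δ ↔ ∃ j ∈ T, r + β j ≤ δ

theorem BoundsRows.singleton (β : ℕ → ℝ) (δ : ℝ) (j : ℕ) : BoundsRows β δ {j} (β j) (β j) := by
  constructor <;> simp

theorem BoundsRows.insert {β : ℕ → ℝ} {δ : ℝ} {T : Set ℕ} {hi lo : ℝ}
    (h : BoundsRows β δ T hi lo) (j : ℕ) :
    BoundsRows β δ (insert j T) (max hi (β j)) (min lo (β j)) := by
  constructor
  · intro r
    rw [Set.forall_mem_insert, ← h.1 r, max_def]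
    split_ifs with h1
    · exact ⟨fun h => ⟨h, by linarith⟩, fun h => h.1⟩
    · exact ⟨fun h => ⟨by linarith, h⟩, fun h => h.2⟩
  · intro r
    rw [Set.exists_mem_insert, ← h.2 r, min_def]
    split_ifs with h1
    · exact ⟨.inr, fun h => h.elim (fun h => by linarith) id⟩
    · exact ⟨.inl, fun h => h.elim id fun h => by linarith⟩

/-- Vertices farther than `δ` from the separating point are moved to distance `2 * δ`. This leaves
only finitely many values and does not change the free cells. -/
noncomputable def clip (δ x : ℝ) : ℝ := if x ≤ δ then x else 2 * δ

theorem clip_add_clip_le_iff {δ x y : ℝ} (hδ : 0 < δ) (hx : 0 ≤ x) (hy : 0 ≤ y) :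
    clip δ x + clip δ y ≤ δ ↔ x + y ≤ δ := by
  unfold clip
  split_ifs with h1 h2 h2
  · rfl
  all_goals constructor <;> intro h <;> linarith

/-! ### Clipping, passes and scans -/

namespace RealRAM

/-- For `i` from `1` to the content of natural register `N`, write the clipped value of `e` to
position `i` of real array `dst`. -/
noncomputable def clipCmd (N dst : ℕ) (e : RealExp) : Cmd :=
  forUpTo N
    (.ite (.realLe e (.reg 0)) (.putReal dst (.reg 8) e)
      (.putReal dst (.reg 8) (.mul (.const 2) (.reg 0))))

/-- The memories `s` and `s'` hold the same input and the same results. -/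
structure SameData (s s' : State) : Prop where
  n : s'.natReg 0 = s.natReg 0
  m : s'.natReg 1 = s.natReg 1
  delta : s'.realReg 0 = s.realReg 0
  eps : s'.realReg 1 = s.realReg 1
  pi : s'.realArr 0 = s.realArr 0
  sigma : s'.realArr 1 = s.realArr 1
  entries : s'.natArr 0 = s.natArr 0
  exitsPi : s'.natArr 1 = s.natArr 1
  exitsSigma : s'.natArr 2 = s.natArr 2
  marks : s'.natArr 6 = s.natArr 6

theorem SameData.trans {s s' s'' : State} (h : SameData s s') (h' : SameData s' s'') :
    SameData s s'' :=
  ⟨h'.n.trans h.n, h'.m.trans h.m, h'.delta.trans h.delta, h'.eps.trans h.eps, h'.pi.trans h.pi,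
    h'.sigma.trans h.sigma, h'.entries.trans h.entries, h'.exitsPi.trans h.exitsPi,
    h'.exitsSigma.trans h.exitsSigma, h'.marks.trans h.marks⟩

theorem haltsWith_clipCmd {s : State} {N dst : ℕ} {e : RealExp} {f : ℕ → ℝ} (hN8 : N ≠ 8)
    (hdst : 2 ≤ dst) (he : e.cost ≤ 10)
    (hf : ∀ s' i, SameData s s' → s'.natReg 8 = i → e.eval s' = f i) :
    HaltsWith (clipCmd N dst e) (fun t s' => t ≤ 6 + s.natReg N * 50 ∧
      (∀ i, 1 ≤ i → i ≤ s.natReg N → s'.realArr dst i = clip (s.realReg 0) (f i)) ∧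
      SameData s s' ∧ (∀ x ≠ 8, s'.natReg x = s.natReg x) ∧
      ∀ a ≠ dst, s'.realArr a = s.realArr a) s := by
  have hsame : ∀ s', Frame (clipCmd N dst e) s s' → SameData s s' ∧
      (∀ x ≠ 8, s'.natReg x = s.natReg x) ∧ ∀ a ≠ dst, s'.realArr a = s.realArr a := by
    intro s' h
    have h1 : ∀ x ≠ 8, s'.natReg x = s.natReg x := fun x hx =>
      h.natReg x (by simpa [clipCmd, forUpTo, Cmd.natRegs] using hx)
    have h2 : ∀ a ≠ dst, s'.realArr a = s.realArr a := fun x hx =>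
      h.realArr x (by simpa [clipCmd, forUpTo, Cmd.realArrs] using hx)
    have h3 : ∀ a, s'.natArr a = s.natArr a := fun x =>
      h.natArr x (by simp [clipCmd, forUpTo, Cmd.natArrs])
    have h4 : ∀ a, s'.realReg a = s.realReg a := fun x =>
      h.realReg x (by simp [clipCmd, forUpTo, Cmd.realRegs])
    exact ⟨⟨h1 _ (by decide), h1 _ (by decide), h4 _, h4 _, h2 _ (by omega), h2 _ (by omega), h3 _,
      h3 _, h3 _, h3 _⟩, h1, h2⟩
  refine (haltsWith_forUpTo (by simp [Cmd.natRegs]) (by simp [Cmd.natRegs]) hN8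
    (fun i s' => ∀ k, 1 ≤ k → k ≤ i → s'.realArr dst k = clip (s.realReg 0) (f k)) 40
    (fun k h1 h2 => by omega) ?_).mono ?_
  · intro i s' hi hfr h8 hI
    have hs' := (hsame s' hfr).1
    have he' := hf s' _ hs' h8
    rw [haltsWith_ite, haltsWith_putReal, haltsWith_putReal]
    simp only [Test.holds, Test.cost, NatExp.eval, NatExp.cost, RealExp.eval, RealExp.cost,
      State.setN_realArr, State.putR_realArr, h8, he', hs'.delta, true_and]
    constructor <;> intro h <;> refine ⟨by omega, fun k h1 h2 => ?_⟩
    all_goals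
      rcases h2.eq_or_lt with rfl | h2
      · simp [clip, h]
      · rw [if_neg (by omega), hI k h1 (by omega)]
  · rintro t s' ⟨ht, hfr, hI⟩
    exact ⟨by omega, hI, hsame s' hfr⟩

/-- Compute the barriers of the clipped sequences given by two expressions in the counter, of the
lengths in the natural registers `P` and `Q`. -/
noncomputable def passCmd (P Q : ℕ) (eA eB : RealExp) : Cmd :=
  .seq (.setNat 2 (.reg P)) (.seq (.setNat 3 (.reg Q))
    (.seq (clipCmd 2 2 eA) (.seq (clipCmd 3 3 eB) barrierCmd)))

theorem haltsWith_passCmd {s : State} {P Q L : ℕ} {eA eB : RealExp} {A B : ℕ → ℝ} {δ : ℝ}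
    {p q : ℕ} {S : Finset ℝ} (hQ2 : Q ≠ 2)
    (hp : s.natReg P = p) (hq : s.natReg Q = q) (hδ : s.realReg 0 = δ) (hδ0 : 0 < δ)
    (hL : 1 ≤ L) (hLε : ∀ l, 2 ^ l * s.realReg 1 ≤ 6 ↔ l < L) (hcard : S.card ≤ 2 ^ L)
    (hcA : eA.cost ≤ 10) (hcB : eB.cost ≤ 10)
    (hA : ∀ s' i, SameData s s' → s'.natReg 8 = i → eA.eval s' = A i)
    (hB : ∀ s' i, SameData s s' → s'.natReg 8 = i → eB.eval s' = B i)
    (hAS : ∀ x, 1 ≤ x → x ≤ p → clip δ (A x) ∈ S) (hBS : ∀ x, 1 ≤ x → x ≤ q → clip δ (B x) ∈ S)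
    (hS0 : ∀ x ∈ S, 0 ≤ x) (hS3 : ∀ x ∈ S, x < 3 * δ) :
    HaltsWith (passCmd P Q eA eB) (fun t s' => t ≤ 1100 * ((p + q + 1) * (L + 1)) ∧
      (∀ x, 1 ≤ x → x ≤ p → s'.natArr 5 x =
        barrier (fun i => clip δ (A i)) (fun i => clip δ (B i)) δ q x) ∧ SameData s s') s := by
  have k0 : SameData s ((s.setN 2 p).setN 3 q) :=
    ⟨by simp, by simp, rfl, rfl, rfl, rfl, rfl, rfl, rfl, rfl⟩
  rw [passCmd, haltsWith_seq, haltsWith_setNat, haltsWith_seq, haltsWith_setNat, haltsWith_seq]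
  simp only [NatExp.eval, NatExp.cost, State.setN_natReg, hp, hQ2, if_false, hq]
  refine (haltsWith_clipCmd (f := A) (by decide) le_rfl hcA
    fun s' i h1 h2 => hA s' i (k0.trans h1) h2).mono ?_
  rintro t₁ s₁ ⟨ht₁, hA₁, k1, r1, a1⟩
  have p1 : s₁.natReg 2 = p := (r1 2 (by decide)).trans (by simp)
  have q1 : s₁.natReg 3 = q := (r1 3 (by decide)).trans (by simp)
  simp only [State.setN_natReg, State.setN_realReg, if_true, (by decide : ¬ (2 = 3)), if_false, hδ]
    at ht₁ hA₁
  have k01 := k0.trans k1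
  rw [haltsWith_seq]
  refine (haltsWith_clipCmd (f := B) (by decide) (by decide) hcB
    fun s' i h1 h2 => hB s' i (k01.trans h1) h2).mono ?_
  rintro t₂ s₂ ⟨ht₂, hB₂, k2, r2, a2⟩
  rw [q1] at ht₂ hB₂
  rw [k01.delta, hδ] at hB₂
  have k02 := k01.trans k2
  refine (haltsWith_barrierCmd (A := fun i => clip δ (A i)) (B := fun i => clip δ (B i)) (S := S)
    (p := p) (q := q) hL (by rwa [k02.eps]) hcard ((r2 2 (by decide)).trans p1)
    ((r2 3 (by decide)).trans q1) (k02.delta.trans hδ) hδ0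
    (fun x h1 h2 => by rw [a2 2 (by decide)]; exact hA₁ x h1 h2) hB₂ hAS hBS hS0 hS3).mono ?_
  rintro t₃ s₃ ⟨ht₃, hD, f₃⟩
  refine ⟨?_, hD, k02.trans ⟨f₃.natReg _ (by decide), f₃.natReg _ (by decide),
    f₃.realReg _ (by decide), f₃.realReg _ (by decide), f₃.realArr _ (by decide),
    f₃.realArr _ (by decide), f₃.natArr _ (by decide), f₃.natArr _ (by decide),
    f₃.natArr _ (by decide), f₃.natArr _ (by decide)⟩⟩
  have e3 : (p + q + 1) * (L + 1) = p * (L + 1) + q * (L + 1) + (L + 1) := by ring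
  have e4 : q ≤ q * (L + 1) := Nat.le_mul_of_pos_right q (by omega)
  have e5 : p ≤ p * (L + 1) := Nat.le_mul_of_pos_right p (by omega)
  omega

/-- Natural array `6` receives, at position `i`, the last entry in `[1..i]` that has barrier `0`.
The barriers are in natural array `5`, in backward order. -/
def markCmd : Cmd :=
  forUpTo 0
    (.ite (.and (.natLe (.const 1) (.get 0 (.reg 8)))
        (.natLe (.get 5 (.sub (.add (.reg 0) (.const 1)) (.reg 8))) (.const 0)))
      (.putNat 6 (.reg 8) (.reg 8))
      (.putNat 6 (.reg 8) (.get 6 (.sub (.reg 8) (.const 1)))))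

theorem haltsWith_markCmd {s : State} {n : ℕ} (hn : s.natReg 0 = n) (h0 : s.natArr 6 0 = 0)
    {Good : ℕ → Prop} (hG : ∀ e, 1 ≤ e → e ≤ n →
      (Good e ↔ 1 ≤ s.natArr 0 e ∧ s.natArr 5 (n + 1 - e) = 0)) :
    HaltsWith markCmd (fun t s' => t ≤ 6 + n * 50 ∧ (∀ i ≤ n, IsLast Good i (s'.natArr 6 i)) ∧
      Frame markCmd s s') s := by
  subst hn
  refine (haltsWith_forUpTo (by decide) (by decide) (by decide)
    (fun i s' => ∀ k ≤ i, IsLast Good k (s'.natArr 6 k)) 42 ?_ ?_).mono ?_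
  · intro k hk
    obtain rfl : k = 0 := by omega
    simpa [h0] using IsLast.zero Good
  · intro i s' hi hf h8 hI
    have e0 : s'.natReg 0 = s.natReg 0 := hf.natReg 0 (by decide)
    have eE : s'.natArr 0 = s.natArr 0 := hf.natArr 0 (by decide)
    have eD : s'.natArr 5 = s.natArr 5 := hf.natArr 5 (by decide)
    have hGi := hG (i + 1) (by omega) hi
    rw [haltsWith_ite, haltsWith_putNat, haltsWith_putNat]
    simp only [Test.holds, Test.cost, NatExp.eval, NatExp.cost, State.setN_natArr,
      State.putN_natArr, h8, e0, eE, eD, Nat.le_zero, ← hGi, Nat.add_sub_cancel, true_and]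
    constructor <;> intro h <;> refine ⟨by omega, fun k hk => ?_⟩
    all_goals
      rcases hk.eq_or_lt with rfl | hk
      · rw [if_pos rfl]
        first
        | exact .succ_of h
        | exact (hI i le_rfl).succ_of_not h
      · rw [if_neg (by omega)]
        exact hI k (by omega)
  · rintro t s' ⟨ht, hf, hI⟩
    exact ⟨by omega, hI, hf⟩

/-- Update the maximum and the minimum of `-σ`, in real registers `4` and `5`, by the vertex whose
index is in natural register `x`. -/
noncomputable def updateBoundsCmd (x : ℕ) : Cmd :=
  .seq
    (.ite (.realLe (.reg 4) (.sub (.const 0) (.get 1 (.reg x))))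
      (.setReal 4 (.sub (.const 0) (.get 1 (.reg x)))) .skip)
    (.ite (.realLe (.sub (.const 0) (.get 1 (.reg x))) (.reg 5))
      (.setReal 5 (.sub (.const 0) (.get 1 (.reg x)))) .skip)

theorem haltsWith_updateBoundsCmd {s : State} {x : ℕ} {δ : ℝ} {β : ℕ → ℝ}
    (hβ : ∀ j, β j = 0 - s.realArr 1 j) {T : Set ℕ}
    (hT : BoundsRows β δ T (s.realReg 4) (s.realReg 5)) :
    HaltsWith (updateBoundsCmd x) (fun t s' => t ≤ 30 ∧
      BoundsRows β δ (insert (s.natReg x) T) (s'.realReg 4) (s'.realReg 5) ∧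
      Frame (updateBoundsCmd x) s s') s := by
  suffices H : HaltsWith (updateBoundsCmd x) (fun t s' => t ≤ 30 ∧
      s'.realReg 4 = max (s.realReg 4) (β (s.natReg x)) ∧
      s'.realReg 5 = min (s.realReg 5) (β (s.natReg x))) s by
    refine H.frame.mono ?_
    rintro t s' ⟨⟨h1, h2, h3⟩, h4⟩
    refine ⟨h1, ?_, h4⟩
    rw [h2, h3]
    exact hT.insert _
  rw [updateBoundsCmd, haltsWith_seq, haltsWith_ite, haltsWith_setReal, haltsWith_skip]
  simp only [haltsWith_ite, haltsWith_setReal, haltsWith_skip, Test.holds, Test.cost, NatExp.eval,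
    NatExp.cost, RealExp.eval, RealExp.cost, State.setR_natReg, State.setR_realReg,
    State.setR_realArr, Rat.cast_zero, ← hβ, if_true, (by decide : ¬ (4 = 5)),
    (by decide : ¬ (5 = 4)), if_false, not_le]
  refine ⟨fun h1 => ⟨fun h2 => ⟨by omega, ?_, ?_⟩, fun h2 => ⟨by omega, ?_, ?_⟩⟩,
    fun h1 => ⟨fun h2 => ⟨by omega, ?_, ?_⟩, fun h2 => ⟨by omega, ?_, ?_⟩⟩⟩
  all_goals
    first
    | rw [max_eq_right h1]
    | rw [max_eq_left h1.le]
    | rw [min_eq_right h2]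
    | rw [min_eq_left h2.le]

/-- Compute the maximum and the minimum of `-σ_1, …, -σ_m`. -/
noncomputable def boundsCmd : Cmd :=
  .seq (.setReal 4 (.sub (.const 0) (.get 1 (.const 1))))
    (.seq (.setReal 5 (.sub (.const 0) (.get 1 (.const 1))))
      (forUpTo 1 (updateBoundsCmd 8)))

theorem haltsWith_boundsCmd {s : State} {m : ℕ} {δ : ℝ} {β : ℕ → ℝ} (hm : s.natReg 1 = m)
    (hm1 : 1 ≤ m) (hβ : ∀ j, β j = 0 - s.realArr 1 j) :
    HaltsWith boundsCmd (fun t s' => t ≤ 20 + m * 50 ∧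
      BoundsRows β δ (Set.Icc 1 m) (s'.realReg 4) (s'.realReg 5) ∧ Frame boundsCmd s s') s := by
  suffices H : HaltsWith boundsCmd (fun t s' => t ≤ 20 + m * 50 ∧
      BoundsRows β δ (Set.Icc 1 m) (s'.realReg 4) (s'.realReg 5)) s from
    H.frame.mono fun t s' h => ⟨h.1.1, h.1.2, h.2⟩
  rw [boundsCmd, haltsWith_seq, haltsWith_setReal, haltsWith_seq, haltsWith_setReal]
  simp only [NatExp.eval, NatExp.cost, RealExp.eval, RealExp.cost]
  refine (haltsWith_forUpTo (by decide) (by decide) (by decide)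
    (fun i s' => BoundsRows β δ (insert 1 (Set.Icc 1 i)) (s'.realReg 4) (s'.realReg 5)) 30
    ?_ ?_).mono ?_
  · have := BoundsRows.singleton β δ 1
    simpa [hβ] using this
  · intro i s' hi hf h8 hI
    have e1 : s'.realArr 1 = s.realArr 1 := hf.realArr 1 (by decide)
    refine (haltsWith_updateBoundsCmd (by rw [e1]; exact hβ) hI).mono ?_
    rintro t s₁ ⟨ht, hT, -⟩
    refine ⟨ht, ?_⟩
    rw [h8] at hT
    simp only [State.setN_realReg]
    convert hT using 1
    ext j
    simp only [Set.mem_insert_iff, Set.mem_Icc]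
    omega
  · rintro t s' ⟨ht, -, hI⟩
    simp only [State.setR_natReg, hm] at ht hI
    refine ⟨by omega, ?_⟩
    convert hI using 1
    ext j
    simp only [Set.mem_insert_iff, Set.mem_Icc]
    omega

/-- Find the exits on `π`. Natural registers `9` and `10` hold the last full column and the last
blocked column. -/
def scanPiCmd : Cmd :=
  .seq (.setNat 9 (.const 0)) (.seq (.setNat 10 (.const 0)) (forUpTo 0
    (.seq
      (.ite (.realLe (.add (.get 0 (.reg 8)) (.reg 4)) (.reg 0)) (.setNat 9 (.reg 8)) .skip)
      (.seq
        (.ite (.realLe (.add (.get 0 (.reg 8)) (.reg 5)) (.reg 0)) .skip (.setNat 10 (.reg 8)))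
        (.ite (.and (.natLe (.get 5 (.reg 8)) (.const 0))
            (.not (.natLe (.get 6 (.reg 9)) (.reg 10))))
          (.putNat 1 (.reg 8) (.const 1)) .skip)))))

theorem haltsWith_scanPiCmd {s : State} {n : ℕ} {Good Full Blocked : ℕ → Prop}
    (hn : s.natReg 0 = n) (h1 : ∀ f, s.natArr 1 f = 0)
    (hG : ∀ i ≤ n, IsLast Good i (s.natArr 6 i))
    (hFull : ∀ x, Full x ↔ s.realArr 0 x + s.realReg 4 ≤ s.realReg 0)
    (hBlocked : ∀ x, Blocked x ↔ ¬ s.realArr 0 x + s.realReg 5 ≤ s.realReg 0) :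
    HaltsWith scanPiCmd (fun t s' => t ≤ 20 + n * 70 ∧
      (∀ f, s'.natArr 1 f ≠ 0 ↔ 1 ≤ f ∧ f ≤ n ∧ s.natArr 5 f = 0 ∧
        ∃ e, 1 ≤ e ∧ e ≤ f ∧ Good e ∧ (∃ c, e ≤ c ∧ c ≤ f ∧ Full c) ∧
          ∀ x, e ≤ x → x ≤ f → ¬ Blocked x) ∧ Frame scanPiCmd s s') s := by
  suffices H : HaltsWith scanPiCmd (fun t s' => t ≤ 20 + n * 70 ∧
      (∀ f, s'.natArr 1 f ≠ 0 ↔ 1 ≤ f ∧ f ≤ n ∧ s.natArr 5 f = 0 ∧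
        ∃ e, 1 ≤ e ∧ e ≤ f ∧ Good e ∧ (∃ c, e ≤ c ∧ c ≤ f ∧ Full c) ∧
          ∀ x, e ≤ x → x ≤ f → ¬ Blocked x)) s from
    H.frame.mono fun t s' h => ⟨h.1.1, h.1.2, h.2⟩
  rw [scanPiCmd, haltsWith_seq, haltsWith_setNat, haltsWith_seq, haltsWith_setNat]
  simp only [NatExp.eval, NatExp.cost]
  refine (haltsWith_forUpTo (by decide) (by decide) (by decide)
    (fun i s' => IsLast Full i (s'.natReg 9) ∧ IsLast Blocked i (s'.natReg 10) ∧
      ∀ f, s'.natArr 1 f ≠ 0 ↔ 1 ≤ f ∧ f ≤ i ∧ s.natArr 5 f = 0 ∧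
        ∃ e, 1 ≤ e ∧ e ≤ f ∧ Good e ∧ (∃ c, e ≤ c ∧ c ≤ f ∧ Full c) ∧
          ∀ x, e ≤ x → x ≤ f → ¬ Blocked x) 60 ?_ ?_).mono ?_
  · refine ⟨by simpa using IsLast.zero Full, by simpa using IsLast.zero Blocked, fun f => ?_⟩
    simp only [State.setN_natArr, h1, ne_eq, not_true, false_iff]
    omega
  · rintro i s' hi hf h8 ⟨h9, h10, hI⟩
    simp only [State.setN_natReg, (by decide : ¬ (0 = 10)), (by decide : ¬ (0 = 9)), if_false, hn]
      at hi
    have e0 : s'.realArr 0 = s.realArr 0 := hf.realArr 0 (by decide)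
    have eδ : s'.realReg 0 = s.realReg 0 := (hf.realReg 0 (by decide)).trans (by simp)
    have e4 : s'.realReg 4 = s.realReg 4 := (hf.realReg 4 (by decide)).trans (by simp)
    have e5 : s'.realReg 5 = s.realReg 5 := (hf.realReg 5 (by decide)).trans (by simp)
    have eD : s'.natArr 5 = s.natArr 5 := hf.natArr 5 (by decide)
    have eG : s'.natArr 6 = s.natArr 6 := hf.natArr 6 (by decide)
    rw [haltsWith_seq]
    suffices H1 : HaltsWith (.ite (.realLe (.add (.get 0 (.reg 8)) (.reg 4)) (.reg 0))
        (.setNat 9 (.reg 8)) .skip) (fun t s₁ => t ≤ 12 ∧ IsLast Full (i + 1) (s₁.natReg 9)) s' by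
      refine H1.frame.mono ?_
      rintro t₁ s₁ ⟨⟨ht₁, k9⟩, f₁⟩
      have j8 : s₁.natReg 8 = i + 1 := (f₁.natReg 8 (by decide)).trans h8
      have j10 : s₁.natReg 10 = s'.natReg 10 := f₁.natReg 10 (by decide)
      have j0 : s₁.realArr 0 = s.realArr 0 := (f₁.realArr 0 (by decide)).trans e0
      have jδ : s₁.realReg 0 = s.realReg 0 := (f₁.realReg 0 (by decide)).trans eδ
      have j5 : s₁.realReg 5 = s.realReg 5 := (f₁.realReg 5 (by decide)).trans e5
      rw [haltsWith_seq]
      suffices H2 : HaltsWith (.ite (.realLe (.add (.get 0 (.reg 8)) (.reg 5)) (.reg 0)) .skip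
          (.setNat 10 (.reg 8))) (fun t s₂ => t ≤ 12 ∧ IsLast Blocked (i + 1) (s₂.natReg 10)) s₁ by
        refine H2.frame.mono ?_
        rintro t₂ s₂ ⟨⟨ht₂, k10⟩, f₂⟩
        have l8 : s₂.natReg 8 = i + 1 := (f₂.natReg 8 (by decide)).trans j8
        have l9 : s₂.natReg 9 = s₁.natReg 9 := f₂.natReg 9 (by decide)
        have lD : s₂.natArr 5 = s.natArr 5 := by
          rw [f₂.natArr 5 (by decide), f₁.natArr 5 (by decide), eD]
        have lG : s₂.natArr 6 = s.natArr 6 := by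
          rw [f₂.natArr 6 (by decide), f₁.natArr 6 (by decide), eG]
        have l1 : s₂.natArr 1 = s'.natArr 1 := by
          rw [f₂.natArr 1 (by decide), f₁.natArr 1 (by decide)]
        have key := lt_isLast_iff k9 k10 (hG _ (k9.le.trans (by omega)))
        rw [haltsWith_ite, haltsWith_putNat, haltsWith_skip]
        simp only [Test.holds, Test.cost, NatExp.eval, NatExp.cost, State.setN_natArr,
          State.putN_natArr, State.setN_natReg, State.putN_natReg, l8, l9, lD, lG, l1, Nat.le_zero,
          not_le, (by decide : ¬ (9 = 8)), (by decide : ¬ (10 = 8)), if_false, k9, k10, key,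
          true_and]
        refine ⟨fun h => ⟨by omega, fun f => ?_⟩, fun h => ⟨by omega, fun f => ?_⟩⟩
        · by_cases hfi : f = i + 1
          · subst hfi
            rw [if_pos rfl]
            exact ⟨fun _ => ⟨by omega, le_rfl, h⟩, fun _ => by decide⟩
          · rw [if_neg hfi, hI]
            constructor <;> rintro ⟨h2, h3, h4⟩ <;> exact ⟨h2, by omega, h4⟩
        · rw [hI]
          constructor
          · rintro ⟨h2, h3, h4⟩
            exact ⟨h2, by omega, h4⟩
          · rintro ⟨h2, h3, h4⟩
            refine ⟨h2, ?_, h4⟩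
            by_contra h5
            obtain rfl : f = i + 1 := by omega
            exact h h4
      rw [haltsWith_ite, haltsWith_setNat, haltsWith_skip]
      simp only [Test.holds, Test.cost, NatExp.eval, NatExp.cost, RealExp.eval, RealExp.cost,
        State.setN_natReg, j8, j0, j5, jδ, j10, ← hBlocked, if_true]
      exact ⟨fun h => ⟨by omega, h10.succ_of_not fun h' => (hBlocked _).1 h' h⟩,
        fun h => ⟨by omega, .succ_of h⟩⟩
    rw [haltsWith_ite, haltsWith_setNat, haltsWith_skip]
    simp only [Test.holds, Test.cost, NatExp.eval, NatExp.cost, RealExp.eval, RealExp.cost,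
      State.setN_natReg, h8, e0, e4, eδ, ← hFull, if_true]
    exact ⟨fun h => ⟨by omega, .succ_of h⟩, fun h => ⟨by omega, h9.succ_of_not h⟩⟩
  · rintro t s' ⟨ht, -, -, -, hI⟩
    simp only [State.setN_natReg, (by decide : ¬ (0 = 10)), (by decide : ¬ (0 = 9)), if_false, hn]
      at ht hI
    exact ⟨by omega, hI⟩

/-- Find the exits on `σ`. As the level `f` in natural register `11` grows, the last column that is
free up to level `f` and the last column that is blocked up to level `f`, in natural registers `9`
and `10`, move to the left. Each iteration moves one of the three. -/
noncomputable def scanSigmaCmd : Cmd :=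
  .seq (.setNat 9 (.reg 0)) (.seq (.setNat 10 (.reg 0)) (.seq (.setNat 11 (.const 1))
    (.seq (.setReal 4 (.sub (.const 0) (.get 1 (.const 1))))
      (.seq (.setReal 5 (.sub (.const 0) (.get 1 (.const 1))))
        (.loop (.natLe (.reg 11) (.reg 1))
          (.ite (.and (.natLe (.const 1) (.reg 9))
              (.not (.realLe (.add (.get 0 (.reg 9)) (.reg 4)) (.reg 0))))
            (.setNat 9 (.sub (.reg 9) (.const 1)))
            (.ite (.and (.natLe (.const 1) (.reg 10))
                (.realLe (.add (.get 0 (.reg 10)) (.reg 5)) (.reg 0)))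
              (.setNat 10 (.sub (.reg 10) (.const 1)))
              (.seq
                (.ite (.and (.natLe (.get 5 (.reg 11)) (.const 0))
                    (.not (.natLe (.get 6 (.reg 9)) (.reg 10))))
                  (.putNat 2 (.reg 11) (.const 1)) .skip)
                (.seq (.setNat 11 (.add (.reg 11) (.const 1))) (updateBoundsCmd 11))))))))))

theorem haltsWith_scanSigmaCmd {s : State} {n m : ℕ} {Good : ℕ → Prop} {α β : ℕ → ℝ} {δ : ℝ}
    (hn : s.natReg 0 = n) (hm : s.natReg 1 = m) (hδ : s.realReg 0 = δ) (h2 : ∀ f, s.natArr 2 f = 0)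
    (hG : ∀ i ≤ n, IsLast Good i (s.natArr 6 i)) (hα : s.realArr 0 = α)
    (hβ : ∀ j, β j = 0 - s.realArr 1 j) :
    HaltsWith scanSigmaCmd (fun t s' => t ≤ 100 * (n + n + m + 1) ∧
      (∀ f, s'.natArr 2 f ≠ 0 ↔ 1 ≤ f ∧ f ≤ m ∧ s.natArr 5 f = 0 ∧
        ∃ e, 1 ≤ e ∧ e ≤ n ∧ Good e ∧
          (∃ c, e ≤ c ∧ c ≤ n ∧ ∀ j ∈ Set.Icc 1 f, α c + β j ≤ δ) ∧
          ∀ x, e ≤ x → x ≤ n → ∃ j ∈ Set.Icc 1 f, α x + β j ≤ δ) ∧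
      Frame scanSigmaCmd s s') s := by
  set Exit : ℕ → Prop := fun f => s.natArr 5 f = 0 ∧
        ∃ e, 1 ≤ e ∧ e ≤ n ∧ Good e ∧
          (∃ c, e ≤ c ∧ c ≤ n ∧ ∀ j ∈ Set.Icc 1 f, α c + β j ≤ δ) ∧
          ∀ x, e ≤ x → x ≤ n → ∃ j ∈ Set.Icc 1 f, α x + β j ≤ δ with hExit
  suffices H : HaltsWith scanSigmaCmd (fun t s' => t ≤ 100 * (n + n + m + 1) ∧
      (∀ f, s'.natArr 2 f ≠ 0 ↔ 1 ≤ f ∧ f ≤ m ∧ Exit f)) s from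
    H.frame.mono fun t s' h => ⟨h.1.1, h.1.2, h.2⟩
  rw [scanSigmaCmd, haltsWith_seq, haltsWith_setNat, haltsWith_seq, haltsWith_setNat,
    haltsWith_seq, haltsWith_setNat, haltsWith_seq, haltsWith_setReal, haltsWith_seq,
    haltsWith_setReal]
  simp only [NatExp.eval, NatExp.cost, RealExp.cost]
  refine (haltsWith_loop (fun k s' => ∃ f c X, s'.natReg 11 = f ∧ s'.natReg 9 = c ∧
    s'.natReg 10 = X ∧ 1 ≤ f ∧ f ≤ m + 1 ∧ c ≤ n ∧ X ≤ n ∧ k = (m + 1 - f) + c + X ∧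
    BoundsRows β δ (Set.Icc 1 f) (s'.realReg 4) (s'.realReg 5) ∧
    (∀ x, c < x → x ≤ n → ¬ ∀ j ∈ Set.Icc 1 f, α x + β j ≤ δ) ∧
    (∀ x, X < x → x ≤ n → ∃ j ∈ Set.Icc 1 f, α x + β j ≤ δ) ∧
    ∀ g, s'.natArr 2 g ≠ 0 ↔ 1 ≤ g ∧ g < f ∧ Exit g) 80 ?_ (k₀ := m + n + n) ?_).mono ?_
  · rintro k s' hf ⟨f, c, X, h11, h9, h10, hf1, hfm, hcn, hXn, rfl, hT, hc, hX, hI⟩ hb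
    have e0 : s'.realArr 0 = α := (hf.realArr 0 (by decide)).trans hα
    have e1 : s'.realArr 1 = s.realArr 1 := hf.realArr 1 (by decide)
    have eδ : s'.realReg 0 = δ := (hf.realReg 0 (by decide)).trans (by simpa using hδ)
    have em : s'.natReg 1 = m := (hf.natReg 1 (by decide)).trans (by simpa using hm)
    have eD : s'.natArr 5 = s.natArr 5 := hf.natArr 5 (by decide)
    have eG : s'.natArr 6 = s.natArr 6 := hf.natArr 6 (by decide)
    simp only [Test.holds, NatExp.eval, h11, em] at hb
    rw [haltsWith_ite, haltsWith_setNat, haltsWith_ite, haltsWith_setNat]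
    simp only [Test.holds, Test.cost, NatExp.eval, NatExp.cost, RealExp.eval, RealExp.cost,
      State.setN_natReg, State.setN_realReg, State.setN_natArr, h9, h10, h11, e0, eδ, hT.1, hT.2]
    refine ⟨fun h => ⟨by omega, (m + 1 - f) + (c - 1) + X, by omega, f, c - 1, X, by simp,
      by simp, by simp, hf1, hfm, by omega, hXn, rfl, hT, fun x hx hxn => ?_, hX, hI⟩,
      fun h => ⟨fun h' => ⟨by omega, (m + 1 - f) + c + (X - 1), by omega, f, c, X - 1,
        by simp, by simp, by simp, hf1, hfm, hcn, by omega, rfl, hT, hc,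
        fun x hx hxn => ?_, hI⟩, fun h' => ?_⟩⟩
    · rcases Nat.lt_or_ge c x with h3 | h3
      · exact hc x h3 hxn
      · rw [show x = c by omega]
        exact h.2
    · rcases Nat.lt_or_ge X x with h3 | h3
      · exact hX x h3 hxn
      · rw [show x = X by omega]
        exact h'.2
    -- both columns are in place: decide about level `f`
    have hlastc : IsLast (fun x => ∀ j ∈ Set.Icc 1 f, α x + β j ≤ δ) n c :=
      ⟨hcn, fun h3 => by by_contra h4; exact h ⟨h3, h4⟩, hc⟩
    have hlastX : IsLast (fun x => ¬ ∃ j ∈ Set.Icc 1 f, α x + β j ≤ δ) n X :=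
      ⟨hXn, fun h3 h4 => h' ⟨h3, h4⟩, fun x h3 h4 h5 => h5 (hX x h3 h4)⟩
    have key := lt_isLast_iff hlastc hlastX (hG c hcn)
    simp only [not_not] at key
    suffices H : HaltsWith (.ite (.and (.natLe (.get 5 (.reg 11)) (.const 0))
          (.not (.natLe (.get 6 (.reg 9)) (.reg 10))))
        (.putNat 2 (.reg 11) (.const 1)) .skip) (fun t s₁ => t ≤ 20 ∧
        (∀ g, s₁.natArr 2 g ≠ 0 ↔ 1 ≤ g ∧ g < f + 1 ∧ Exit g)) s' by
      rw [haltsWith_seq]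
      refine H.frame.mono ?_
      rintro t s₁ ⟨⟨ht, hI₁⟩, f₁⟩
      have j11 : s₁.natReg 11 = f := (f₁.natReg 11 (by decide)).trans h11
      have j9 : s₁.natReg 9 = c := (f₁.natReg 9 (by decide)).trans h9
      have j10 : s₁.natReg 10 = X := (f₁.natReg 10 (by decide)).trans h10
      have j4 : s₁.realReg 4 = s'.realReg 4 := f₁.realReg 4 (by decide)
      have j5 : s₁.realReg 5 = s'.realReg 5 := f₁.realReg 5 (by decide)
      have j1 : s₁.realArr 1 = s.realArr 1 := (f₁.realArr 1 (by decide)).trans e1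
      rw [haltsWith_seq, haltsWith_setNat]
      simp only [NatExp.eval, NatExp.cost, j11]
      refine (haltsWith_updateBoundsCmd (δ := δ) (β := β) (T := Set.Icc 1 f)
        (by simpa [j1] using hβ) (by simpa [j4, j5] using hT)).mono ?_
      rintro t₂ s₂ ⟨ht₂, hT₂, f₂⟩
      have hins : insert (f + 1) (Set.Icc 1 f) = Set.Icc 1 (f + 1) := by
        ext j
        simp only [Set.mem_insert_iff, Set.mem_Icc]
        omega
      simp only [State.setN_natReg, if_true, hins] at hT₂
      refine ⟨by omega, (m + 1 - (f + 1)) + c + X, by omega, f + 1, c, X,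
        (f₂.natReg 11 (by decide)).trans (by simp), (f₂.natReg 9 (by decide)).trans (by simp [j9]),
        (f₂.natReg 10 (by decide)).trans (by simp [j10]), by omega, by omega, hcn, hXn, rfl, hT₂,
        fun x h3 h4 h5 => hc x h3 h4 fun j hj => h5 j ⟨hj.1, hj.2.trans (Nat.le_succ f)⟩,
        fun x h3 h4 => ?_, ?_⟩
      · obtain ⟨j, hj, h5⟩ := hX x h3 h4
        exact ⟨j, ⟨hj.1, hj.2.trans (Nat.le_succ f)⟩, h5⟩
      · rw [f₂.natArr 2 (by simp [updateBoundsCmd, Cmd.natArrs])]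
        exact hI₁
    rw [haltsWith_ite, haltsWith_putNat, haltsWith_skip]
    simp only [Test.holds, Test.cost, NatExp.eval, NatExp.cost, State.putN_natArr, h9, h10, h11,
      eD, eG, Nat.le_zero, not_le, true_and, key]
    refine ⟨fun h => ⟨by omega, fun g => ?_⟩, fun h => ⟨by omega, fun g => ?_⟩⟩
    · by_cases hgf : g = f
      · subst hgf
        rw [if_pos rfl]
        exact ⟨fun _ => ⟨hf1, by omega, h⟩, fun _ => by decide⟩
      · rw [if_neg hgf, hI]
        constructor <;> rintro ⟨h2, h3, h4⟩ <;> exact ⟨h2, by omega, h4⟩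
    · rw [hI]
      constructor
      · rintro ⟨h2, h3, h4⟩
        exact ⟨h2, by omega, h4⟩
      · rintro ⟨h2, h3, h4⟩
        refine ⟨h2, ?_, h4⟩
        by_contra h5
        obtain rfl : g = f := by omega
        exact h h4
  · refine ⟨1, n, n, by simp, by simp [hn], by simp [hn], le_rfl, by omega, le_rfl, le_rfl,
      by omega, ?_, fun x h3 h4 => by omega, fun x h3 h4 => by omega, fun g => ?_⟩
    · have := BoundsRows.singleton β δ 1
      simpa [hβ, RealExp.eval, NatExp.eval] using this
    · simp only [State.setR_natArr, State.setN_natArr, h2, ne_eq, not_true, false_iff]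
      omega
  · rintro t s' ⟨ht, hb, hf, k, -, f, c, X, h11, h9, h10, hf1, hfm, hcn, hXn, hk, hT, hc, hX, hI⟩
    have em : s'.natReg 1 = m := (hf.natReg 1 (by decide)).trans (by simpa using hm)
    simp only [Test.holds, NatExp.eval, h11, em] at hb
    obtain rfl : f = m + 1 := by omega
    simp only [Test.cost, NatExp.cost] at ht
    refine ⟨by omega, fun g => ?_⟩
    rw [hI, Nat.lt_succ_iff]

end RealRAM

/-! ### The values of the clipped vertices and the height of the table -/

/-- The multiples of `ε * δ / 3` in `[0, δ]`, and `2 * δ`. -/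
noncomputable def valueSet (δ ε : ℝ) : Finset ℝ :=
  insert (2 * δ) ((Finset.range (⌊3 / ε⌋₊ + 1)).image fun k : ℕ => (k : ℝ) * (ε * δ / 3))

section
variable {δ ε : ℝ}

theorem clip_mem_valueSet (hδ : 0 < δ) (hε : 0 < ε) {x : ℝ} (hx : 0 ≤ x)
    (hk : ∃ k : ℤ, x = k * (ε * δ / 3)) : clip δ x ∈ valueSet δ ε := by
  obtain ⟨k, rfl⟩ := hk
  have hu : 0 < ε * δ / 3 := by positivity
  have hk0 : 0 ≤ k := by
    have := nonneg_of_mul_nonneg_left hx hu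
    exact_mod_cast this
  lift k to ℕ using hk0
  rw [Int.cast_natCast, clip, valueSet, Finset.mem_insert, Finset.mem_image]
  split_ifs with h
  · refine .inr ⟨k, Finset.mem_range.2 (Nat.lt_succ_iff.2 (Nat.le_floor ?_)), rfl⟩
    rw [le_div_iff₀ hε]
    by_contra h'
    have := mul_lt_mul_of_pos_right (not_le.1 h') hδ
    linarith
  · exact .inl rfl

theorem valueSet_bounds (hδ : 0 < δ) (hε : 0 < ε) {x : ℝ} (hx : x ∈ valueSet δ ε) :
    0 ≤ x ∧ x < 3 * δ := by
  rw [valueSet, Finset.mem_insert, Finset.mem_image] at hx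
  rcases hx with rfl | ⟨k, hk, rfl⟩
  · constructor <;> linarith
  · refine ⟨by positivity, ?_⟩
    have h1 : (k : ℝ) ≤ 3 / ε :=
      (Nat.le_floor_iff (by positivity)).1 (Nat.lt_succ_iff.1 (Finset.mem_range.1 hk))
    rw [le_div_iff₀ hε] at h1
    have := mul_le_mul_of_nonneg_right h1 hδ.le
    linarith

/-- The least `L` with `6 < 2 ^ L * ε`. -/
noncomputable def tableHeight (ε : ℝ) : ℕ := Nat.log 2 ⌊6 / ε⌋₊ + 1

theorem pow_mul_le_iff_lt_tableHeight (hε : 0 < ε) (hε1 : ε ≤ 1) (l : ℕ) :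
    2 ^ l * ε ≤ 6 ↔ l < tableHeight ε := by
  have h6 : 6 ≤ 6 / ε := by rw [le_div_iff₀ hε]; linarith
  have h0 : ⌊6 / ε⌋₊ ≠ 0 := by
    have := Nat.le_floor (n := 6) (a := 6 / ε) (by exact_mod_cast h6)
    omega
  rw [tableHeight, Nat.lt_succ_iff, Nat.le_log_iff_pow_le (by norm_num) h0,
    Nat.le_floor_iff (by positivity), le_div_iff₀ hε]
  push_cast
  rfl

theorem card_valueSet_le (hε : 0 < ε) (hε1 : ε ≤ 1) :
    (valueSet δ ε).card ≤ 2 ^ tableHeight ε := by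
  have h1 : (valueSet δ ε).card ≤ ⌊3 / ε⌋₊ + 2 := by
    refine (Finset.card_insert_le _ _).trans ?_
    have := Finset.card_image_le (s := Finset.range (⌊3 / ε⌋₊ + 1))
      (f := fun k : ℕ => (k : ℝ) * (ε * δ / 3))
    rw [Finset.card_range] at this
    omega
  have h2 : 6 / ε < 2 ^ tableHeight ε := by
    rw [div_lt_iff₀ hε]
    by_contra h
    exact lt_irrefl _ ((pow_mul_le_iff_lt_tableHeight hε hε1 _).1 (not_lt.1 h))
  have h3 : (⌊3 / ε⌋₊ : ℝ) ≤ 3 / ε := Nat.floor_le (by positivity)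
  have h4 : 3 ≤ 3 / ε := by rw [le_div_iff₀ hε]; linarith
  have h5 : 6 / ε = 3 / ε + 3 / ε := by ring
  have h6 : ((⌊3 / ε⌋₊ + 2 : ℕ) : ℝ) ≤ ((2 ^ tableHeight ε : ℕ) : ℝ) := by
    push_cast
    linarith
  exact h1.trans (by exact_mod_cast h6)

theorem tableHeight_le (hε : 0 < ε) (hε1 : ε ≤ 1) :
    (tableHeight ε : ℝ) + 1 ≤ 6 * (1 + Real.log (1 / ε)) := by
  have h1 : 2 ^ Nat.log 2 ⌊6 / ε⌋₊ * ε ≤ 6 :=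
    (pow_mul_le_iff_lt_tableHeight hε hε1 _).2 (Nat.lt_succ_self _)
  rw [tableHeight]
  generalize Nat.log 2 ⌊6 / ε⌋₊ = l at *
  have h2 : (2 : ℝ) ^ l ≤ 2 ^ 3 * (1 / ε) := by
    rw [mul_one_div, le_div_iff₀ hε]
    linarith
  have h3 := Real.log_le_log (by positivity) h2
  rw [Real.log_mul (by norm_num) (by positivity), Real.log_pow, Real.log_pow] at h3
  have h4 : 0 ≤ Real.log (1 / ε) := Real.log_nonneg (by rw [le_div_iff₀ hε]; linarith)
  have h5 := Real.log_two_gt_d9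
  push_cast at h3 ⊢
  have h6 : (l : ℝ) - 3 ≤ 2 * Real.log (1 / ε) := by
    by_contra h
    nlinarith
  nlinarith

end

/-! ### The complete program -/

namespace RealRAM

/-- The vertex of `π` whose index is the counter. -/
def piForward : RealExp := .get 0 (.reg 8)

/-- The vertex of `π` whose index, counted from the end, is the counter. -/
def piBackward : RealExp := .get 0 (.sub (.add (.reg 0) (.const 1)) (.reg 8))

/-- The vertex of `-σ` whose index is the counter. -/
def sigmaForward : RealExp := .sub (.const 0) (.get 1 (.reg 8))

/-- The vertex of `-σ` whose index, counted from the end, is the counter. -/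
def sigmaBackward : RealExp := .sub (.const 0) (.get 1 (.sub (.add (.reg 1) (.const 1)) (.reg 8)))

/-- The program for the reduced free-space problem: the barriers of the entries, the barriers of the
exits on `π` and these exits, the barriers of the exits on `σ` and these exits. -/
noncomputable def freeSpaceCmd : Cmd :=
  .seq (passCmd 0 1 piBackward sigmaForward) (.seq markCmd
    (.seq (passCmd 0 1 piForward sigmaBackward) (.seq boundsCmd (.seq scanPiCmd
      (.seq (passCmd 1 0 sigmaForward piBackward) scanSigmaCmd)))))

theorem haltsWith_freeSpaceCmd {s : State} {n m L : ℕ} {δ : ℝ} {α β a b : ℕ → ℝ} {S : Finset ℝ}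
    (hn : s.natReg 0 = n) (hm : s.natReg 1 = m) (hm1 : 1 ≤ m) (hδ : s.realReg 0 = δ) (hδ0 : 0 < δ)
    (hα : s.realArr 0 = α) (hβ : ∀ j, β j = 0 - s.realArr 1 j)
    (h1 : ∀ f, s.natArr 1 f = 0) (h2 : ∀ f, s.natArr 2 f = 0) (h6 : s.natArr 6 0 = 0)
    (ha : ∀ i, a i = clip δ (α i)) (hb : ∀ j, b j = clip δ (β j))
    (hL : 1 ≤ L) (hLε : ∀ l, 2 ^ l * s.realReg 1 ≤ 6 ↔ l < L) (hcard : S.card ≤ 2 ^ L)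
    (haS : ∀ i, 1 ≤ i → i ≤ n → a i ∈ S) (hbS : ∀ j, 1 ≤ j → j ≤ m → b j ∈ S)
    (hS0 : ∀ x ∈ S, 0 ≤ x) (hS3 : ∀ x ∈ S, x < 3 * δ) {Good : ℕ → Prop}
    (hG : ∀ e, Good e ↔ 1 ≤ s.natArr 0 e ∧ barrier (backwards n a) b δ m (n + 1 - e) = 0) :
    HaltsWith freeSpaceCmd (fun t s' => t ≤ 4000 * ((n + m + 1) * (L + 1)) ∧
      (∀ f, s'.natArr 1 f ≠ 0 ↔ 1 ≤ f ∧ f ≤ n ∧ barrier a (backwards m b) δ m f = 0 ∧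
        ∃ e, 1 ≤ e ∧ e ≤ f ∧ Good e ∧
          (∃ c, e ≤ c ∧ c ≤ f ∧ ∀ j ∈ Set.Icc 1 m, α c + β j ≤ δ) ∧
          ∀ x, e ≤ x → x ≤ f → ∃ j ∈ Set.Icc 1 m, α x + β j ≤ δ) ∧
      ∀ f, s'.natArr 2 f ≠ 0 ↔ 1 ≤ f ∧ f ≤ m ∧ barrier b (backwards n a) δ n f = 0 ∧
        ∃ e, 1 ≤ e ∧ e ≤ n ∧ Good e ∧
          (∃ c, e ≤ c ∧ c ≤ n ∧ ∀ j ∈ Set.Icc 1 f, α c + β j ≤ δ) ∧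
          ∀ x, e ≤ x → x ≤ n → ∃ j ∈ Set.Icc 1 f, α x + β j ≤ δ) s := by
  obtain rfl : a = fun i => clip δ (α i) := funext ha
  obtain rfl : b = fun j => clip δ (β j) := funext hb
  have hpiF : ∀ s', s'.realArr 0 = s.realArr 0 → ∀ i, s'.natReg 8 = i →
      piForward.eval s' = α i := by
    intro s' e i h8
    simp only [piForward, RealExp.eval, NatExp.eval, e, hα, h8]
  have hpiB : ∀ s', s'.realArr 0 = s.realArr 0 → s'.natReg 0 = n → ∀ i, s'.natReg 8 = i →
      piBackward.eval s' = α (n + 1 - i) := by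
    intro s' e e' i h8
    simp only [piBackward, RealExp.eval, NatExp.eval, e, e', hα, h8]
  have hsiF : ∀ s', s'.realArr 1 = s.realArr 1 → ∀ i, s'.natReg 8 = i →
      sigmaForward.eval s' = β i := by
    intro s' e i h8
    simp only [sigmaForward, RealExp.eval, NatExp.eval, e, hβ, h8, Rat.cast_zero]
  have hsiB : ∀ s', s'.realArr 1 = s.realArr 1 → s'.natReg 1 = m → ∀ i, s'.natReg 8 = i →
      sigmaBackward.eval s' = β (m + 1 - i) := by
    intro s' e e' i h8
    simp only [sigmaBackward, RealExp.eval, NatExp.eval, e, e', hβ, h8, Rat.cast_zero]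
  rw [freeSpaceCmd, haltsWith_seq]
  refine (haltsWith_passCmd (B := β) (S := S) (by decide) hn hm hδ hδ0 hL hLε hcard (by decide)
    (by decide) (fun s' i h => hpiB s' h.pi (h.n.trans hn) i) (fun s' i h => hsiF s' h.sigma i)
    (fun x h1 h2 => haS _ (by omega) (by omega)) hbS hS0 hS3).mono ?_
  rintro t₁ s₁ ⟨ht₁, hD₁, k₁⟩
  rw [haltsWith_seq]
  refine (haltsWith_markCmd (k₁.n.trans hn) (by rw [k₁.marks, h6]) (Good := Good)
    (fun e he hen => ?_)).mono ?_
  · rw [k₁.entries, hD₁ _ (by omega) (by omega), hG]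
    rfl
  rintro t₂ s₂ ⟨ht₂, hG₂, f₂⟩
  have n₂ : s₂.natReg 0 = n := (f₂.natReg 0 (by decide)).trans (k₁.n.trans hn)
  have m₂ : s₂.natReg 1 = m := (f₂.natReg 1 (by decide)).trans (k₁.m.trans hm)
  have δ₂ : s₂.realReg 0 = δ := (f₂.realReg 0 (by decide)).trans (k₁.delta.trans hδ)
  have ε₂ : s₂.realReg 1 = s.realReg 1 := (f₂.realReg 1 (by decide)).trans k₁.eps
  have π₂ : s₂.realArr 0 = s.realArr 0 := (f₂.realArr 0 (by decide)).trans k₁.pi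
  have σ₂ : s₂.realArr 1 = s.realArr 1 := (f₂.realArr 1 (by decide)).trans k₁.sigma
  have x₂ : s₂.natArr 1 = s.natArr 1 := (f₂.natArr 1 (by decide)).trans k₁.exitsPi
  have y₂ : s₂.natArr 2 = s.natArr 2 := (f₂.natArr 2 (by decide)).trans k₁.exitsSigma
  rw [haltsWith_seq]
  refine (haltsWith_passCmd (A := α) (B := fun j => β (m + 1 - j)) (S := S) (by decide) n₂ m₂ δ₂
    hδ0 hL (by rwa [ε₂]) hcard (by decide) (by decide)
    (fun s' i h => hpiF s' (h.pi.trans π₂) i)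
    (fun s' i h => hsiB s' (h.sigma.trans σ₂) (h.m.trans m₂) i) haS
    (fun x h1 h2 => hbS _ (by omega) (by omega)) hS0 hS3).mono ?_
  rintro t₃ s₃ ⟨ht₃, hD₃, k₃⟩
  rw [haltsWith_seq]
  refine (haltsWith_boundsCmd (δ := δ) (β := β) (k₃.m.trans m₂) hm1
    (by rw [k₃.sigma, σ₂]; exact hβ)).mono ?_
  rintro t₄ s₄ ⟨ht₄, hT₄, f₄⟩
  have n₄ : s₄.natReg 0 = n := (f₄.natReg 0 (by decide)).trans (k₃.n.trans n₂)
  have m₄ : s₄.natReg 1 = m := (f₄.natReg 1 (by decide)).trans (k₃.m.trans m₂)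
  have δ₄ : s₄.realReg 0 = δ := (f₄.realReg 0 (by decide)).trans (k₃.delta.trans δ₂)
  have ε₄ : s₄.realReg 1 = s.realReg 1 := (f₄.realReg 1 (by decide)).trans (k₃.eps.trans ε₂)
  have π₄ : s₄.realArr 0 = s.realArr 0 := (f₄.realArr 0 (by decide)).trans (k₃.pi.trans π₂)
  have σ₄ : s₄.realArr 1 = s.realArr 1 := (f₄.realArr 1 (by decide)).trans (k₃.sigma.trans σ₂)
  have x₄ : s₄.natArr 1 = s.natArr 1 := (f₄.natArr 1 (by decide)).trans (k₃.exitsPi.trans x₂)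
  have y₄ : s₄.natArr 2 = s.natArr 2 := (f₄.natArr 2 (by decide)).trans (k₃.exitsSigma.trans y₂)
  have g₄ : s₄.natArr 6 = s₂.natArr 6 := (f₄.natArr 6 (by decide)).trans k₃.marks
  have d₄ : s₄.natArr 5 = s₃.natArr 5 := f₄.natArr 5 (by decide)
  rw [haltsWith_seq]
  refine (haltsWith_scanPiCmd (Good := Good) (Full := fun x => ∀ j ∈ Set.Icc 1 m, α x + β j ≤ δ)
    (Blocked := fun x => ¬ ∃ j ∈ Set.Icc 1 m, α x + β j ≤ δ) n₄ (by rwa [x₄]) (by rwa [g₄])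
    (fun x => by rw [π₄, hα, δ₄, hT₄.1]) (fun x => by rw [π₄, hα, δ₄, hT₄.2])).mono ?_
  rintro t₅ s₅ ⟨ht₅, hX₅, f₅⟩
  have n₅ : s₅.natReg 0 = n := (f₅.natReg 0 (by decide)).trans n₄
  have m₅ : s₅.natReg 1 = m := (f₅.natReg 1 (by decide)).trans m₄
  have δ₅ : s₅.realReg 0 = δ := (f₅.realReg 0 (by decide)).trans δ₄
  have ε₅ : s₅.realReg 1 = s.realReg 1 := (f₅.realReg 1 (by decide)).trans ε₄
  have π₅ : s₅.realArr 0 = s.realArr 0 := (f₅.realArr 0 (by decide)).trans π₄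
  have σ₅ : s₅.realArr 1 = s.realArr 1 := (f₅.realArr 1 (by decide)).trans σ₄
  have y₅ : s₅.natArr 2 = s.natArr 2 := (f₅.natArr 2 (by decide)).trans y₄
  have g₅ : s₅.natArr 6 = s₂.natArr 6 := (f₅.natArr 6 (by decide)).trans g₄
  rw [haltsWith_seq]
  refine (haltsWith_passCmd (A := β) (B := fun i => α (n + 1 - i)) (S := S) (by decide) m₅ n₅ δ₅
    hδ0 hL (by rwa [ε₅]) hcard (by decide) (by decide)
    (fun s' i h => hsiF s' (h.sigma.trans σ₅) i)
    (fun s' i h => hpiB s' (h.pi.trans π₅) (h.n.trans n₅) i) hbS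
    (fun x h1 h2 => haS _ (by omega) (by omega)) hS0 hS3).mono ?_
  rintro t₆ s₆ ⟨ht₆, hD₆, k₆⟩
  refine (haltsWith_scanSigmaCmd (Good := Good) (α := α) (β := β) (δ := δ) (k₆.n.trans n₅)
    (k₆.m.trans m₅) (k₆.delta.trans δ₅) (by rwa [k₆.exitsSigma, y₅]) (by rwa [k₆.marks, g₅])
    (by rw [k₆.pi, π₅, hα]) (by rw [k₆.sigma, σ₅]; exact hβ)).mono ?_
  rintro t₇ s₇ ⟨ht₇, hX₇, f₇⟩
  refine ⟨?_, fun f => ?_, fun f => ?_⟩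
  · have e1 : (m + n + 1) * (L + 1) = (n + m + 1) * (L + 1) := by rw [Nat.add_comm m n]
    have e2 : n + m + 1 ≤ (n + m + 1) * (L + 1) := Nat.le_mul_of_pos_right _ (by omega)
    rw [e1] at ht₆
    generalize (n + m + 1) * (L + 1) = T at *
    omega
  · rw [f₇.natArr 1 (by decide), k₆.exitsPi, hX₅, d₄]
    refine and_congr_right fun hf1 => and_congr_right fun hfn => ?_
    rw [hD₃ f hf1 hfn]
    simp only [not_not]
    rfl
  · rw [hX₇]
    refine and_congr_right fun hf1 => and_congr_right fun hfm => ?_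
    rw [hD₆ f hf1 hfm]
    rfl

end RealRAM

/-! ### The reduced free-space problem -/

theorem mainTheorem5 :
    ∃ (prog : RealRAM.Cmd) (C : ℝ),
      ∀ (n m : ℕ) (π σ : ℕ → ℝ) (δ ε : ℝ) (E : Finset ℕ),
        IsReducedFreeSpaceInstance n m π σ δ ε E →
        ∃ (t : ℕ) (s : RealRAM.State),
          RealRAM.Exec prog (reducedFreeSpaceInput n m π σ δ ε E) t s ∧
          (t : ℝ) ≤ C * ((n : ℝ) + (m : ℝ)) * (1 + Real.log (1 / ε)) ∧
          s.output 1 = exitsOnPi n m π σ δ E ∧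
          s.output 2 = exitsOnSigma n m π σ δ E := by
  refine ⟨RealRAM.freeSpaceCmd, 48000, fun n m π σ δ ε E h => ?_⟩
  obtain ⟨hn, hm, hδ, hε, hε1, hπ, hσ, hπk, hσk, hE⟩ := h
  simp only [Finset.mem_Icc, and_imp] at hπ hσ hπk hσk
  set s := reducedFreeSpaceInput n m π σ δ ε E with hs
  set α : ℕ → ℝ := s.realArr 0 with hα
  set β : ℕ → ℝ := fun j => 0 - s.realArr 1 j with hβ
  set a : ℕ → ℝ := fun i => clip δ (α i) with ha
  set b : ℕ → ℝ := fun j => clip δ (β j) with hb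
  have hαπ : ∀ i, 1 ≤ i → i ≤ n → α i = π i := fun i h1 h2 => by
    simp [hα, hs, reducedFreeSpaceInput, h1, h2]
  have hβσ : ∀ j, 1 ≤ j → j ≤ m → β j = - σ j := fun j h1 h2 => by
    simp [hβ, hs, reducedFreeSpaceInput, h1, h2]
  have hα0 : ∀ i, 1 ≤ i → i ≤ n → 0 ≤ α i := fun i h1 h2 => by
    rw [hαπ i h1 h2]
    exact hπ i h1 h2
  have hβ0 : ∀ j, 1 ≤ j → j ≤ m → 0 ≤ β j := fun j h1 h2 => by
    rw [hβσ j h1 h2]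
    exact neg_nonneg.2 (hσ j h1 h2)
  have haS : ∀ i, 1 ≤ i → i ≤ n → a i ∈ valueSet δ ε := fun i h1 h2 =>
    clip_mem_valueSet hδ hε (hα0 i h1 h2) (by rw [hαπ i h1 h2]; exact hπk i h1 h2)
  have hbS : ∀ j, 1 ≤ j → j ≤ m → b j ∈ valueSet δ ε := fun j h1 h2 => by
    refine clip_mem_valueSet hδ hε (hβ0 j h1 h2) ?_
    obtain ⟨k, hk⟩ := hσk j h1 h2
    exact ⟨-k, by rw [hβσ j h1 h2, hk]; push_cast; ring⟩
  have hfree : ∀ i j, 1 ≤ i → i ≤ n → 1 ≤ j → j ≤ m → (a i + b j ≤ δ ↔ α i + β j ≤ δ) :=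
    fun i j h1 h2 h3 h4 => clip_add_clip_le_iff hδ (hα0 i h1 h2) (hβ0 j h3 h4)
  have hab : ∀ i j, 1 ≤ i → i ≤ n → 1 ≤ j → j ≤ m → (a i + b j ≤ δ ↔ π i - σ j ≤ δ) :=
    fun i j h1 h2 h3 h4 => by
      rw [hfree i j h1 h2 h3 h4, hαπ i h1 h2, hβσ j h3 h4, sub_eq_add_neg]
  have hcell : ∀ i j, 1 ≤ i → i ≤ n → 1 ≤ j → j ≤ m →
      (FreeCell a b δ n m i j ↔ α i + β j ≤ δ) := fun i j h1 h2 h3 h4 =>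
    ⟨fun h => (hfree i j h1 h2 h3 h4).1 h.2.2,
      fun h => ⟨⟨h1, h2⟩, ⟨h3, h4⟩, (hfree i j h1 h2 h3 h4).2 h⟩⟩
  have hEn : ∀ e, e ∈ E → 1 ≤ e ∧ e ≤ n := fun e he => Finset.mem_Icc.1 (hE he)
  have harr : ∀ e, 1 ≤ s.natArr 0 e ↔ e ∈ E := fun e => by
    simp only [hs, reducedFreeSpaceInput, true_and]
    split_ifs with h <;> simp [h]
  have hbd := fun x hx => valueSet_bounds (δ := δ) (ε := ε) (x := x) hδ hε hx
  obtain ⟨t, s', hexec, ht, hX, hY⟩ := RealRAM.haltsWith_freeSpaceCmd (s := s) (n := n) (m := m)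
    (L := tableHeight ε) (δ := δ) (α := α) (β := β) (a := a) (b := b) (S := valueSet δ ε)
    (Good := fun e => e ∈ E ∧ barrier (backwards n a) b δ m (n + 1 - e) = 0)
    rfl rfl hm rfl hδ rfl (fun _ => rfl) (fun f => by simp [hs, reducedFreeSpaceInput])
    (fun f => by simp [hs, reducedFreeSpaceInput]) (by simp [hs, reducedFreeSpaceInput])
    (fun _ => rfl) (fun _ => rfl) (Nat.le_add_left 1 _)
    (fun l => pow_mul_le_iff_lt_tableHeight hε hε1 l) (card_valueSet_le hε hε1) haS hbS
    (fun x hx => (hbd x hx).1) (fun x hx => (hbd x hx).2) (fun e => by rw [harr])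
  refine ⟨t, s', hexec, ?_, ?_, ?_⟩
  · have h1 : (t : ℝ) ≤ 4000 * ((n + m + 1) * (tableHeight ε + 1)) := by exact_mod_cast ht
    have h2 : (n : ℝ) + m + 1 ≤ 2 * (n + m) := by
      have : (1 : ℝ) ≤ n := by exact_mod_cast hn
      have : (1 : ℝ) ≤ m := by exact_mod_cast hm
      linarith
    have h3 := mul_le_mul h2 (tableHeight_le hε hε1) (by positivity) (by positivity)
    linarith
  · ext f
    change s'.natArr 1 f ≠ 0 ↔ _
    rw [hX]
    change _ ↔ (1 ≤ f ∧ f ≤ n) ∧ _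
    rw [← and_assoc]
    refine and_congr_right fun ⟨hf1, hfn⟩ => ?_
    have key : ∀ e ∈ E, e ≤ f → (discreteFrechetDist π e f σ 1 m ≤ ENNReal.ofReal δ ↔
        barrier (backwards n a) b δ m (n + 1 - e) = 0 ∧ barrier a (backwards m b) δ m f = 0 ∧
          (∃ c, e ≤ c ∧ c ≤ f ∧ ∀ j ∈ Set.Icc 1 m, α c + β j ≤ δ) ∧
          ∀ x, e ≤ x → x ≤ f → ∃ j ∈ Set.Icc 1 m, α x + β j ≤ δ) := fun e he hef => by
      obtain ⟨he1, hen⟩ := hEn e he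
      rw [discreteFrechetDist_le_iff hδ hπ hσ hab he1 hfn le_rfl,
        risePath_top_iff hδ (fun x h1 h2 => (hbd _ (haS x h1 h2)).1) hm he1 hfn]
      refine and_congr_right fun _ => and_congr_right fun _ => and_congr ?_ ?_
      · refine exists_congr fun c => and_congr_right fun h1 => and_congr_right fun h2 =>
          forall_congr' fun j => ?_
        rw [Set.mem_Icc, and_imp]
        refine imp_congr_right fun h3 => imp_congr_right fun h4 => ?_
        exact hcell c j (by omega) (by omega) h3 h4
      · refine forall_congr' fun x => imp_congr_right fun h1 => imp_congr_right fun h2 =>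
          exists_congr fun j => ?_
        rw [Set.mem_Icc, and_assoc]
        refine and_congr_right fun h3 => and_congr_right fun h4 => ?_
        exact hcell x j (by omega) (by omega) h3 h4
    constructor
    · rintro ⟨h1, e, -, hef, ⟨he, h2⟩, h3⟩
      exact ⟨e, he, hef, (key e he hef).2 ⟨h2, h1, h3⟩⟩
    · rintro ⟨e, he, hef, h⟩
      obtain ⟨h2, h1, h3⟩ := (key e he hef).1 h
      exact ⟨h1, e, (hEn e he).1, hef, ⟨he, h2⟩, h3⟩
  · ext f
    change s'.natArr 2 f ≠ 0 ↔ _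
    rw [hY]
    change _ ↔ (1 ≤ f ∧ f ≤ m) ∧ _
    rw [← and_assoc]
    refine and_congr_right fun ⟨hf1, hfm⟩ => ?_
    have key : ∀ e ∈ E, (discreteFrechetDist π e n σ 1 f ≤ ENNReal.ofReal δ ↔
        barrier (backwards n a) b δ m (n + 1 - e) = 0 ∧ barrier b (backwards n a) δ n f = 0 ∧
          (∃ c, e ≤ c ∧ c ≤ n ∧ ∀ j ∈ Set.Icc 1 f, α c + β j ≤ δ) ∧
          ∀ x, e ≤ x → x ≤ n → ∃ j ∈ Set.Icc 1 f, α x + β j ≤ δ) := fun e he => by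
      obtain ⟨he1, hen⟩ := hEn e he
      rw [discreteFrechetDist_le_iff hδ hπ hσ hab he1 le_rfl hfm,
        risePath_right_iff hδ (fun x h1 h2 => (hbd _ (haS x h1 h2)).1)
          (fun x h1 h2 => (hbd _ (haS x h1 h2)).2) (fun x h1 h2 => (hbd _ (hbS x h1 h2)).1)
          (fun x h1 h2 => (hbd _ (hbS x h1 h2)).2) he1 hen hf1 hfm]
      refine and_congr_right fun _ => and_congr_right fun _ => and_congr ?_ ?_
      · refine exists_congr fun c => and_congr_right fun h1 => and_congr_right fun h2 =>
          forall_congr' fun j => ?_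
        rw [Set.mem_Icc, and_imp]
        refine imp_congr_right fun h3 => imp_congr_right fun h4 => ?_
        exact hcell c j (by omega) (by omega) h3 (by omega)
      · refine forall_congr' fun x => imp_congr_right fun h1 => imp_congr_right fun h2 =>
          exists_congr fun j => ?_
        rw [Set.mem_Icc, and_assoc]
        refine and_congr_right fun h3 => and_congr_right fun h4 => ?_
        exact hcell x j (by omega) (by omega) h3 (by omega)
    constructor
    · rintro ⟨h1, e, -, hen, ⟨he, h2⟩, h3⟩
      exact ⟨e, he, (key e he).2 ⟨h2, h1, h3⟩⟩
    · rintro ⟨e, he, h⟩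
      obtain ⟨h2, h1, h3⟩ := (key e he).1 h
      exact ⟨h1, e, (hEn e he).1, (hEn e he).2, ⟨he, h2⟩, h3⟩
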